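/- Let $N\ge 1$ and $0\le m\le N$. Let $t^{1/2},a,b,c,d\in\mathbb C$ with $t^{1/2}\neq 0$, $t\neq 1$ and $a,b,c,d\neq 1$, and put $$\alpha=\frac{(t^{1/2}-t^{-1/2})ab}{(a-1)(b-1)},\quad \gamma=\frac{t^{-1/2}-t^{1/2}}{(a-1)(b-1)},\quad \beta=\frac{(t^{1/2}-t^{-1/2})cd}{(c-1)(d-1)},\quad \delta=\frac{t^{-1/2}-t^{1/2}}{(c-1)(d-1)}.$$ Let $V$ have basis $v_{-1},v_0,v_1$ (empty site, second class particle, first class particle), let $E^{(j,i)}\in\mathrm{End}(V)$ send $v_i$ to $v_j$ and the other basis vectors to $0$, and let $$\mathbf e=\sum_{i,j=-1}^{1}t^{\frac12\mathrm{sign}(j-i)}\left(E^{(i,j)}\otimes E^{(j,i)}-E^{(j,j)}\otimes E^{(i,i)}\right),$$ $$\mathbf f(\rho,\sigma)=\rho\,(E^{(-1,1)}-E^{(1,1)})+\sigma\,(E^{(1,-1)}-E^{(-1,-1)}).$$ On $V^{\otimes N}$ let $\mathbf e_i$ be $\mathbf e$ acting on the factors $i,i+1$, let $\mathbf f_i$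 be $\mathbf f$ acting on the factor $i$, and set $$\check R_i(z)=1+\frac{z-1}{t^{1/2}z-t^{-1/2}}\,\mathbf e_i,\quad K_1(z)=1+\frac{z^2-1}{(z-a)(z-b)}\,\gamma^{-1}\mathbf f_1(\gamma,\alpha),\quad K_N(z)=1+\frac{1-z^2}{(cz-1)(dz-1)}\,\delta^{-1}\mathbf f_N(\beta,\delta).$$ For $1\le i\le N$ the scattering matrix is $$\begin{aligned}S_i(\mathbf z)={}&\check R_{i-1}(z_i/z_{i-1})\cdots\check R_1(z_i/z_1)\,K_1(z_i^{-1})\,\check R_1(z_iz_1)\cdots\check R_{i-1}(z_iz_{i-1})\\ &\check R_i(z_iz_{i+1})\cdots\check R_{N-1}(z_iz_N)\,K_N(z_i)\,\check R_{N-1}(z_i/z_N)\cdots\check R_i(z_i/z_{i+1}).\end{aligned}$$ Let $H_{N,m}\subset V^{\otimes N}$ be the span of the basis vectors with exactly $m$ factors $v_0$. Then there is a nonzero vector $\Psi_{N,m}(\mathbf z)\in H_{N,m}\otimes\mathbb C[z_1^{\pm1},\dots,z_N^{\pm1}]$ with $S_i(\mathbf z)\Psi_{N,m}=\Psi_{N,m}$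 for all $1\le i\le N$, which satisfies $$\check R_i(z_i/z_{i+1})\Psi_{N,m}=\mathbf s_i\Psi_{N,m}\ (1\le i\le N-1),\qquad K_1(z_1)\Psi_{N,m}=\mathbf s_0\Psi_{N,m},\qquad K_N(z_N)\Psi_{N,m}=\mathbf s_N\Psi_{N,m},$$ where $\mathbf s_i$ exchanges $z_i$ and $z_{i+1}$, $\mathbf s_0$ exchanges $z_1$ and $z_1^{-1}$, and $\mathbf s_N$ exchanges $z_N$ and $z_N^{-1}$. Moreover, if $t^{1/2}$ and the rates $\alpha,\beta,\gamma,\delta$ are real and positive, then $\Psi_{N,m}$ is the unique stationary solution up to normalisation: every $\Phi\in H_{N,m}\otimes\mathbb C(z_1,\dots,z_N)$ with $S_i(\mathbf z)\Phi=\Phi$ for all $i$ is of the form $r\,\Psi_{N,m}$ with $r\in\mathbb C(z_1,\dots,z_N)$. -/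

import Mathlib

open Matrix

noncomputable section

namespace OpenTwoASEP

/-- The parameters of the model: `τ` is the chosen square root `t^{1/2}`, and `a, b, c, d`
parametrise the boundary rates. -/
structure Params (F : Type*) where
  τ : F
  a : F
  b : F
  c : F
  d : F

/-- Transport of the parameters along a map. -/
def Params.map {F G : Type*} (φ : F → G) (p : Params F) : Params G :=
  ⟨φ p.τ, φ p.a, φ p.b, φ p.c, φ p.d⟩

section Rates

variable {F : Type*} [Field F]

/-- Injection rate of a first class particle at the first site. -/
def Params.α (p : Params F) : F := (p.τ - p.τ⁻¹) * p.a * p.b / ((p.a - 1) * (p.b - 1))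

/-- Removal rate of a first class particle at the first site. -/
def Params.γ (p : Params F) : F := (p.τ⁻¹ - p.τ) / ((p.a - 1) * (p.b - 1))

/-- Removal rate of a first class particle at the last site. -/
def Params.β (p : Params F) : F := (p.τ - p.τ⁻¹) * p.c * p.d / ((p.c - 1) * (p.d - 1))

/-- Injection rate of a first class particle at the last site. -/
def Params.δ (p : Params F) : F := (p.τ⁻¹ - p.τ) / ((p.c - 1) * (p.d - 1))

end Rates

open scoped ComplexOrder in
/-- All the rates of the Markov chain are positive real numbers: the bulk rates `t^{1/2}` and
`t^{-1/2}`, and the boundary rates `α, β, γ, δ`. In the order on `ℂ` used here, `0 < x` means that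
`x` is real and positive. -/
def Params.PositiveRates (p : Params ℂ) : Prop :=
  0 < p.τ ∧ 0 < p.α ∧ 0 < p.β ∧ 0 < p.γ ∧ 0 < p.δ

/-- Configurations on `N` sites: `-1` is an empty site, `0` a second class particle, `1` a first
class particle. They index the basis of `V₁ ⊗ ⋯ ⊗ V_N`, so that vectors of this space are functions
on `Config N` and operators are matrices indexed by `Config N`. -/
abbrev Config (N : ℕ) : Type := Fin N → SignType

/-- The vector `ψ` lies in the sector with exactly `m` second class particles. -/
def InSector {R : Type*} [Zero R] {N : ℕ} (m : ℕ) (ψ : Config N → R) : Prop :=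
  ∀ w : Config N, (Finset.univ.filter fun i => w i = 0).card ≠ m → ψ w = 0

section Operators

variable {F : Type*} [Field F]

/-- The local operator `e` on `V ⊗ V`. The matrix unit `single j i 1` sends `v_i` to `v_j`. -/
def bulkLocal (τ : F) : Matrix (SignType × SignType) (SignType × SignType) F :=
  ∑ i : SignType, ∑ j : SignType,
    τ ^ ((SignType.sign ((j : ℤ) - (i : ℤ)) : SignType) : ℤ) •
      (kroneckerMap (· * ·) (Matrix.single i j (1 : F)) (Matrix.single j i (1 : F)) -
        kroneckerMap (· * ·) (Matrix.single j j (1 : F)) (Matrix.single i i (1 : F)))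

/-- The local operator `f(ρ, σ)` on `V`: a first class particle is removed with rate `ρ`
and injected with rate `σ`. -/
def boundaryLocal (ρ σ : F) : Matrix SignType SignType F :=
  ρ • (Matrix.single (-1) 1 (1 : F) - Matrix.single 1 1 (1 : F)) +
    σ • (Matrix.single 1 (-1) (1 : F) - Matrix.single (-1) (-1) (1 : F))

/-- The operator acting as `A` on the tensor factor `i` and as the identity on the others. -/
def atSite {N : ℕ} (i : Fin N) (A : Matrix SignType SignType F) :
    Matrix (Config N) (Config N) F :=
  Matrix.of fun w v => if ∀ k, k ≠ i → w k = v k then A (w i) (v i) else 0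

/-- The operator acting as `B` on the neighbouring tensor factors `j`, `j + 1` and as the identity
on the others. -/
def atBond {n : ℕ} (j : Fin n) (B : Matrix (SignType × SignType) (SignType × SignType) F) :
    Matrix (Config (n + 1)) (Config (n + 1)) F :=
  Matrix.of fun w v =>
    if ∀ k, k ≠ j.castSucc → k ≠ j.succ → w k = v k then
      B (w j.castSucc, w j.succ) (v j.castSucc, v j.succ) else 0

/-- The baxterised matrix `Ř_j(z)`, acting on the sites `j` and `j + 1`. -/
def Rmat {n : ℕ} (p : Params F) (j : Fin n) (z : F) : Matrix (Config (n + 1)) (Config (n + 1)) F :=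
  1 + ((z - 1) / (p.τ * z - p.τ⁻¹)) • atBond j (bulkLocal p.τ)

/-- The boundary matrix `K_1(z)`, acting on the first site. -/
def K1mat {n : ℕ} (p : Params F) (z : F) : Matrix (Config (n + 1)) (Config (n + 1)) F :=
  1 + ((z ^ 2 - 1) / ((z - p.a) * (z - p.b)) * p.γ⁻¹) • atSite 0 (boundaryLocal p.γ p.α)

/-- The boundary matrix `K_N(z)`, acting on the last site. -/
def KNmat {n : ℕ} (p : Params F) (z : F) : Matrix (Config (n + 1)) (Config (n + 1)) F :=
  1 + ((1 - z ^ 2) / ((p.c * z - 1) * (p.d * z - 1)) * p.δ⁻¹) •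
    atSite (Fin.last n) (boundaryLocal p.β p.δ)

/-- The bonds `(j, j + 1)` to the left of the site `i`, from left to right. -/
def leftBonds {n : ℕ} (i : Fin (n + 1)) : List (Fin n) :=
  (List.finRange n).filter fun j => j.castSucc < i

/-- The bonds `(j, j + 1)` to the right of the site `i`, from left to right. -/
def rightBonds {n : ℕ} (i : Fin (n + 1)) : List (Fin n) :=
  (List.finRange n).filter fun j => i ≤ j.castSucc

/-- The scattering matrix `S_i(z_1, …, z_N)`, with `N = n + 1`:
`Ř_{i-1}(z_i/z_{i-1}) ⋯ Ř_1(z_i/z_1) K_1(1/z_i) Ř_1(z_i z_1) ⋯ Ř_{i-1}(z_i z_{i-1})`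
`Ř_i(z_i z_{i+1}) ⋯ Ř_{N-1}(z_i z_N) K_N(z_i) Ř_{N-1}(z_i/z_N) ⋯ Ř_i(z_i/z_{i+1})`. -/
def scattering {n : ℕ} (p : Params F) (z : Fin (n + 1) → F) (i : Fin (n + 1)) :
    Matrix (Config (n + 1)) (Config (n + 1)) F :=
  ((leftBonds i).reverse.map fun j => Rmat p j (z i / z j.castSucc)).prod *
    K1mat p (z i)⁻¹ *
    ((leftBonds i).map fun j => Rmat p j (z i * z j.castSucc)).prod *
    ((rightBonds i).map fun j => Rmat p j (z i * z j.succ)).prod *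
    KNmat p (z i) *
    ((rightBonds i).reverse.map fun j => Rmat p j (z i / z j.succ)).prod

end Operators

/-- The ring `ℂ[z_1^{±1}, …, z_N^{±1}]` of Laurent polynomials. -/
abbrev Laurent (N : ℕ) : Type := AddMonoidAlgebra ℂ (Fin N → ℤ)

/-- The field `ℂ(z_1, …, z_N)` of rational functions. -/
abbrev RatField (N : ℕ) : Type := FractionRing (Laurent N)

/-- The spectral parameter `z_i`, as a rational function. -/
def zvar {N : ℕ} (i : Fin N) : RatField N :=
  algebraMap (Laurent N) (RatField N) (AddMonoidAlgebra.single (Pi.single i 1) 1)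

/-- The complex parameters as constants in the field of rational functions. -/
def Params.const (N : ℕ) (p : Params ℂ) : Params (RatField N) :=
  p.map (algebraMap ℂ (RatField N))

/-- A vector of Laurent polynomials, regarded as a vector of rational functions. -/
def toRat {N : ℕ} (Ψ : Config N → Laurent N) : Config N → RatField N :=
  fun w => algebraMap (Laurent N) (RatField N) (Ψ w)

/-- The automorphism of the ring of Laurent polynomials that exchanges `z_i` and `z_j`. -/
def swapVar {N : ℕ} (i j : Fin N) : Laurent N ≃ₐ[ℂ] Laurent N :=
  AddMonoidAlgebra.domCongr ℂ ℂ
    { toFun := fun e k => e (Equiv.swap i j k)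
      invFun := fun e k => e (Equiv.swap i j k)
      left_inv := fun e => by funext k; simp
      right_inv := fun e => by funext k; simp
      map_add' := fun _ _ => rfl }

/-- The automorphism of the ring of Laurent polynomials that exchanges `z_i` and `z_i⁻¹`. -/
def invVar {N : ℕ} (i : Fin N) : Laurent N ≃ₐ[ℂ] Laurent N :=
  AddMonoidAlgebra.domCongr ℂ ℂ
    { toFun := fun e k => if k = i then -e k else e k
      invFun := fun e k => if k = i then -e k else e k
      left_inv := fun e => by funext k; by_cases h : k = i <;> simp [h]
      right_inv := fun e => by funext k; by_cases h : k = i <;> simp [h]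
      map_add' := fun e e' => by
        funext k
        by_cases h : k = i
        · simp [h, add_comm]
        · simp [h] }

/-- The vector `Φ` of rational functions solves `S_i(z) Φ(z) = Φ(z)` for every site `i`. -/
def IsScatteringInvariant {n : ℕ} (p : Params ℂ) (Φ : Config (n + 1) → RatField (n + 1)) : Prop :=
  ∀ i : Fin (n + 1), scattering (p.const (n + 1)) zvar i *ᵥ Φ = Φ

/-- The exchange-reflection equations for a vector `Ψ` of Laurent polynomials. -/
structure ExchangeReflection {n : ℕ} (p : Params ℂ) (Ψ : Config (n + 1) → Laurent (n + 1)) :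
    Prop where
  bulk : ∀ j : Fin n,
    Rmat (p.const (n + 1)) j (zvar j.castSucc / zvar j.succ) *ᵥ toRat Ψ =
      toRat fun w => swapVar j.castSucc j.succ (Ψ w)
  left : K1mat (p.const (n + 1)) (zvar 0) *ᵥ toRat Ψ = toRat fun w => invVar 0 (Ψ w)
  right : KNmat (p.const (n + 1)) (zvar (Fin.last n)) *ᵥ toRat Ψ =
    toRat fun w => invVar (Fin.last n) (Ψ w)

end OpenTwoASEP

end

/-! Write `N = n + 1`. To each bulk bond and each boundary attach the operator that first performs
the substitution of variables (`z_i ↔ z_{i+1}`, `z_1 ↔ 1/z_1`, `z_N ↔ 1/z_N`) and then applies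
`Ř_i(z_{i+1}/z_i)`, `K_1(1/z_1)` or `K_N(1/z_N)`. On vectors of rational functions these semilinear
operators `gen` satisfy the relations of the affine Weyl group of type `C` (`affineRelations_gen`):
unitarity gives the involutions, the Yang–Baxter equation the braid relations, the reflection
equations the quartic relations. All of this is baxterisation of the two-boundary Hecke relations
for the local generators. The exchange-reflection equations say exactly that `Ψ` is fixed by every
generator, and the scattering matrices are the translations of the group (`translation_gen`), whose
substitution is trivial. Existence is therefore the existence of a nonzero fixed vector in the
sector.

Translations commute, hence so do the `S_i`. Each `S_i` preserves the sector and has column sums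
one, so the sum of the entries is a common fixed functional. Linear algebra then yields a nonzero
common fixed vector (`exists_common_fixed`). The space of all such vectors is stable under the
generators, and the finite Weyl group generated by `T 1, …, T N` permutes and inverts the variables,
so a descent argument in the spirit of Galois theory produces a nonzero vector in it fixed by these
generators (`AffineRelations.exists_fixed`). The remaining generator `T 0` fixes it as well, because
the first translation is `T 0` times a word in the others. A common denominator is removed by its
norm over all signed permutations of the variables (`exists_laurent_fixed`).

For uniqueness, put the spectral parameters equal to `x, 1, …, 1`. Near `x = 1` the first scattering
matrix is `1 + (x - 1) · 2/(τ - τ⁻¹) · G` to first order, where `G` is the Markov generator of the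
process (`firstOrder_firstScattering`). With positive rates `G` is irreducible on the sector, so by
the maximum principle only constant functions on the sector are annihilated from the left, and `G`
has no kernel among vectors of total zero (`det_augmented_generator_ne_zero`). This is the
nonvanishing of a determinant, which persists for `x` near `1` and then for indeterminate
parameters. Hence an invariant vector is determined by its total, and two of them are proportional.
-/

namespace OpenTwoASEP

noncomputable section

/-! ### Hop operators -/

section Hop

variable {F X : Type*} [Field F] [Fintype X] [DecidableEq X]

/-- The Markov generator on functions for which `w` is reached from `π w` with rate `g w`. -/
def hop (g : X → F) (π : Equiv.Perm X) : Matrix X X F :=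
  Matrix.of fun w v => (if v = π w then g w else 0) - (if v = w then g (π w) else 0)

theorem hop_mulVec (g : X → F) (π : Equiv.Perm X) (ψ : X → F) (w : X) :
    (hop g π *ᵥ ψ) w = g w * ψ (π w) - g (π w) * ψ w := by
  simp [hop, Matrix.mulVec, dotProduct, sub_mul, Finset.sum_sub_distrib, ite_mul]

/-- Peels off the leftmost factor of a word in hop operators. Iterating it expands both sides of an
algebra relation into values of `ψ` at finitely many configurations, which is how the Hecke
relations below are checked. -/
theorem hop_mul_mulVec (g : X → F) (π : Equiv.Perm X) (A : Matrix X X F) (ψ : X → F) (w : X) :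
    ((hop g π * A) *ᵥ ψ) w = g w * (A *ᵥ ψ) (π w) - g (π w) * (A *ᵥ ψ) w := by
  rw [← Matrix.mulVec_mulVec, hop_mulVec]

theorem matrix_ext_mulVec {A B : Matrix X X F} (h : ∀ ψ w, (A *ᵥ ψ) w = (B *ᵥ ψ) w) : A = B :=
  Matrix.ext_of_mulVec_single fun _ => funext fun w => h _ w

/-- In column `v` the gain `g (π v)` sits in the row `π v` and the loss `g (π v)` on the diagonal.
That this row is the only one with a gain uses that `π` is an involution. -/
theorem one_vecMul_hop (g : X → F) (π : Equiv.Perm X) (hπ : ∀ w, π (π w) = w) :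
    (1 : X → F) ᵥ* hop g π = 0 := by
  funext v
  have h1 : ∀ w, (v = π w) ↔ (w = π v) := fun w =>
    ⟨fun h => by rw [h, hπ], fun h => by rw [h, hπ]⟩
  simp [hop, Matrix.vecMul, dotProduct, Finset.sum_sub_distrib, h1]

/-- Each pair `{w, π w}` carries a two-state chain with total rate `q`, whose generator squares to
`-q` times itself. At fixed points of `π` gain and loss cancel, so no condition is needed there. -/
theorem hop_sq {g : X → F} {π : Equiv.Perm X} (hπ : ∀ w, π (π w) = w) (q : F)
    (h : ∀ w, π w = w ∨ g w + g (π w) = q) : hop g π * hop g π = (-q) • hop g π := by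
  refine matrix_ext_mulVec fun ψ w => ?_
  rw [hop_mul_mulVec, Matrix.smul_mulVec, Pi.smul_apply, hop_mulVec, hop_mulVec, hπ, smul_eq_mul]
  rcases h w with h | h
  · rw [h]; ring
  · rw [← h]; ring

theorem hop_commute {g h : X → F} {π ρ : Equiv.Perm X} (hc : ∀ w, π (ρ w) = ρ (π w))
    (hg : ∀ w, g (ρ w) = g w) (hh : ∀ w, h (π w) = h w) : Commute (hop g π) (hop h ρ) := by
  have hh' : ∀ w, h (ρ (π w)) = h (ρ w) := fun w => by rw [← hc, hh]
  refine matrix_ext_mulVec fun ψ w => ?_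
  rw [hop_mul_mulVec, hop_mul_mulVec]
  simp only [hop_mulVec, hg, hh, hh', hc]
  ring

end Hop

/-! ### The local operators as hop operators -/

section Local

variable {F : Type*} [Field F]

/-- The configuration with the entries at two sites exchanged. -/
def swapSites {N : ℕ} (i j : Fin N) : Equiv.Perm (Config N) where
  toFun w := w ∘ Equiv.swap i j
  invFun w := w ∘ Equiv.swap i j
  left_inv w := by funext k; simp
  right_inv w := by funext k; simp

/-- The configuration with first class particle and empty site exchanged at site `i`. -/
def flipSite {N : ℕ} (i : Fin N) : Equiv.Perm (Config N) where
  toFun w := Function.update w i (-w i)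
  invFun w := Function.update w i (-w i)
  left_inv w := by simp
  right_inv w := by simp

theorem swapSites_apply {N : ℕ} (i j : Fin N) (w : Config N) (k : Fin N) :
    swapSites i j w k = w (Equiv.swap i j k) := rfl

theorem flipSite_apply {N : ℕ} (i : Fin N) (w : Config N) (k : Fin N) :
    flipSite i w k = if k = i then -w k else w k := by
  by_cases h : k = i
  · subst h; simp [flipSite]
  · simp [flipSite, h]

theorem swapSites_swapSites {N : ℕ} (i j : Fin N) (w : Config N) :
    swapSites i j (swapSites i j w) = w := by
  funext k; simp [swapSites_apply]

theorem flipSite_flipSite {N : ℕ} (i : Fin N) (w : Config N) :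
    flipSite i (flipSite i w) = w := by
  funext k; by_cases h : k = i <;> simp [flipSite_apply, h]

/-- The rate at which the ordered pair `(y, x)` turns into `(x, y)`. -/
def bulkRate (τ : F) (x y : SignType) : F :=
  τ ^ ((SignType.sign ((y : ℤ) - (x : ℤ)) : SignType) : ℤ)

/-- The rate at which the boundary process produces the local state `x`. -/
def boundaryRate (ρ σ : F) (x : SignType) : F :=
  if x = 1 then σ else if x = -1 then ρ else 0

theorem bulkLocal_apply (τ : F) (x y x' y' : SignType) :
    bulkLocal τ (x, y) (x', y') =
      (if x' = y ∧ y' = x then bulkRate τ x y else 0) -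
        (if x' = x ∧ y' = y then bulkRate τ y x else 0) := by
  -- For given matrix entries the first Kronecker product selects `(i, j) = (x, y)` and the second
  -- `(i, j) = (y, x)`, so the double sum collapses to one gain and one loss term.
  have : ∀ i j : SignType, (τ ^ ((SignType.sign ((j : ℤ) - (i : ℤ)) : SignType) : ℤ) •
      (kroneckerMap (· * ·) (Matrix.single i j (1 : F)) (Matrix.single j i (1 : F)) -
        kroneckerMap (· * ·) (Matrix.single j j (1 : F)) (Matrix.single i i (1 : F))))
        (x, y) (x', y') =
      (if i = x then (if j = y then (if x' = y ∧ y' = x then bulkRate τ x y else 0) else 0) else 0)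
      - (if i = y then (if j = x then (if x' = x ∧ y' = y then bulkRate τ y x else 0) else 0)
        else 0) := by
    intro i j
    simp only [Matrix.smul_apply, Matrix.sub_apply, kroneckerMap_apply, Matrix.single_apply,
      smul_eq_mul, mul_sub, bulkRate]
    congr 1
    · by_cases h1 : i = x <;> by_cases h2 : j = y <;> by_cases h3 : x' = y <;>
        by_cases h4 : y' = x <;> simp_all [eq_comm]
    · by_cases h1 : i = y <;> by_cases h2 : j = x <;> by_cases h3 : x' = x <;>
        by_cases h4 : y' = y <;> simp_all [eq_comm]
  simp only [bulkLocal, Matrix.sum_apply, this, Finset.sum_sub_distrib, Finset.sum_ite_eq',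
    Finset.mem_univ, if_true, Finset.sum_const_zero, Finset.sum_ite_irrel]

theorem boundaryLocal_apply (ρ σ : F) (x x' : SignType) :
    boundaryLocal ρ σ x x' =
      (if x' = -x then boundaryRate ρ σ x else 0) -
        (if x' = x then boundaryRate ρ σ (-x) else 0) := by
  cases x <;> cases x' <;>
    simp [boundaryLocal, boundaryRate]

theorem atBond_bulkLocal {n : ℕ} (τ : F) (j : Fin n) :
    atBond j (bulkLocal τ) =
      hop (fun w => bulkRate τ (w j.castSucc) (w j.succ)) (swapSites j.castSucc j.succ) := by
  have hne : j.castSucc ≠ j.succ := (Fin.castSucc_lt_succ).ne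
  ext w v
  have h1 : (v = swapSites j.castSucc j.succ w) ↔
      ((∀ k, k ≠ j.castSucc → k ≠ j.succ → w k = v k) ∧ v j.castSucc = w j.succ ∧
        v j.succ = w j.castSucc) := by
    constructor
    · rintro rfl
      refine ⟨fun k hk hk' => ?_, ?_, ?_⟩ <;> simp [swapSites_apply, Equiv.swap_apply_of_ne_of_ne, *]
    · rintro ⟨h, h2, h3⟩
      funext k
      by_cases hk : k = j.castSucc
      · subst hk; simp [swapSites_apply, h2]
      by_cases hk' : k = j.succ
      · subst hk'; simp [swapSites_apply, h3]
      rw [← h k hk hk', swapSites_apply, Equiv.swap_apply_of_ne_of_ne hk hk']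
  have h2 : (v = w) ↔
      ((∀ k, k ≠ j.castSucc → k ≠ j.succ → w k = v k) ∧ v j.castSucc = w j.castSucc ∧
        v j.succ = w j.succ) := by
    constructor
    · rintro rfl; simp
    · rintro ⟨h, h2, h3⟩
      funext k
      by_cases hk : k = j.castSucc
      · subst hk; exact h2
      by_cases hk' : k = j.succ
      · subst hk'; exact h3
      exact (h k hk hk').symm
  simp only [atBond, hop, Matrix.of_apply, bulkLocal_apply, h1, h2, swapSites_apply,
    Equiv.swap_apply_left, Equiv.swap_apply_right]
  by_cases h : ∀ k, k ≠ j.castSucc → k ≠ j.succ → w k = v k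
  · simp only [ite_and, if_pos h]
  · simp only [ite_and, if_neg h, sub_zero]

theorem atSite_boundaryLocal {N : ℕ} (ρ σ : F) (i : Fin N) :
    atSite i (boundaryLocal ρ σ) =
      hop (fun w => boundaryRate ρ σ (w i)) (flipSite i) := by
  ext w v
  have h1 : (v = flipSite i w) ↔ ((∀ k, k ≠ i → w k = v k) ∧ v i = - w i) := by
    constructor
    · rintro rfl
      refine ⟨fun k hk => ?_, ?_⟩ <;> simp [flipSite_apply, *]
    · rintro ⟨h, h2⟩
      funext k
      by_cases hk : k = i
      · subst hk; simp [flipSite_apply, h2]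
      rw [← h k hk, flipSite_apply, if_neg hk]
  have h2 : (v = w) ↔ ((∀ k, k ≠ i → w k = v k) ∧ v i = w i) := by
    constructor
    · rintro rfl; simp
    · rintro ⟨h, h2⟩
      funext k
      by_cases hk : k = i
      · subst hk; exact h2
      exact (h k hk).symm
  have h3 : flipSite i w i = - w i := by simp [flipSite_apply]
  simp only [atSite, hop, Matrix.of_apply, boundaryLocal_apply, h1, h2, h3]
  by_cases h : ∀ k, k ≠ i → w k = v k
  · simp only [ite_and, if_pos h]
  · simp only [ite_and, if_neg h, sub_zero]

end Local

/-! ### The defining relations of the two-boundary Hecke algebra -/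

section Relations

variable {F : Type*} [Field F] {N : ℕ}

/-- The bulk generator on the pair of sites `i`, `k`. -/
def bondHop (τ : F) (i k : Fin N) : Matrix (Config N) (Config N) F :=
  hop (fun w => bulkRate τ (w i) (w k)) (swapSites i k)

/-- The boundary generator on the site `i`. -/
def siteHop (ρ σ : F) (i : Fin N) : Matrix (Config N) (Config N) F :=
  hop (fun w => boundaryRate ρ σ (w i)) (flipSite i)

theorem bulkRate_of_sign_cases (τ : F) :
    (∀ x, bulkRate τ x x = 1) ∧ bulkRate τ (-1) 0 = τ ∧ bulkRate τ (-1) 1 = τ ∧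
      bulkRate τ 0 1 = τ ∧ bulkRate τ 0 (-1) = τ⁻¹ ∧ bulkRate τ 1 (-1) = τ⁻¹ ∧
      bulkRate τ 1 0 = τ⁻¹ := by
  refine ⟨fun x => ?_, ?_, ?_, ?_, ?_, ?_, ?_⟩ <;> simp [bulkRate]

/-- The configuration `w` with the entries at three sites replaced. -/
def put (w : Config N) (i j k : Fin N) (x y z : SignType) : Config N :=
  fun l => if l = i then x else if l = j then y else if l = k then z else w l

theorem put_self (w : Config N) (i j k : Fin N) : put w i j k (w i) (w j) (w k) = w := by
  funext l
  unfold put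
  split_ifs with h1 h2 h3 <;> simp [*]

theorem put_fst (w : Config N) (i j k : Fin N) (x y z : SignType) :
    put w i j k x y z i = x := by simp [put]

theorem put_snd (w : Config N) {i j : Fin N} (k : Fin N) (h : i ≠ j) (x y z : SignType) :
    put w i j k x y z j = y := by simp [put, h.symm]

theorem put_trd (w : Config N) {i j k : Fin N} (h : i ≠ k) (h' : j ≠ k) (x y z : SignType) :
    put w i j k x y z k = z := by simp [put, h.symm, h'.symm]

theorem swapSites_put_fst (w : Config N) {i j k : Fin N} (h1 : i ≠ j) (h2 : i ≠ k) (h3 : j ≠ k)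
    (x y z : SignType) : swapSites i j (put w i j k x y z) = put w i j k y x z := by
  funext l
  rw [swapSites_apply, Equiv.swap_apply_def]
  unfold put
  split_ifs <;> simp_all

theorem swapSites_put_snd (w : Config N) {i j k : Fin N} (h1 : i ≠ j) (h2 : i ≠ k) (h3 : j ≠ k)
    (x y z : SignType) : swapSites j k (put w i j k x y z) = put w i j k x z y := by
  funext l
  rw [swapSites_apply, Equiv.swap_apply_def]
  unfold put
  split_ifs <;> simp_all

theorem flipSite_put_fst (w : Config N) {i j k : Fin N}
    (x y z : SignType) : flipSite i (put w i j k x y z) = put w i j k (-x) y z := by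
  funext l
  rw [flipSite_apply]
  unfold put
  split_ifs <;> simp_all

theorem flipSite_put_snd (w : Config N) {i j k : Fin N} (h1 : i ≠ j)
    (x y z : SignType) : flipSite j (put w i j k x y z) = put w i j k x (-y) z := by
  funext l
  rw [flipSite_apply]
  unfold put
  split_ifs <;> simp_all

theorem bondHop_sq (τ : F) (i k : Fin N) :
    bondHop τ i k * bondHop τ i k = (-(τ + τ⁻¹)) • bondHop τ i k := by
  refine hop_sq (swapSites_swapSites i k) _ fun w => ?_
  obtain ⟨-, h1, h2, h3, h4, h5, h6⟩ := bulkRate_of_sign_cases τ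
  simp only [swapSites_apply, Equiv.swap_apply_left, Equiv.swap_apply_right]
  by_cases h : w i = w k
  · left
    funext l
    rw [swapSites_apply, Equiv.swap_apply_def]
    split_ifs <;> simp_all
  · right
    cases hx : w i <;> cases hy : w k <;> simp_all [add_comm]

theorem siteHop_sq (ρ σ : F) (i : Fin N) :
    siteHop ρ σ i * siteHop ρ σ i = (-(ρ + σ)) • siteHop ρ σ i := by
  refine hop_sq (flipSite_flipSite i) _ fun w => ?_
  simp only [flipSite_apply, if_true]
  by_cases h : w i = 0
  · left
    funext l
    rw [flipSite_apply]
    split_ifs with hl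
    · subst hl; simp [h]
    · rfl
  · right
    cases hx : w i <;> simp_all [boundaryRate, add_comm]

/-- Modulo the quadratic relation this is the braid relation for the shifted generators `e + τ`.
Only three sites are involved, so it is a finite check over the 27 local states. -/
theorem bondHop_braid {τ : F} (hτ : τ ≠ 0) {i j k : Fin N} (h1 : i ≠ j) (h2 : i ≠ k) (h3 : j ≠ k) :
    bondHop τ i j * bondHop τ j k * bondHop τ i j - bondHop τ i j =
      bondHop τ j k * bondHop τ i j * bondHop τ j k - bondHop τ j k := by
  refine matrix_ext_mulVec fun ψ w => ?_
  obtain ⟨r0, r1, r2, r3, r4, r5, r6⟩ := bulkRate_of_sign_cases τ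
  simp only [Matrix.sub_mulVec, Pi.sub_apply, mul_assoc, bondHop, hop_mul_mulVec, hop_mulVec]
  rw [← put_self w i j k]
  simp only [swapSites_put_fst, swapSites_put_snd, put_fst, put_snd, put_trd, ne_eq, h1, h2, h3,
    not_false_eq_true]
  generalize w i = x
  generalize w j = y
  generalize w k = z
  generalize put w i j k = f
  cases x <;> cases y <;> cases z <;>
    simp only [SignType.zero_eq_zero, SignType.neg_eq_neg_one, SignType.pos_eq_one,
      r0, r1, r2, r3, r4, r5, r6] <;> field_simp <;> ring

/-- Modulo the quadratic relations this is the quartic braid relation between `e + τ` and `f + σ`;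
the lower order terms of that relation produce the scalar on the right. -/
theorem bond_site_relation_left {τ : F} (hτ : τ ≠ 0) (ρ σ : F) {i j : Fin N} (h1 : i ≠ j) :
    bondHop τ i j * siteHop ρ σ i * bondHop τ i j * siteHop ρ σ i -
        siteHop ρ σ i * bondHop τ i j * siteHop ρ σ i * bondHop τ i j =
      (τ * ρ + τ⁻¹ * σ) • (bondHop τ i j * siteHop ρ σ i - siteHop ρ σ i * bondHop τ i j) := by
  refine matrix_ext_mulVec fun ψ w => ?_
  obtain ⟨r0, r1, r2, r3, r4, r5, r6⟩ := bulkRate_of_sign_cases τ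
  simp only [Matrix.sub_mulVec, Matrix.smul_mulVec, Pi.smul_apply, smul_eq_mul,
    Pi.sub_apply, mul_assoc, bondHop, siteHop, hop_mul_mulVec, hop_mulVec]
  -- Only two sites matter, so the third slot of `put` repeats `j` and its value is never read.
  rw [← put_self w i j j]
  have hs : ∀ x y, swapSites i j (put w i j j x y (w j)) = put w i j j y x (w j) := by
    intro x y; funext l
    rw [swapSites_apply, Equiv.swap_apply_def]
    unfold put
    split_ifs <;> simp_all
  simp only [hs, flipSite_put_fst, put_fst, put_snd, ne_eq, h1,
    not_false_eq_true]
  generalize hf : (fun x y => put w i j j x y (w j)) = f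
  replace hf : ∀ x y, put w i j j x y (w j) = f x y := fun x y => by rw [← hf]
  simp only [hf]
  generalize w i = x
  generalize w j = y
  cases x <;> cases y <;>
    simp [r0, r1, r2, r3, r4, r5, r6, boundaryRate] <;> field_simp <;> ring

/-- The mirror image of the left relation: here the quartic braid relation holds between `e + τ` and
`f + ρ`, so `ρ` and `σ` exchange roles in the scalar. -/
theorem bond_site_relation_right {τ : F} (hτ : τ ≠ 0) (ρ σ : F) {i j : Fin N} (h1 : i ≠ j) :
    bondHop τ i j * siteHop ρ σ j * bondHop τ i j * siteHop ρ σ j -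
        siteHop ρ σ j * bondHop τ i j * siteHop ρ σ j * bondHop τ i j =
      (τ⁻¹ * ρ + τ * σ) • (bondHop τ i j * siteHop ρ σ j - siteHop ρ σ j * bondHop τ i j) := by
  refine matrix_ext_mulVec fun ψ w => ?_
  obtain ⟨r0, r1, r2, r3, r4, r5, r6⟩ := bulkRate_of_sign_cases τ
  simp only [Matrix.sub_mulVec, Matrix.smul_mulVec, Pi.smul_apply, smul_eq_mul,
    Pi.sub_apply, mul_assoc, bondHop, siteHop, hop_mul_mulVec, hop_mulVec]
  rw [← put_self w i j j]
  have hs : ∀ x y, swapSites i j (put w i j j x y (w j)) = put w i j j y x (w j) := by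
    intro x y; funext l
    rw [swapSites_apply, Equiv.swap_apply_def]
    unfold put
    split_ifs <;> simp_all
  simp only [hs, flipSite_put_snd, put_fst, put_snd, ne_eq, h1,
    not_false_eq_true]
  generalize hf : (fun x y => put w i j j x y (w j)) = f
  replace hf : ∀ x y, put w i j j x y (w j) = f x y := fun x y => by rw [← hf]
  simp only [hf]
  generalize w i = x
  generalize w j = y
  cases x <;> cases y <;>
    simp [r0, r1, r2, r3, r4, r5, r6, boundaryRate] <;> field_simp <;> ring

theorem bondHop_commute (τ : F) {i j k l : Fin N} (hij : i ≠ j) (hkl : k ≠ l) (h1 : i ≠ k)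
    (h2 : i ≠ l) (h3 : j ≠ k) (h4 : j ≠ l) : Commute (bondHop τ i j) (bondHop τ k l) := by
  refine hop_commute (fun w => ?_) (fun w => ?_) (fun w => ?_)
  · funext m
    have hc : Equiv.swap i j * Equiv.swap k l = Equiv.swap k l * Equiv.swap i j :=
      (Equiv.Perm.disjoint_swap_swap (by simp [*])).commute
    simp only [swapSites_apply]
    exact congrArg w (DFunLike.congr_fun hc m).symm
  · simp only [swapSites_apply, Equiv.swap_apply_of_ne_of_ne h1 h2,
      Equiv.swap_apply_of_ne_of_ne h3 h4]
  · simp only [swapSites_apply, Equiv.swap_apply_of_ne_of_ne h1.symm h3.symm,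
      Equiv.swap_apply_of_ne_of_ne h2.symm h4.symm]

theorem bondHop_commute_siteHop (τ ρ σ : F) {i j k : Fin N} (h1 : i ≠ k) (h2 : j ≠ k) :
    Commute (bondHop τ i j) (siteHop ρ σ k) := by
  refine hop_commute (fun w => ?_) (fun w => ?_) (fun w => ?_)
  · funext m
    simp only [swapSites_apply, flipSite_apply, Equiv.swap_apply_def]
    split_ifs <;> simp_all
  · simp only [flipSite_apply, h1, h2, if_false]
  · simp only [swapSites_apply, Equiv.swap_apply_of_ne_of_ne h1.symm h2.symm]

theorem siteHop_commute (ρ σ ρ' σ' : F) {i k : Fin N} (h1 : i ≠ k) :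
    Commute (siteHop ρ σ i) (siteHop ρ' σ' k) := by
  refine hop_commute (fun w => ?_) (fun w => ?_) (fun w => ?_)
  · funext m
    simp only [flipSite_apply]
    split_ifs <;> simp_all
  · simp only [flipSite_apply, h1, if_false]
  · simp only [flipSite_apply, h1.symm, if_false]

end Relations

/-! ### Baxterisation -/

section Baxter

variable {F A : Type*} [Field F] [Ring A] [Algebra F A]

theorem baxter_inv {e : A} {q x y : F} (he : e * e = (-q) • e) (h : x + y - q * (x * y) = 0) :
    (1 + x • e) * (1 + y • e) = 1 := by
  have key : (x + y - q * (x * y)) • e = 0 := by rw [h, zero_smul]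
  simp only [mul_add, add_mul, mul_one, one_mul, smul_mul_smul_comm, he]
  linear_combination (norm := module) key

/-- After the quadratic and braid relations the difference of the two sides is a multiple of `e -
f`, so a single scalar equation between the weights suffices. -/
theorem baxter_yang_baxter {e f : A} {q x y z : F} (he : e * e = (-q) • e)
    (hf : f * f = (-q) • f) (hb : e * f * e - e = f * e * f - f)
    (h : x + z - q * (x * z) + x * y * z = y) :
    (1 + x • e) * (1 + y • f) * (1 + z • e) = (1 + z • f) * (1 + y • e) * (1 + x • f) := by
  have k1 : (x + z - q * (x * z) + x * y * z) • e = y • e := by rw [h]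
  have k2 : (x + z - q * (x * z) + x * y * z) • f = y • f := by rw [h]
  simp only [mul_add, add_mul, mul_one, one_mul, smul_mul_assoc, mul_smul_comm, he, hf]
  linear_combination (norm := module) (x * y * z) • hb + k1 - k2

/-- The terms that do not cancel by symmetry are multiples of `e * f - f * e`, once the quartic
relation has rewritten `e * f * e * f - f * e * f * e`. The hypothesis `h` is the vanishing of the
total coefficient. -/
theorem baxter_reflection {e f : A} {q φ κ x y k l : F} (he : e * e = (-q) • e)
    (hf : f * f = (-φ) • f) (hb : e * f * e * f - f * e * f * e = κ • (e * f - f * e))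
    (h : l * y + l * x + k * x - φ * l * k * x - q * l * x * y - k * y + κ * x * y * k * l = 0) :
    (1 + l • f) * (1 + y • e) * (1 + k • f) * (1 + x • e) =
      (1 + x • e) * (1 + k • f) * (1 + y • e) * (1 + l • f) := by
  have k1 : (l * y + l * x + k * x - φ * l * k * x - q * l * x * y - k * y +
    κ * x * y * k * l) • (f * e - e * f) = 0 := by rw [h, zero_smul]
  have he' : ∀ a, a * e * e = (-q) • (a * e) := fun a => by rw [mul_assoc, he, mul_smul_comm]
  have hf' : ∀ a, a * f * f = (-φ) • (a * f) := fun a => by rw [mul_assoc, hf, mul_smul_comm]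
  simp only [mul_add, add_mul, mul_one, one_mul, smul_mul_assoc, mul_smul_comm, he, hf, he', hf']
  linear_combination (norm := module) k1 - (x * y * k * l) • hb

theorem baxter_commute {e f : A} (x y : F) (h : Commute e f) :
    Commute (1 + x • e) (1 + y • f) :=
  ((Commute.one_left _).add_left ((Commute.one_right _).add_right
    ((h.smul_left x).smul_right y)))

end Baxter

/-! ### The affine Weyl group of type C -/

section Affine

variable {G : Type*} [Monoid G]

/-- The relations between the generators `T 0, …, T (n + 1)` of the affine Weyl group of
type `C`. -/
structure AffineRelations (n : ℕ) (T : ℕ → G) : Prop where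
  sq : ∀ j ≤ n + 1, T j * T j = 1
  comm : ∀ j k, j + 2 ≤ k → k ≤ n + 1 → Commute (T j) (T k)
  braid : ∀ j, 1 ≤ j → j + 1 ≤ n → T j * T (j + 1) * T j = T (j + 1) * T j * T (j + 1)
  left : 1 ≤ n → T 0 * T 1 * T 0 * T 1 = T 1 * T 0 * T 1 * T 0
  right : 1 ≤ n → T (n + 1) * T n * T (n + 1) * T n = T n * T (n + 1) * T n * T (n + 1)

/-- The reflection `T i ⋯ T 1 T 0 T 1 ⋯ T i`. -/
def leftRefl (T : ℕ → G) : ℕ → G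
  | 0 => T 0
  | i + 1 => T (i + 1) * leftRefl T i * T (i + 1)

/-- The reflection `T (n + 1 - r) ⋯ T n T (n + 1) T n ⋯ T (n + 1 - r)`. -/
def rightReflAux (n : ℕ) (T : ℕ → G) : ℕ → G
  | 0 => T (n + 1)
  | r + 1 => T (n - r) * rightReflAux n T r * T (n - r)

/-- The reflection `T i ⋯ T n T (n + 1) T n ⋯ T i`. -/
def rightRefl (n : ℕ) (T : ℕ → G) (i : ℕ) : G := rightReflAux n T (n + 1 - i)

/-- The translation of the affine Weyl group attached to the site `i`. -/
def translation (n : ℕ) (T : ℕ → G) (i : ℕ) : G := leftRefl T i * rightRefl n T (i + 1)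

theorem rightRefl_last (n : ℕ) (T : ℕ → G) : rightRefl n T (n + 1) = T (n + 1) := by
  simp [rightRefl, rightReflAux]

theorem rightRefl_eq {n : ℕ} (T : ℕ → G) {i : ℕ} (hi : i ≤ n) :
    rightRefl n T i = T i * rightRefl n T (i + 1) * T i := by
  obtain ⟨r, rfl⟩ := Nat.exists_eq_add_of_le hi
  have h1 : i + r + 1 - i = r + 1 := by omega
  have h2 : i + r + 1 - (i + 1) = r := by omega
  have h3 : i + r - r = i := by omega
  simp [rightRefl, rightReflAux, h1, h2, h3]

/-- Downward induction from `n + 1`. -/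
theorem downward_induction {n : ℕ} {C : ℕ → Prop} (h0 : C (n + 1))
    (h : ∀ i, i ≤ n → C (i + 1) → C i) (i : ℕ) (hi : i ≤ n + 1) : C i :=
  Nat.decreasingInduction' (fun k hk _ hC => h k (Nat.lt_succ_iff.mp hk) hC) hi h0

namespace AffineRelations

variable {n : ℕ} {T : ℕ → G}

theorem sq_cancel (h : AffineRelations n T) {j : ℕ} (hj : j ≤ n + 1) (a : G) :
    T j * (T j * a) = a := by
  rw [← mul_assoc, h.sq j hj, one_mul]

theorem leftRefl_sq (h : AffineRelations n T) : ∀ i ≤ n + 1, leftRefl T i * leftRefl T i = 1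
  | 0, _ => h.sq 0 (by omega)
  | i + 1, hi => by
    have := leftRefl_sq h i (by omega)
    calc T (i + 1) * leftRefl T i * T (i + 1) * (T (i + 1) * leftRefl T i * T (i + 1))
        = T (i + 1) * leftRefl T i * (T (i + 1) * T (i + 1)) * leftRefl T i * T (i + 1) := by
          simp only [mul_assoc]
      _ = T (i + 1) * (leftRefl T i * leftRefl T i) * T (i + 1) := by
          rw [h.sq _ hi]; simp only [mul_assoc, mul_one]
      _ = 1 := by rw [this, mul_one, h.sq _ hi]

theorem rightRefl_sq (h : AffineRelations n T) :
    ∀ i ≤ n + 1, rightRefl n T i * rightRefl n T i = 1 := by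
  refine downward_induction (by rw [rightRefl_last]; exact h.sq _ le_rfl) fun i hi ih => ?_
  rw [rightRefl_eq T hi]
  calc T i * rightRefl n T (i + 1) * T i * (T i * rightRefl n T (i + 1) * T i)
      = T i * rightRefl n T (i + 1) * (T i * T i) * rightRefl n T (i + 1) * T i := by
        simp only [mul_assoc]
    _ = T i * (rightRefl n T (i + 1) * rightRefl n T (i + 1)) * T i := by
        rw [h.sq _ (by omega)]; simp only [mul_assoc, mul_one]
    _ = 1 := by rw [ih, mul_one, h.sq _ (by omega)]

theorem commute_leftRefl_of_gt (h : AffineRelations n T) {k : ℕ} (hk : k ≤ n + 1) :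
    ∀ i, i + 2 ≤ k → Commute (T k) (leftRefl T i)
  | 0, hi => (h.comm 0 k hi hk).symm
  | i + 1, hi =>
    (((h.comm (i + 1) k hi hk).symm.mul_right (commute_leftRefl_of_gt h hk i (by omega)))).mul_right
      (h.comm (i + 1) k hi hk).symm

theorem commute_rightRefl_of_lt (h : AffineRelations n T) {k : ℕ} :
    ∀ i ≤ n + 1, k + 2 ≤ i → Commute (T k) (rightRefl n T i) := by
  refine downward_induction (fun hk => ?_) fun i hi ih hk => ?_
  · rw [rightRefl_last]; exact h.comm _ _ hk le_rfl
  · rw [rightRefl_eq T hi]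
    have := h.comm k i hk (by omega)
    exact (this.mul_right (ih (by omega))).mul_right this

/-- `leftRefl T i` is the sign change attached to site `i`, and for `k < i` the generator `T k` only
involves earlier sites. The essential case is `k + 1 = i`: the braid relation turns `T k` into `T (k
+ 1)`, which passes through the inner reflection and is then turned back. At the boundary the
quartic relation plays this part. -/
theorem commute_leftRefl_of_lt (h : AffineRelations n T) :
    ∀ i ≤ n, ∀ k < i, Commute (T k) (leftRefl T i)
  | 0, _, k, hk => absurd hk (Nat.not_lt_zero k)
  | i + 1, hi, k, hk => by
    change T k * (T (i + 1) * leftRefl T i * T (i + 1)) =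
      (T (i + 1) * leftRefl T i * T (i + 1)) * T k
    rcases Nat.lt_or_ge k i with hk' | hk'
    · have c1 := h.comm k (i + 1) (by omega) (by omega)
      exact (c1.mul_right (commute_leftRefl_of_lt h i (by omega) k hk')).mul_right c1
    · obtain rfl : k = i := by omega
      rcases k with _ | k
      · have := h.left (by omega)
        simp only [leftRefl, zero_add, ← mul_assoc]
        rw [this]
      · have b := h.braid (k + 1) (by omega) hi
        have c := (h.commute_leftRefl_of_gt (k := k + 1 + 1) (by omega) k le_rfl).eq
        simp only [leftRefl]
        calc T (k + 1) * (T (k + 1 + 1) * (T (k + 1) * leftRefl T k * T (k + 1)) * T (k + 1 + 1))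
            = (T (k + 1) * T (k + 1 + 1) * T (k + 1)) * leftRefl T k *
                (T (k + 1) * T (k + 1 + 1)) := by simp only [mul_assoc]
          _ = T (k + 1 + 1) * T (k + 1) * (T (k + 1 + 1) * leftRefl T k) *
                (T (k + 1) * T (k + 1 + 1)) := by rw [b]; simp only [mul_assoc]
          _ = T (k + 1 + 1) * T (k + 1) * leftRefl T k *
                (T (k + 1 + 1) * T (k + 1) * T (k + 1 + 1)) := by rw [c]; simp only [mul_assoc]
          _ = _ := by rw [← b]; simp only [mul_assoc]

theorem commute_rightRefl_of_gt (h : AffineRelations n T) :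
    ∀ i ≤ n + 1, 1 ≤ i → ∀ k, i < k → k ≤ n + 1 → Commute (T k) (rightRefl n T i) := by
  refine downward_induction (fun _ k h1 h2 => by omega) fun i hi ih h1 k hk hk' => ?_
  rw [rightRefl_eq T hi]
  rcases Nat.lt_or_ge (i + 1) k with hk2 | hk2
  · have c1 := (h.comm i k (by omega) hk').symm
    exact (c1.mul_right (ih (by omega) k hk2 hk')).mul_right c1
  · obtain rfl : k = i + 1 := by omega
    rcases Nat.lt_or_ge i n with hn | hn
    · have b := h.braid i h1 hn
      have c := (h.commute_rightRefl_of_lt (k := i) (i + 1 + 1) (by omega) (by omega)).eq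
      rw [rightRefl_eq T hn, commute_iff_eq]
      calc T (i + 1) * (T i * (T (i + 1) * rightRefl n T (i + 1 + 1) * T (i + 1)) * T i)
          = (T (i + 1) * T i * T (i + 1)) * rightRefl n T (i + 1 + 1) * (T (i + 1) * T i) := by
            simp only [mul_assoc]
        _ = T i * T (i + 1) * (T i * rightRefl n T (i + 1 + 1)) * (T (i + 1) * T i) := by
            rw [← b]; simp only [mul_assoc]
        _ = T i * T (i + 1) * rightRefl n T (i + 1 + 1) * (T i * T (i + 1) * T i) := by
            rw [c]; simp only [mul_assoc]
        _ = _ := by rw [b]; simp only [mul_assoc]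
    · obtain rfl : i = n := by omega
      have := h.right h1
      rw [rightRefl_last, commute_iff_eq]
      simp only [← mul_assoc]
      rw [this]

theorem commute_translation (h : AffineRelations n T) {i k : ℕ} (hi : i ≤ n) (hk : k ≤ n + 1)
    (hki : k < i ∨ i + 2 ≤ k) :
    Commute (T k) (translation n T i) := by
  rcases hki with hki | hki
  · exact (h.commute_leftRefl_of_lt i hi k hki).mul_right
      (h.commute_rightRefl_of_lt (i + 1) (by omega) (by omega))
  · exact (h.commute_leftRefl_of_gt hk i hki).mul_right
      (h.commute_rightRefl_of_gt (i + 1) (by omega) (by omega) k (by omega) hk)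

/-- Unfolding the two reflections gives the same word on both sides, so no relation of the group
enters. Together with `translation_mul` it says that `T (i + 1)` exchanges the translations at `i`
and `i + 1`. -/
theorem mul_translation {i : ℕ} (hi : i + 1 ≤ n) :
    T (i + 1) * translation n T i = translation n T (i + 1) * T (i + 1) := by
  simp only [translation, leftRefl, rightRefl_eq T hi, mul_assoc]

theorem translation_mul (h : AffineRelations n T) {i : ℕ} (hi : i + 1 ≤ n) :
    translation n T i * T (i + 1) = T (i + 1) * translation n T (i + 1) := by
  simp only [translation, leftRefl, rightRefl_eq T hi, mul_assoc]
  simp only [h.sq_cancel (show i + 1 ≤ n + 1 by omega), h.sq _ (show i + 1 ≤ n + 1 by omega),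
    mul_one]

/-- With `P` the left reflection at `i`, `Z` the right reflection at `i + 2` and `t = T (i + 1)`,
the two translations are `P · tZt` and `tPt · Z`. They commute because `P` commutes with `Z`
(disjoint sites), `P` with `tPt`, and `Z` with `tZt`. -/
theorem commute_translation_succ (h : AffineRelations n T) {i : ℕ} (hi : i + 1 ≤ n) :
    Commute (translation n T i) (translation n T (i + 1)) := by
  have hP := h.commute_leftRefl_of_lt (i + 1) hi
  have hq : T (i + 1) * T (i + 1) = 1 := h.sq _ (by omega)
  have hq' := h.sq_cancel (show i + 1 ≤ n + 1 by omega)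
  set t := T (i + 1) with ht
  set P := leftRefl T i with hPdef
  set Z := rightRefl n T (i + 1 + 1) with hZdef
  have hPZ : Commute P Z := by
    have : ∀ j ≤ i, Commute (leftRefl T j) Z := by
      intro j
      induction j with
      | zero => exact fun _ => h.commute_rightRefl_of_lt _ (by omega) (by omega)
      | succ j ih =>
        intro hj
        have c := h.commute_rightRefl_of_lt (k := j + 1) (i + 1 + 1) (by omega) (by omega)
        exact (c.mul_left (ih (by omega))).mul_left c
    exact this i le_rfl
  have hPP : P * (t * P * t) = t * P * t * P := by
    have : ∀ j ≤ i, Commute (leftRefl T j) (leftRefl T (i + 1)) := by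
      intro j
      induction j with
      | zero => exact fun _ => hP 0 (by omega)
      | succ j ih =>
        intro hj
        exact ((hP (j + 1) (by omega)).mul_left (ih (by omega))).mul_left (hP (j + 1) (by omega))
    exact this i le_rfl
  have hZZ : Z * (t * Z * t) = t * Z * t * Z := by
    have hZ := h.commute_rightRefl_of_gt (i + 1) (by omega) (by omega)
    have : ∀ j ≤ n + 1, i + 2 ≤ j → Commute (rightRefl n T j) (rightRefl n T (i + 1)) := by
      refine downward_induction (fun hj => ?_) fun j hj ih hj' => ?_
      · rw [rightRefl_last]; exact hZ _ (by omega) le_rfl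
      · rw [rightRefl_eq T hj]
        have c := hZ j (by omega) (by omega)
        exact (c.mul_left (ih (by omega))).mul_left c
    have := this (i + 2) (by omega) le_rfl
    rw [rightRefl_eq T hi] at this
    exact this.eq
  have e1 : translation n T i = P * (t * Z * t) := by rw [translation, rightRefl_eq T hi]
  have e2 : translation n T (i + 1) = t * P * t * Z := rfl
  rw [commute_iff_eq, e1, e2]
  calc P * (t * Z * t) * (t * P * t * Z) = P * t * (Z * P) * t * Z := by
        simp only [mul_assoc, hq']
    _ = P * (t * P) * (Z * t * Z) := by rw [← hPZ.eq]; simp only [mul_assoc]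
    _ = P * (t * P * t) * (t * Z * t * Z) := by simp only [mul_assoc, hq']
    _ = t * P * t * P * (Z * (t * Z * t)) := by rw [hPP, ← hZZ]
    _ = t * P * t * (P * Z) * (t * Z * t) := by simp only [mul_assoc]
    _ = t * P * t * Z * (P * (t * Z * t)) := by rw [hPZ.eq]; simp only [mul_assoc]

/-- The translation at `k + 1` is conjugate to the one at `k` by `T (k + 1)`, which commutes with
the translation at `i` as soon as `i < k`; the neighbouring case starts the induction. -/
theorem commute_translation_translation (h : AffineRelations n T) {i k : ℕ} (hik : i < k)
    (hk : k ≤ n) :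
    Commute (translation n T i) (translation n T k) := by
  induction k, hik using Nat.le_induction with
  | base => exact h.commute_translation_succ hk
  | succ k hik ih =>
    have e : translation n T (k + 1) = T (k + 1) * translation n T k * T (k + 1) := by
      rw [mul_assoc, h.translation_mul hk, h.sq_cancel (by omega)]
    have c := (h.commute_translation (i := i) (k := k + 1) (by omega) (by omega)
      (Or.inr (by omega))).symm
    rw [e]
    exact (c.mul_right (ih (by omega))).mul_right c

/-- The generators preserve the set of vectors that are invariant under all translations. -/
theorem translation_smul_smul (h : AffineRelations n T) {M : Type*} [MulAction G M] {u : M}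
    (hu : ∀ i ≤ n, translation n T i • u = u) {k : ℕ} (hk : k ≤ n + 1) {i : ℕ} (hi : i ≤ n) :
    translation n T i • T k • u = T k • u := by
  by_cases hki : k < i ∨ i + 2 ≤ k
  · rw [smul_smul, ← (h.commute_translation hi hk hki).eq, mul_smul, hu i hi]
  by_cases hk1 : k = i
  · subst hk1
    rcases k with _ | k
    · have e : translation n T 0 * T 0 * translation n T 0 = T 0 := by
        have := h.rightRefl_sq 1 (by omega)
        simp only [translation, leftRefl, zero_add, mul_assoc]
        rw [h.sq_cancel (by omega), this, mul_one]
      conv_lhs => rw [← hu 0 (by omega)]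
      rw [smul_smul, smul_smul, e]
    · rw [smul_smul, ← mul_translation hi, mul_smul, hu k (by omega)]
  · obtain rfl : k = i + 1 := by omega
    rcases Nat.lt_or_ge i n with hn | hn
    · rw [smul_smul, h.translation_mul hn, mul_smul, hu (i + 1) (by omega)]
    · obtain rfl : i = n := by omega
      have e : translation i T i * T (i + 1) * translation i T i = T (i + 1) := by
        have := h.leftRefl_sq i (by omega)
        simp only [translation, rightRefl_last, mul_assoc]
        rw [h.sq_cancel le_rfl, ← mul_assoc, this, one_mul]
      conv_lhs => rw [← hu i (by omega)]
      rw [smul_smul, smul_smul, e]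

end AffineRelations

theorem leftRefl_smul_eq_self {n : ℕ} {T : ℕ → G} {M : Type*} [MulAction G M] {u : M}
    (hu : ∀ k ≤ n + 1, T k • u = u) :
    ∀ i ≤ n + 1, leftRefl T i • u = u
  | 0, _ => hu 0 (by omega)
  | i + 1, hi => by
    rw [leftRefl, mul_smul, mul_smul, hu _ hi, leftRefl_smul_eq_self hu i (by omega), hu _ hi]

theorem rightRefl_smul_eq_self {n : ℕ} {T : ℕ → G} {M : Type*} [MulAction G M] {u : M}
    (hu : ∀ k, 1 ≤ k → k ≤ n + 1 → T k • u = u) :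
    ∀ i ≤ n + 1, 1 ≤ i → rightRefl n T i • u = u := by
  refine downward_induction (fun _ => ?_) fun i hi ih h1 => ?_
  · rw [rightRefl_last]; exact hu _ (by omega) le_rfl
  · rw [rightRefl_eq T hi, mul_smul, mul_smul, hu i h1 (by omega), ih (by omega),
      hu i h1 (by omega)]

end Affine

/-! ### Vectors invariant under a semilinear action of the finite Weyl group -/

section Averaging

variable {K M : Type*} [Field K] [AddCommGroup M] [Module K M]

/-- Dedekind independence of the characters `l ↦ x r ^ l` of the additive monoid of natural numbers,
transferred from scalars to `M` by linear functionals. -/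
theorem eq_zero_of_forall_sum_pow_smul_eq_zero {κ : Type*} [Fintype κ] {x : κ → K}
    (hx : Function.Injective x) {y : κ → M} (h : ∀ l : ℕ, ∑ r, x r ^ l • y r = 0) (r : κ) :
    y r = 0 := by
  rw [← Module.forall_dual_apply_eq_zero_iff K]
  intro φ
  have hinj : Function.Injective fun r => powersHom K (x r) :=
    (powersHom K).injective.comp hx
  have hli := (linearIndependent_monoidHom (Multiplicative ℕ) K).comp _ hinj
  rw [Fintype.linearIndependent_iff] at hli
  refine hli (fun r => φ (y r)) (funext fun l => ?_) r
  have := congrArg φ (h l.toAdd)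
  simpa [powersHom_apply, mul_comm] using this

variable {G : Type*} [Monoid G] [DistribMulAction G M] {n : ℕ} {T : ℕ → G}

/-- The orbit `v, T j v, T (j + 1) T j v, …` of a vector, indexed from `j` on. -/
def orbitSeq (T : ℕ → G) (j : ℕ) (v : M) : ℕ → M
  | 0 => v
  | i + 1 => if i < j then v else T i • orbitSeq T j v i

theorem orbitSeq_self (T : ℕ → G) (j : ℕ) (v : M) : orbitSeq T j v j = v := by
  cases j <;> simp [orbitSeq]

theorem orbitSeq_succ (T : ℕ → G) {i j : ℕ} (h : j ≤ i) (v : M) :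
    orbitSeq T j v (i + 1) = T i • orbitSeq T j v i := by
  simp [orbitSeq, h.not_gt]

theorem AffineRelations.smul_orbitSeq_of_gt (h : AffineRelations n T) {j : ℕ} {v : M}
    (hv : ∀ k, j < k → k ≤ n + 1 → T k • v = v) {i : ℕ} (hji : j ≤ i) :
    ∀ k, i < k → k ≤ n + 1 → T k • orbitSeq T j v i = orbitSeq T j v i := by
  induction i, hji using Nat.le_induction with
  | base => rw [orbitSeq_self]; exact hv
  | succ i hji ih =>
    intro k hk hk'
    rw [orbitSeq_succ T hji, smul_smul, ← (h.comm i k hk hk').eq, mul_smul,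
      ih k (by omega) hk']

/-- Since `v` is fixed by the generators after `T j`, the vectors `y_i = T (i - 1) ⋯ T j v` behave
like cosets of a symmetric group modulo a point stabiliser, and `T k` moves them by the
transposition `(k, k + 1)`. -/
theorem AffineRelations.smul_orbitSeq (h : AffineRelations n T) {j : ℕ} (hj : 1 ≤ j) {v : M}
    (hv : ∀ k, j < k → k ≤ n + 1 → T k • v = v) {i : ℕ} (hji : j ≤ i) :
    i ≤ n + 1 → ∀ k, j ≤ k → k ≤ n →
    T k • orbitSeq T j v i = orbitSeq T j v (Equiv.swap k (k + 1) i) := by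
  induction i, hji using Nat.le_induction with
  | base =>
    intro _ k hk hk'
    rcases hk.eq_or_lt with rfl | hk
    · rw [Equiv.swap_apply_left, orbitSeq_succ T le_rfl]
    · rw [orbitSeq_self, Equiv.swap_apply_of_ne_of_ne (by omega) (by omega), orbitSeq_self,
        hv k hk (by omega)]
  | succ i hji ih =>
    intro hi k hk hk'
    rcases lt_trichotomy k (i + 1) with hki | rfl | hki
    · rcases Nat.lt_succ_iff_lt_or_eq.mp hki with hki | rfl
      · rw [Equiv.swap_apply_of_ne_of_ne (by omega) (by omega), orbitSeq_succ T hji]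
        rcases Nat.lt_or_ge (k + 1) i with hki' | hki'
        · have e := ih (by omega) k hk hk'
          rw [Equiv.swap_apply_of_ne_of_ne (by omega) (by omega)] at e
          rw [smul_smul, (h.comm k i hki' (by omega)).eq, mul_smul, e]
        · obtain rfl : i = k + 1 := by omega
          -- Here `T k T (k + 1) T k y_k = T (k + 1) T k T (k + 1) y_k`, and `T (k + 1)` fixes
          -- `y_k`.
          rw [orbitSeq_succ T hk, smul_smul, smul_smul,
            h.braid k (by omega) (by omega), mul_smul, mul_smul]
          rw [h.smul_orbitSeq_of_gt hv hk (k + 1) (by omega) (by omega)]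
      · rw [Equiv.swap_apply_right, orbitSeq_succ T hji, smul_smul, h.sq k (by omega), one_smul]
    · rw [Equiv.swap_apply_left, ← orbitSeq_succ T (by omega)]
    · rw [Equiv.swap_apply_of_ne_of_ne (by omega) (by omega)]
      exact h.smul_orbitSeq_of_gt hv (by omega) k hki (by omega)

/-- Conjugation by `T k` exchanges the right reflections at `k` and `k + 1` and fixes the others, so
the reflected vectors are permuted in the same way as the original ones. -/
theorem AffineRelations.smul_rightRefl_smul (h : AffineRelations n T) {j : ℕ} (hj : 1 ≤ j)
    {y : ℕ → M} (hy : ∀ i, j ≤ i → i ≤ n + 1 → ∀ k, j ≤ k → k ≤ n →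
      T k • y i = y (Equiv.swap k (k + 1) i))
    {i : ℕ} (hji : j ≤ i) (hi : i ≤ n + 1) {k : ℕ} (hk : j ≤ k) (hk' : k ≤ n) :
    T k • rightRefl n T i • y i = rightRefl n T (Equiv.swap k (k + 1) i) •
      y (Equiv.swap k (k + 1) i) := by
  have hyk := hy i hji hi k hk hk'
  by_cases h1 : i = k
  · subst h1
    rw [Equiv.swap_apply_left] at hyk ⊢
    rw [rightRefl_eq T hk', smul_smul, mul_assoc, h.sq_cancel (by omega), mul_smul, hyk]
  by_cases h2 : i = k + 1
  · subst h2
    rw [Equiv.swap_apply_right] at hyk ⊢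
    rw [rightRefl_eq T hk', mul_smul, mul_smul, ← hyk, smul_smul (T k) (T k), h.sq k (by omega),
      one_smul]
  · rw [Equiv.swap_apply_of_ne_of_ne h1 h2] at hyk ⊢
    have c : Commute (T k) (rightRefl n T i) := by
      rcases Nat.lt_or_ge i k with h3 | h3
      · exact h.commute_rightRefl_of_gt i hi (by omega) k h3 (by omega)
      · exact h.commute_rightRefl_of_lt i hi (by omega)
    rw [smul_smul, c.eq, mul_smul, hyk]

/-- A semilinear action of the generators on `M`: the generators act on the scalars `z 1, …,
z (n + 1)` by exchanging neighbours and inverting the last one. -/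
structure SemilinearAction (n : ℕ) (T : ℕ → G) (M : Type*) [AddCommGroup M] [Module K M]
    [DistribMulAction G M] (s : ℕ → K →+* K) (z : ℕ → K) : Prop where
  smul_smul : ∀ k, 1 ≤ k → k ≤ n + 1 → ∀ (c : K) (v : M), T k • c • v = s k c • T k • v
  swap : ∀ k, 1 ≤ k → k ≤ n → ∀ i, 1 ≤ i → i ≤ n + 1 → s k (z i) = z (Equiv.swap k (k + 1) i)
  last : s (n + 1) (z (n + 1)) = (z (n + 1))⁻¹
  fixed : ∀ i, 1 ≤ i → i ≤ n → s (n + 1) (z i) = z i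
  distinct : ∀ i i', 1 ≤ i → i ≤ n + 1 → 1 ≤ i' → i' ≤ n + 1 →
    (z i = z i' → i = i') ∧ z i ≠ (z i')⁻¹

/-- Let `y_i` be the orbit vectors of `v` and `y'_i` their reflections. The generators from `T j` on
permute the pairs `(z_i, y_i)` and `(z_i⁻¹, y'_i)` together, so every power sum `S l = ∑ (z_i ^ l
y_i + z_i ^ (-l) y'_i)` is fixed. The scalars `z_i, z_i⁻¹` are distinct; if all `S l` vanished,
Dedekind independence would force `y_j = v` to vanish. -/
theorem AffineRelations.exists_fixed_step (h : AffineRelations n T) {s : ℕ → K →+* K}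
    {z : ℕ → K} (hs : SemilinearAction n T M s z) (U : Submodule K M)
    (hU : ∀ k, 1 ≤ k → k ≤ n + 1 → ∀ u ∈ U, T k • u ∈ U) {j : ℕ} (hj : 1 ≤ j) (hj' : j ≤ n + 1)
    {v : M} (hvU : v ∈ U) (hv0 : v ≠ 0) (hv : ∀ k, j < k → k ≤ n + 1 → T k • v = v) :
    ∃ u ∈ U, u ≠ 0 ∧ ∀ k, j ≤ k → k ≤ n + 1 → T k • u = u := by
  set y := orbitSeq T j v with hydef
  set y' : ℕ → M := fun i => rightRefl n T i • y i with hy'def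
  have hy : ∀ i, j ≤ i → i ≤ n + 1 → ∀ k, j ≤ k → k ≤ n →
      T k • y i = y (Equiv.swap k (k + 1) i) := fun i hi hi' => h.smul_orbitSeq hj hv hi hi'
  have hy' : ∀ i, j ≤ i → i ≤ n + 1 → ∀ k, j ≤ k → k ≤ n →
      T k • y' i = y' (Equiv.swap k (k + 1) i) := fun i hi hi' k hk hk' =>
    h.smul_rightRefl_smul hj hy hi hi' hk hk'
  have hyU : ∀ i, j ≤ i → i ≤ n + 1 → y i ∈ U := by
    intro i hi
    induction i, hi using Nat.le_induction with
    | base => intro _; rw [hydef, orbitSeq_self]; exact hvU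
    | succ i hi ih =>
      intro hi'
      rw [hydef, orbitSeq_succ T hi]
      exact hU i (by omega) (by omega) _ (ih (by omega))
  have hZU : ∀ i ≤ n + 1, 1 ≤ i → ∀ u ∈ U, rightRefl n T i • u ∈ U := by
    refine downward_induction (fun _ u hu => ?_) fun i hi ih h1 u hu => ?_
    · rw [rightRefl_last]; exact hU _ (by omega) le_rfl u hu
    · rw [rightRefl_eq T hi, mul_smul, mul_smul]
      exact hU i h1 (by omega) _ (ih (by omega) _ (hU i h1 (by omega) u hu))
  set S : ℕ → M := fun l =>
    ∑ i ∈ Finset.Icc j (n + 1), (z i ^ l • y i + (z i)⁻¹ ^ l • y' i) with hS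
  have hfix : ∀ l k, j ≤ k → k ≤ n + 1 → T k • S l = S l := by
    intro l k hk hk'
    rw [hS]
    simp only [Finset.smul_sum, smul_add, hs.smul_smul k (by omega) hk', map_pow, map_inv₀]
    rcases Nat.lt_or_ge n k with hkn | hkn
    · obtain rfl : k = n + 1 := by omega
      -- The last generator exchanges the two terms with `i = n + 1`, and fixes both terms for every
      -- smaller `i`.
      refine Finset.sum_congr rfl fun i hi => ?_
      rw [Finset.mem_Icc] at hi
      rcases hi.2.eq_or_lt with rfl | hi2
      · rw [hs.last, hy'def]
        simp only [rightRefl_last, inv_inv]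
        rw [smul_smul (T (n + 1)) (T (n + 1)), h.sq _ le_rfl, one_smul, add_comm]
      · have c := h.commute_rightRefl_of_gt i (by omega) (by omega) (n + 1) (by omega) le_rfl
        rw [hs.fixed i (by omega) (by omega), hy'def]
        simp only
        rw [smul_smul (T (n + 1)), c.eq, mul_smul,
          h.smul_orbitSeq_of_gt hv hi.1 (n + 1) (by omega) le_rfl]
    · refine Finset.sum_equiv (Equiv.swap k (k + 1)) (fun i => ?_) fun i hi => ?_
      · simp only [Finset.mem_Icc, Equiv.swap_apply_def]
        split_ifs <;> omega
      · rw [Finset.mem_Icc] at hi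
        rw [hy i hi.1 hi.2 k hk hkn, hy' i hi.1 hi.2 k hk hkn,
          hs.swap k (by omega) hkn i (by omega) hi.2]
  have hSU : ∀ l, S l ∈ U := fun l => by
    refine U.sum_mem fun i hi => ?_
    rw [Finset.mem_Icc] at hi
    exact U.add_mem (U.smul_mem _ (hyU i hi.1 hi.2))
      (U.smul_mem _ (hZU i hi.2 (by omega) _ (hyU i hi.1 hi.2)))
  by_contra hcon
  have hzero : ∀ l, S l = 0 := fun l => by
    by_contra hl
    exact hcon ⟨S l, hSU l, hl, hfix l⟩
  let x : {i // i ∈ Finset.Icc j (n + 1)} × Bool → K := fun r => bif r.2 then z r.1 else (z r.1)⁻¹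
  let w : {i // i ∈ Finset.Icc j (n + 1)} × Bool → M := fun r => bif r.2 then y r.1 else y' r.1
  have hx : Function.Injective x := by
    rintro ⟨⟨i, hi⟩, b⟩ ⟨⟨i', hi'⟩, b'⟩ hxx
    have hi1 := Finset.mem_Icc.mp hi
    have hi2 := Finset.mem_Icc.mp hi'
    have d := hs.distinct i i' (by omega) hi1.2 (by omega) hi2.2
    have d' := hs.distinct i' i (by omega) hi2.2 (by omega) hi1.2
    cases b <;> cases b' <;> simp only [x, cond_true, cond_false] at hxx
    · have := d.1 (inv_injective hxx); subst this; rfl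
    · exact absurd hxx.symm d'.2
    · exact absurd hxx d.2
    · have := d.1 hxx; subst this; rfl
  have hw := eq_zero_of_forall_sum_pow_smul_eq_zero hx (y := w) (fun l => by
    rw [Fintype.sum_prod_type, ← hzero l, hS]
    simp only [Fintype.sum_bool, x, w, cond_true, cond_false]
    exact Finset.sum_coe_sort (Finset.Icc j (n + 1))
      (fun i => z i ^ l • y i + (z i)⁻¹ ^ l • y' i))
    (⟨j, Finset.mem_Icc.mpr ⟨le_rfl, hj'⟩⟩, true)
  simp only [w, cond_true, hydef, orbitSeq_self] at hw
  exact hv0 hw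

/-- Descent along the finite Weyl group. -/
theorem AffineRelations.exists_fixed (h : AffineRelations n T) {s : ℕ → K →+* K}
    {z : ℕ → K} (hs : SemilinearAction n T M s z) (U : Submodule K M)
    (hU : ∀ k, 1 ≤ k → k ≤ n + 1 → ∀ u ∈ U, T k • u ∈ U)
    {v : M} (hvU : v ∈ U) (hv0 : v ≠ 0) :
    ∃ u ∈ U, u ≠ 0 ∧ ∀ k, 1 ≤ k → k ≤ n + 1 → T k • u = u := by
  have : ∀ j ≤ n + 1, ∃ u ∈ U, u ≠ 0 ∧ ∀ k, j + 1 ≤ k → k ≤ n + 1 → T k • u = u := by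
    refine downward_induction ⟨v, hvU, hv0, fun k h1 h2 => by omega⟩ ?_
    rintro i hi ⟨u, huU, hu0, hu⟩
    exact h.exists_fixed_step hs U hU (by omega) (by omega) huU hu0 hu
  exact this 0 (by omega)

end Averaging

/-! ### A common fixed vector of commuting operators with a common fixed functional -/

section CommonFixed

open Polynomial

variable {K V ι : Type*} [Field K] [AddCommGroup V] [Module K V]

theorem aeval_apply_mem {f : Module.End K V} {W : Submodule K V} (hW : ∀ v ∈ W, f v ∈ W) (q : K[X])
    {v : V} (hv : v ∈ W) : aeval f q v ∈ W := by
  induction q using Polynomial.induction_on generalizing v with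
  | C a => simpa using W.smul_mem a hv
  | add p q hp hq => simpa using W.add_mem (hp hv) (hq hv)
  | monomial n a ih =>
    have : aeval f (C a * X ^ (n + 1)) v = aeval f (C a * X ^ n) (f v) := by
      simp [pow_succ]
    rw [this]
    exact ih (hW v hv)

/-- Write the minimal polynomial as `X ^ d * q` with `q 0 ≠ 0`. Then `q(f) v` is killed by `f ^ d`,
while `φ (q(f) v) = q 0 * φ v` because `φ` vanishes on the image of `f`. -/
theorem exists_pow_ker_of_functional [FiniteDimensional K V] (f : Module.End K V)
    {W : Submodule K V} (hW : ∀ v ∈ W, f v ∈ W) (φ : V →ₗ[K] K) (hφ : ∀ v, φ (f v) = 0)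
    (h : ∃ v ∈ W, φ v ≠ 0) : ∃ d : ℕ, ∃ v ∈ W, (f ^ d) v = 0 ∧ φ v ≠ 0 := by
  obtain ⟨v, hv, hv0⟩ := h
  have hp : minpoly K f ≠ 0 := minpoly.ne_zero (Algebra.IsIntegral.isIntegral f)
  obtain ⟨q, hq, hq0⟩ := exists_eq_pow_rootMultiplicity_mul_and_not_dvd _ hp 0
  rw [C_0, sub_zero] at hq hq0
  rw [X_dvd_iff] at hq0
  refine ⟨(minpoly K f).rootMultiplicity 0, aeval f q v, aeval_apply_mem hW q hv, ?_, ?_⟩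
  · have h1 := congrArg (fun p => aeval f p v) hq
    simp only [minpoly.aeval, map_mul, map_pow, aeval_X] at h1
    exact h1.symm
  · have h1 : φ (aeval f q v) = q.coeff 0 * φ v := by
      have h2 : aeval f q v = f (aeval f (divX q) v) + q.coeff 0 • v := by
        refine (congrArg (fun p => aeval f p v) (X_mul_divX_add q).symm).trans ?_
        simp only [map_add, map_mul, aeval_X, aeval_C, LinearMap.add_apply, Module.End.mul_apply,
          Module.algebraMap_end_apply]
      rw [h2, map_add, hφ, map_smul, zero_add, smul_eq_mul]
    rw [h1]
    exact mul_ne_zero hq0 hv0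

/-- Take a minimal stable subspace `W` of `H` on which `φ` is nonzero. By
`exists_pow_ker_of_functional` and minimality all the commuting operators `S i - 1` are nilpotent on
`W`. Commuting nilpotent operators on a nonzero space have a common kernel vector. The vector found
is nonzero, but `φ` may vanish on it. -/
theorem exists_common_fixed [FiniteDimensional K V] (S : ι → Module.End K V)
    (hc : ∀ i j, Commute (S i) (S j)) (H : Submodule K V) (hH : ∀ i, ∀ v ∈ H, S i v ∈ H)
    (φ : V →ₗ[K] K) (hφ : ∀ i v, φ (S i v) = φ v) (hv : ∃ v ∈ H, φ v ≠ 0) :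
    ∃ u ∈ H, u ≠ 0 ∧ ∀ i, S i u = u := by
  let f : ι → Module.End K V := fun i => S i - 1
  have hfc : ∀ i j, Commute (f i) (f j) := fun i j =>
    ((hc i j).sub_left (Commute.one_left _)).sub_right (Commute.one_right _)
  have hfφ : ∀ i v, φ (f i v) = 0 := fun i v => by simp [f, hφ]
  have hstab : ∀ (W : Submodule K V) (j : ι) (g : Module.End K V), (∀ v ∈ W, f j v ∈ W) →
      Commute (f j) g → ∀ v ∈ W ⊓ LinearMap.ker g, f j v ∈ W ⊓ LinearMap.ker g := by
    rintro W j g hW hg v ⟨hv1, hv2⟩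
    refine ⟨hW v hv1, ?_⟩
    rw [SetLike.mem_coe, LinearMap.mem_ker] at hv2 ⊢
    rw [← Module.End.mul_apply, ← hg.eq, Module.End.mul_apply, hv2, map_zero]
  obtain ⟨W, ⟨hWH, hWs, hWφ⟩, hWmin⟩ := (wellFounded_lt (α := Submodule K V)).has_min
    {W | W ≤ H ∧ (∀ i, ∀ v ∈ W, f i v ∈ W) ∧ ∃ v ∈ W, φ v ≠ 0}
    ⟨H, le_rfl, fun i v hv => H.sub_mem (hH i v hv) hv, hv⟩
  have hnil : ∀ i, ∃ d : ℕ, ∀ v ∈ W, (f i ^ d) v = 0 := by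
    intro i
    obtain ⟨d, v, hvW, hv0, hvφ⟩ := exists_pow_ker_of_functional (f i) (hWs i) φ (hfφ i) hWφ
    refine ⟨d, fun u hu => ?_⟩
    by_contra hcon
    refine hWmin (W ⊓ LinearMap.ker (f i ^ d)) ⟨inf_le_left.trans hWH, fun j =>
      hstab W j _ (hWs j) ((hfc j i).pow_right d), v, ⟨hvW, hv0⟩, hvφ⟩
      (lt_of_le_of_ne inf_le_left fun he => hcon ?_)
    rw [← he] at hu
    exact hu.2
  have hW0 : W ≠ ⊥ := by
    rintro rfl
    obtain ⟨v, hv, hv0⟩ := hWφ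
    rw [Submodule.mem_bot] at hv
    exact hv0 (by rw [hv, map_zero])
  -- A minimal nonzero stable subspace: each nilpotent operator has a nonzero kernel in `Y`, which
  -- is again stable and hence all of `Y`.
  obtain ⟨Y, ⟨hYW, hYs, hY0⟩, hYmin⟩ := (wellFounded_lt (α := Submodule K V)).has_min
    {Y | Y ≤ W ∧ (∀ i, ∀ v ∈ Y, f i v ∈ Y) ∧ Y ≠ ⊥} ⟨W, le_rfl, hWs, hW0⟩
  obtain ⟨u, huY, hu0⟩ := Submodule.exists_mem_ne_zero_of_ne_bot hY0
  refine ⟨u, hWH (hYW huY), hu0, fun i => ?_⟩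
  suffices hfu : f i u = 0 from sub_eq_zero.mp hfu
  by_contra hcon
  refine hYmin (Y ⊓ LinearMap.ker (f i)) ⟨inf_le_left.trans hYW, fun j =>
    hstab Y j _ (hYs j) (hfc j i), ?_⟩ (lt_of_le_of_ne inf_le_left fun he => hcon ?_)
  · classical
    obtain ⟨d, hd⟩ := hnil i
    -- The last nonvanishing iterate of `u` is a nonzero vector in the kernel.
    have hex : ∃ d : ℕ, (f i ^ d) u = 0 := ⟨d, hd u (hYW huY)⟩
    have hspec := Nat.find_spec hex
    obtain ⟨k, hk⟩ : ∃ k, Nat.find hex = k + 1 := by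
      refine Nat.exists_eq_succ_of_ne_zero fun h0 => hu0 ?_
      rw [h0] at hspec
      simpa using hspec
    have hmin := Nat.find_min hex (m := k) (by omega)
    rw [hk, pow_succ', Module.End.mul_apply] at hspec
    have hmem : (f i ^ k) u ∈ Y := by
      have := aeval_apply_mem (hYs i) (X ^ k) huY
      simpa using this
    intro hbot
    have : (f i ^ k) u ∈ Y ⊓ LinearMap.ker (f i) := ⟨hmem, hspec⟩
    rw [hbot, Submodule.mem_bot] at this
    exact hmin this
  · rw [← he] at huY
    exact huY.2

end CommonFixed

/-! ### Unitarity, the Yang–Baxter equation and the reflection equations -/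

section Matrices

variable {F : Type*} [Field F] {n : ℕ}

theorem smul_siteHop {N : ℕ} (c ρ σ : F) (i : Fin N) :
    c • siteHop ρ σ i = siteHop (c * ρ) (c * σ) i := by
  have : ∀ x, c * boundaryRate ρ σ x = boundaryRate (c * ρ) (c * σ) x := fun x => by
    cases x <;> simp [boundaryRate]
  ext w v
  simp [siteHop, hop, mul_sub, this]

/-- The weight of the bulk generator in `Ř(z)`. -/
def bulkWeight (p : Params F) (z : F) : F := (z - 1) / (p.τ * z - p.τ⁻¹)

/-- The weight of the boundary generator in `K_1(z)`. -/
def leftWeight (p : Params F) (z : F) : F := (z ^ 2 - 1) / ((z - p.a) * (z - p.b))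

/-- The weight of the boundary generator in `K_N(z)`. -/
def rightWeight (p : Params F) (z : F) : F := (1 - z ^ 2) / ((p.c * z - 1) * (p.d * z - 1))

theorem Rmat_eq (p : Params F) (j : Fin n) (z : F) :
    Rmat p j z = 1 + bulkWeight p z • bondHop p.τ j.castSucc j.succ := by
  rw [Rmat, atBond_bulkLocal]; rfl

/-- The conditions on the parameters under which all the operators are well defined. -/
structure Params.Regular (p : Params F) : Prop where
  τ_ne : p.τ ≠ 0
  sq_ne : p.τ ^ 2 ≠ 1
  a_ne : p.a ≠ 1
  b_ne : p.b ≠ 1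
  c_ne : p.c ≠ 1
  d_ne : p.d ≠ 1

theorem Params.Regular.inv_sub_ne {p : Params F} (hp : p.Regular) : p.τ⁻¹ - p.τ ≠ 0 := by
  intro h
  refine hp.sq_ne ?_
  have := congrArg (· * p.τ) h
  simp only [sub_mul, inv_mul_cancel₀ hp.τ_ne, zero_mul] at this
  linear_combination -this

/-- The normalisation by `γ⁻¹` leaves the rates `1` and `α / γ = -ab`, so the boundary matrix is
polynomial in `a, b` apart from its weight. In the same way `β / δ = -cd` at the other end. -/
theorem K1mat_eq {p : Params F} (hp : p.Regular) (z : F) :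
    (K1mat p z : Matrix (Config (n + 1)) _ F) =
      1 + leftWeight p z • siteHop 1 (-(p.a * p.b)) 0 := by
  have h1 := hp.inv_sub_ne
  have ha := sub_ne_zero.mpr hp.a_ne
  have hb := sub_ne_zero.mpr hp.b_ne
  have hγ : p.γ ≠ 0 := div_ne_zero h1 (mul_ne_zero ha hb)
  have hα : p.α = p.γ * (-(p.a * p.b)) := by
    simp only [Params.α, Params.γ]; field_simp; ring
  rw [K1mat, atSite_boundaryLocal, ← smul_smul]
  change _ + _ • _ • siteHop _ _ _ = _
  rw [smul_siteHop, hα, inv_mul_cancel₀ hγ, inv_mul_cancel_left₀ hγ]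
  rfl

theorem KNmat_eq {p : Params F} (hp : p.Regular) (z : F) :
    (KNmat p z : Matrix (Config (n + 1)) _ F) =
      1 + rightWeight p z • siteHop (-(p.c * p.d)) 1 (Fin.last n) := by
  have h1 := hp.inv_sub_ne
  have ha := sub_ne_zero.mpr hp.c_ne
  have hb := sub_ne_zero.mpr hp.d_ne
  have hγ : p.δ ≠ 0 := div_ne_zero h1 (mul_ne_zero ha hb)
  have hα : p.β = p.δ * (-(p.c * p.d)) := by
    simp only [Params.β, Params.δ]; field_simp; ring
  rw [KNmat, atSite_boundaryLocal, ← smul_smul]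
  change _ + _ • _ • siteHop _ _ _ = _
  rw [smul_siteHop, hα, inv_mul_cancel₀ hγ, inv_mul_cancel_left₀ hγ]
  rfl

/-- Clears `τ⁻¹`, so that the nonvanishing conditions take the form `τ² z ≠ 1`. -/
theorem bulkWeight_eq {p : Params F} (hp : p.Regular) (z : F) :
    bulkWeight p z = p.τ * (z - 1) / (p.τ ^ 2 * z - 1) := by
  have h := hp.τ_ne
  rw [bulkWeight, ← mul_div_mul_left _ _ h, mul_sub p.τ (p.τ * z), mul_inv_cancel₀ h]
  ring_nf

theorem bond_ne {j : Fin n} : j.castSucc ≠ j.succ := (Fin.castSucc_lt_succ).ne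

theorem Rmat_mul_inv {p : Params F} (hp : p.Regular) (j : Fin n) {z : F} (hz : z ≠ 0)
    (h1 : p.τ ^ 2 * z - 1 ≠ 0) (h2 : p.τ ^ 2 * z⁻¹ - 1 ≠ 0) :
    Rmat p j z * Rmat p j z⁻¹ = 1 := by
  rw [Rmat_eq, Rmat_eq]
  refine baxter_inv (bondHop_sq _ _ _) ?_
  have h := hp.τ_ne
  have h3 : p.τ ^ 2 - z ≠ 0 := by
    intro h3; apply h2; rw [sub_eq_zero.mp h3]; field_simp; simp
  rw [bulkWeight_eq hp, bulkWeight_eq hp,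
    show p.τ * (z⁻¹ - 1) / (p.τ ^ 2 * z⁻¹ - 1) = p.τ * (1 - z) / (p.τ ^ 2 - z) by field_simp]
  generalize hD0 : p.τ ^ 2 * z - 1 = D0 at *
  generalize hD1 : p.τ ^ 2 - z = D1 at *
  field_simp
  simp only [← hD0, ← hD1]
  ring

theorem K1mat_mul_inv {p : Params F} (hp : p.Regular) {z : F} (hz : z ≠ 0)
    (h1 : z - p.a ≠ 0) (h2 : z - p.b ≠ 0) (h3 : z⁻¹ - p.a ≠ 0) (h4 : z⁻¹ - p.b ≠ 0) :
    (K1mat p z : Matrix (Config (n + 1)) _ F) * K1mat p z⁻¹ = 1 := by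
  rw [K1mat_eq hp, K1mat_eq hp]
  refine baxter_inv (siteHop_sq _ _ _) ?_
  have h3' : 1 - p.a * z ≠ 0 := by
    intro h; apply h3; field_simp; rw [mul_comm, h, mul_zero]
  have h4' : 1 - p.b * z ≠ 0 := by
    intro h; apply h4; field_simp; rw [mul_comm, h, mul_zero]
  rw [leftWeight, leftWeight, show (z⁻¹ ^ 2 - 1) / ((z⁻¹ - p.a) * (z⁻¹ - p.b)) =
    (1 - z ^ 2) / ((1 - p.a * z) * (1 - p.b * z)) by field_simp]
  generalize hD0 : z - p.a = D0 at *
  generalize hD1 : z - p.b = D1 at *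
  generalize hD2 : 1 - p.a * z = D2 at *
  generalize hD3 : 1 - p.b * z = D3 at *
  field_simp
  simp only [← hD0, ← hD1, ← hD2, ← hD3]
  ring

theorem KNmat_mul_inv {p : Params F} (hp : p.Regular) {z : F} (hz : z ≠ 0)
    (h1 : p.c * z - 1 ≠ 0) (h2 : p.d * z - 1 ≠ 0) (h3 : p.c * z⁻¹ - 1 ≠ 0)
    (h4 : p.d * z⁻¹ - 1 ≠ 0) :
    (KNmat p z : Matrix (Config (n + 1)) _ F) * KNmat p z⁻¹ = 1 := by
  rw [KNmat_eq hp, KNmat_eq hp]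
  refine baxter_inv (siteHop_sq _ _ _) ?_
  have h3' : p.c - z ≠ 0 := by
    intro h; apply h3; field_simp; simpa using h
  have h4' : p.d - z ≠ 0 := by
    intro h; apply h4; field_simp; simpa using h
  rw [rightWeight, rightWeight, show (1 - z⁻¹ ^ 2) / ((p.c * z⁻¹ - 1) * (p.d * z⁻¹ - 1)) =
    (z ^ 2 - 1) / ((p.c - z) * (p.d - z)) by field_simp]
  generalize hD0 : p.c * z - 1 = D0 at *
  generalize hD1 : p.d * z - 1 = D1 at *
  generalize hD2 : p.c - z = D2 at *
  generalize hD3 : p.d - z = D3 at *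
  field_simp
  simp only [← hD0, ← hD1, ← hD2, ← hD3]
  ring

theorem Rmat_yang_baxter {p : Params F} (hp : p.Regular) {j k : Fin n} (hjk : j.succ = k.castSucc)
    {u v : F} (h1 : p.τ ^ 2 * u - 1 ≠ 0) (h2 : p.τ ^ 2 * v - 1 ≠ 0)
    (h3 : p.τ ^ 2 * (u * v) - 1 ≠ 0) :
    Rmat p j u * Rmat p k (u * v) * Rmat p j v = Rmat p k v * Rmat p j (u * v) * Rmat p k u := by
  have e1 : j.castSucc ≠ k.succ := by
    have := congrArg Fin.val hjk
    intro h
    have := congrArg Fin.val h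
    simp at *; omega
  simp only [Rmat_eq, hjk]
  refine baxter_yang_baxter (bondHop_sq _ _ _) (bondHop_sq _ _ _)
    (bondHop_braid hp.τ_ne (hjk ▸ bond_ne) e1 bond_ne) ?_
  have h := hp.τ_ne
  simp only [bulkWeight_eq hp]
  generalize hD0 : p.τ ^ 2 * u - 1 = D0 at *
  generalize hD1 : p.τ ^ 2 * v - 1 = D1 at *
  generalize hD2 : p.τ ^ 2 * (u * v) - 1 = D2 at *
  field_simp
  simp only [← hD0, ← hD1, ← hD2]
  ring

theorem right_reflection {p : Params F} (hp : p.Regular) {j : Fin n} (hj : j.succ = Fin.last n)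
    {u v : F} (hv : v ≠ 0) (h1 : p.τ ^ 2 * (u * v) - 1 ≠ 0) (h2 : p.τ ^ 2 * (u / v) - 1 ≠ 0)
    (h3 : p.c * u - 1 ≠ 0) (h4 : p.d * u - 1 ≠ 0) (h5 : p.c * v - 1 ≠ 0) (h6 : p.d * v - 1 ≠ 0) :
    KNmat p v * Rmat p j (u * v) * KNmat p u * Rmat p j (u / v) =
      Rmat p j (u / v) * KNmat p u * Rmat p j (u * v) * KNmat p v := by
  simp only [Rmat_eq, KNmat_eq hp, ← hj]
  have h := hp.τ_ne
  refine baxter_reflection (bondHop_sq _ _ _) (siteHop_sq _ _ _)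
    (bond_site_relation_right h _ _ bond_ne) ?_
  have h2' : p.τ ^ 2 * u - v ≠ 0 := by
    intro h; apply h2; field_simp; simpa using h
  simp only [bulkWeight_eq hp, rightWeight,
    show p.τ * (u / v - 1) / (p.τ ^ 2 * (u / v) - 1) = p.τ * (u - v) / (p.τ ^ 2 * u - v) by
      field_simp]
  generalize hD0 : p.τ ^ 2 * (u * v) - 1 = D0 at *
  generalize hD1 : p.τ ^ 2 * u - v = D1 at *
  generalize hD2 : p.c * u - 1 = D2 at *
  generalize hD3 : p.d * u - 1 = D3 at *
  generalize hD4 : p.c * v - 1 = D4 at *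
  generalize hD5 : p.d * v - 1 = D5 at *
  field_simp
  simp only [← hD0, ← hD1, ← hD2, ← hD3, ← hD4, ← hD5]
  ring

theorem left_reflection {p : Params F} (hp : p.Regular) {j : Fin n} (hj : j.castSucc = 0)
    {u v : F} (hu : u ≠ 0) (hv : v ≠ 0) (h1 : p.τ ^ 2 * (u * v)⁻¹ - 1 ≠ 0)
    (h2 : p.τ ^ 2 * (v / u) - 1 ≠ 0)
    (h3 : u - p.a ≠ 0) (h4 : u - p.b ≠ 0) (h5 : v - p.a ≠ 0) (h6 : v - p.b ≠ 0) :
    K1mat p v * Rmat p j (u * v)⁻¹ * K1mat p u * Rmat p j (v / u) =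
      Rmat p j (v / u) * K1mat p u * Rmat p j (u * v)⁻¹ * K1mat p v := by
  simp only [Rmat_eq, K1mat_eq hp, ← hj]
  have h := hp.τ_ne
  refine baxter_reflection (bondHop_sq _ _ _) (siteHop_sq _ _ _)
    (bond_site_relation_left h _ _ bond_ne) ?_
  have h1' : p.τ ^ 2 - u * v ≠ 0 := by
    intro h; apply h1; field_simp; simpa using h
  have h2' : p.τ ^ 2 * v - u ≠ 0 := by
    intro h; apply h2; field_simp; simpa using h
  simp only [bulkWeight_eq hp, leftWeight,
    show p.τ * (v / u - 1) / (p.τ ^ 2 * (v / u) - 1) = p.τ * (v - u) / (p.τ ^ 2 * v - u) by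
      field_simp,
    show p.τ * ((u * v)⁻¹ - 1) / (p.τ ^ 2 * (u * v)⁻¹ - 1) =
      p.τ * (1 - u * v) / (p.τ ^ 2 - u * v) by field_simp]
  generalize hD0 : p.τ ^ 2 - u * v = D0 at *
  generalize hD1 : p.τ ^ 2 * v - u = D1 at *
  generalize hD2 : u - p.a = D2 at *
  generalize hD3 : u - p.b = D3 at *
  generalize hD4 : v - p.a = D4 at *
  generalize hD5 : v - p.b = D5 at *
  field_simp
  simp only [← hD0, ← hD1, ← hD2, ← hD3, ← hD4, ← hD5]
  ring

theorem Rmat_commute (p : Params F) {j k : Fin n} (hjk : (j : ℕ) + 2 ≤ k) (u v : F) :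
    Commute (Rmat p j u) (Rmat p k v) := by
  rw [Rmat_eq, Rmat_eq]
  refine baxter_commute _ _ (bondHop_commute _ bond_ne bond_ne ?_ ?_ ?_ ?_) <;>
    · simp only [Ne, Fin.ext_iff, Fin.val_castSucc, Fin.val_succ]; omega

theorem K1mat_commute_Rmat {p : Params F} (hp : p.Regular) {k : Fin n} (hk : 1 ≤ (k : ℕ)) (u v : F) :
    Commute (K1mat p u) (Rmat p k v) := by
  rw [Rmat_eq, K1mat_eq hp]
  refine baxter_commute _ _ (bondHop_commute_siteHop _ _ _ ?_ ?_).symm <;>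
    · simp only [Ne, Fin.ext_iff, Fin.val_castSucc, Fin.val_succ, Fin.val_zero]; omega

theorem Rmat_commute_KNmat {p : Params F} (hp : p.Regular) {k : Fin n} (hk : (k : ℕ) + 2 ≤ n)
    (u v : F) : Commute (Rmat p k v) (KNmat p u) := by
  rw [Rmat_eq, KNmat_eq hp]
  refine baxter_commute _ _ (bondHop_commute_siteHop _ _ _ ?_ ?_) <;>
    · simp only [Ne, Fin.ext_iff, Fin.val_castSucc, Fin.val_succ, Fin.val_last]; omega

theorem K1mat_commute_KNmat {p : Params F} (hp : p.Regular) (hn : 1 ≤ n) (u v : F) :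
    Commute (K1mat p u : Matrix (Config (n + 1)) _ F) (KNmat p v) := by
  rw [K1mat_eq hp, KNmat_eq hp]
  refine baxter_commute _ _ (siteHop_commute _ _ _ _ ?_)
  simp only [Ne, Fin.ext_iff, Fin.val_zero, Fin.val_last]; omega

end Matrices

/-! ### Automorphisms of the field of rational functions -/

section Automorphisms

variable {N : ℕ}

/-- The automorphisms of the lattice of exponents. -/
abbrev LatticeAut (N : ℕ) : Type := (Fin N → ℤ) ≃ₗ[ℤ] (Fin N → ℤ)

/-- A Laurent monomial as a rational function. -/
def mono (e : Fin N → ℤ) : RatField N :=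
  algebraMap (Laurent N) (RatField N) (AddMonoidAlgebra.single e 1)

theorem mono_add (e f : Fin N → ℤ) : mono (e + f) = mono e * mono f := by
  rw [mono, mono, mono, ← map_mul, AddMonoidAlgebra.single_mul_single, one_mul]

theorem mono_zero : mono (0 : Fin N → ℤ) = 1 := map_one (algebraMap (Laurent N) (RatField N))

theorem mono_ne_zero (e : Fin N → ℤ) : mono e ≠ 0 := fun h => by
  have := mono_add e (-e)
  rw [add_neg_cancel, mono_zero, h, zero_mul] at this
  exact one_ne_zero this

theorem mono_neg (e : Fin N → ℤ) : mono (-e) = (mono e)⁻¹ :=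
  eq_inv_of_mul_eq_one_left (by rw [← mono_add, neg_add_cancel, mono_zero])

theorem mono_sub (e f : Fin N → ℤ) : mono (e - f) = mono e / mono f := by
  rw [sub_eq_add_neg, mono_add, mono_neg, div_eq_mul_inv]

theorem zvar_eq_mono (i : Fin N) : zvar i = mono (Pi.single i 1) := rfl

theorem mono_injective : Function.Injective (mono : (Fin N → ℤ) → RatField N) := fun e f h => by
  have h1 := IsFractionRing.injective (Laurent N) (RatField N) h
  rcases AddMonoidAlgebra.single_inj.mp h1 with h2 | h2
  · exact h2.1
  · exact absurd h2.1 one_ne_zero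

/-- Up to units, every denominator in `Ř`, `K_1` and `K_N` is a product of such binomials. The
parameters `a, b, c, d` may be zero, so only one of the two coefficients is required to be nonzero.
-/
theorem const_mul_mono_sub_const_ne_zero {c c' : ℂ} (hc : c ≠ 0 ∨ c' ≠ 0) {e : Fin N → ℤ}
    (he : e ≠ 0) :
    algebraMap ℂ (RatField N) c * mono e - algebraMap ℂ (RatField N) c' ≠ 0 := by
  intro h
  rw [sub_eq_zero, mono, IsScalarTower.algebraMap_apply ℂ (Laurent N) (RatField N),
    IsScalarTower.algebraMap_apply ℂ (Laurent N) (RatField N), ← map_mul] at h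
  have h1 := IsFractionRing.injective (Laurent N) (RatField N) h
  have h2 : (AddMonoidAlgebra.single e c : Laurent N) = AddMonoidAlgebra.single 0 c' := by
    simpa using h1
  rcases AddMonoidAlgebra.single_inj.mp h2 with h3 | h3
  · exact he h3.1
  · exact hc.elim (fun h => h h3.1) (fun h => h h3.2)

/-- The endomorphism of the field of rational functions induced by an automorphism of the
lattice of exponents. -/
def expAut (g : LatticeAut N) : RatField N →+* RatField N :=
  (IsFractionRing.ringEquivOfRingEquiv (K := RatField N) (L := RatField N)
    (AddMonoidAlgebra.domCongr ℂ ℂ g.toAddEquiv).toRingEquiv).toRingHom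

theorem expAut_algebraMap (g : LatticeAut N) (x : Laurent N) :
    expAut g (algebraMap _ _ x) = algebraMap _ _ (AddMonoidAlgebra.domCongr ℂ ℂ g.toAddEquiv x) :=
  IsFractionRing.ringEquivOfRingEquiv_algebraMap _ x

theorem expAut_mono (g : LatticeAut N) (e : Fin N → ℤ) :
    expAut g (mono e) = mono (g e) := by
  rw [mono, expAut_algebraMap, AddMonoidAlgebra.domCongr_single]; rfl

theorem expAut_const (g : LatticeAut N) (c : ℂ) :
    expAut g (algebraMap ℂ (RatField N) c) = algebraMap ℂ (RatField N) c := by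
  rw [IsScalarTower.algebraMap_apply ℂ (Laurent N) (RatField N), expAut_algebraMap,
    AlgEquiv.commutes]

theorem ringHom_ext_of_laurent {S : Type*} [Field S] {φ ψ : RatField N →+* S}
    (h : ∀ x : Laurent N, φ (algebraMap _ _ x) = ψ (algebraMap _ _ x)) (x : RatField N) :
    φ x = ψ x := by
  obtain ⟨a, b, hb, rfl⟩ := IsFractionRing.div_surjective (A := Laurent N) x
  rw [map_div₀, map_div₀, h, h]

theorem expAut_mul (g h : LatticeAut N) (x : RatField N) :
    expAut (g * h) x = expAut g (expAut h x) := by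
  refine ringHom_ext_of_laurent (φ := expAut (g * h)) (ψ := (expAut g).comp (expAut h))
    (fun x => ?_) x
  rw [RingHom.comp_apply, expAut_algebraMap, expAut_algebraMap, expAut_algebraMap]
  congr 1
  have : (AddMonoidAlgebra.domCongr ℂ ℂ (g * h).toAddEquiv).toAlgHom =
      (AddMonoidAlgebra.domCongr ℂ ℂ g.toAddEquiv).toAlgHom.comp
        (AddMonoidAlgebra.domCongr ℂ ℂ h.toAddEquiv).toAlgHom :=
    AddMonoidAlgebra.algHom_ext (fun e => by
      simp [AddMonoidAlgebra.domCongr_single]) (by ext)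
  exact DFunLike.congr_fun this x

theorem expAut_one (x : RatField N) : expAut (1 : LatticeAut N) x = x := by
  refine ringHom_ext_of_laurent (φ := expAut 1) (ψ := RingHom.id _) (fun x => ?_) x
  rw [RingHom.id_apply, expAut_algebraMap]
  congr 1
  have : (AddMonoidAlgebra.domCongr ℂ ℂ (1 : LatticeAut N).toAddEquiv).toAlgHom =
      AlgHom.id ℂ _ :=
    AddMonoidAlgebra.algHom_ext (fun e => by
      simp [AddMonoidAlgebra.domCongr_single]) (by ext)
  exact DFunLike.congr_fun this x

/-- The automorphism of the lattice of exponents that exchanges two variables. -/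
def swapExp (i j : Fin N) : LatticeAut N where
  toFun := fun e k => e (Equiv.swap i j k)
  invFun := fun e k => e (Equiv.swap i j k)
  left_inv := fun e => by funext k; simp
  right_inv := fun e => by funext k; simp
  map_add' := fun _ _ => rfl
  map_smul' := fun _ _ => rfl

/-- The automorphism of the lattice of exponents that inverts a variable. -/
def invExp (i : Fin N) : LatticeAut N where
  toFun := fun e k => if k = i then -e k else e k
  invFun := fun e k => if k = i then -e k else e k
  left_inv := fun e => by funext k; by_cases h : k = i <;> simp [h]
  right_inv := fun e => by funext k; by_cases h : k = i <;> simp [h]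
  map_add' := fun e e' => by
    funext k
    by_cases h : k = i
    · simp [h, add_comm]
    · simp [h]
  map_smul' := fun c e => by
    funext k
    by_cases h : k = i <;> simp [h]

theorem swapExp_apply (i j : Fin N) (e : Fin N → ℤ) (k : Fin N) :
    swapExp i j e k = e (Equiv.swap i j k) := rfl

theorem invExp_apply (i : Fin N) (e : Fin N → ℤ) (k : Fin N) :
    invExp i e k = if k = i then -e k else e k := rfl

theorem latticeAut_ext {g h : LatticeAut N} (H : ∀ e k, g e k = h e k) : g = h :=
  LinearEquiv.ext fun e => funext fun k => H e k

theorem swapExp_mul_self (i j : Fin N) : swapExp i j * swapExp i j = 1 :=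
  latticeAut_ext fun e k => by
    simp [LinearEquiv.mul_apply, swapExp_apply]

theorem invExp_mul_self (i : Fin N) : invExp i * invExp i = 1 :=
  latticeAut_ext fun e k => by
    simp only [LinearEquiv.mul_apply, invExp_apply, LinearEquiv.coe_one, id_eq]
    split_ifs <;> simp

theorem invExp_commute (i j : Fin N) : Commute (invExp i) (invExp j) :=
  latticeAut_ext fun e k => by
    simp only [LinearEquiv.mul_apply, invExp_apply]
    split_ifs <;> simp

theorem swapExp_mul_invExp (i j k : Fin N) :
    swapExp i j * invExp k = invExp (Equiv.swap i j k) * swapExp i j :=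
  latticeAut_ext fun e l => by
    have : Equiv.swap i j l = k ↔ l = Equiv.swap i j k :=
      ⟨fun h => by rw [← h, Equiv.swap_apply_self], fun h => by rw [h, Equiv.swap_apply_self]⟩
    simp only [LinearEquiv.mul_apply, invExp_apply, swapExp_apply, this]

theorem swapExp_mul_swapExp_mul_swapExp {i j k : Fin N} (h1 : i ≠ j) (h2 : i ≠ k) (h3 : j ≠ k) :
    swapExp i j * swapExp j k * swapExp i j = swapExp i k :=
  latticeAut_ext fun e l => by
    simp only [LinearEquiv.mul_apply, swapExp_apply]
    refine congrArg e ?_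
    simp only [Equiv.swap_apply_def]
    split_ifs <;> simp_all

theorem swapExp_commute {i j k l : Fin N} (h1 : i ≠ k) (h2 : i ≠ l) (h3 : j ≠ k) (h4 : j ≠ l) :
    Commute (swapExp i j) (swapExp k l) :=
  latticeAut_ext fun e m => by
    simp only [LinearEquiv.mul_apply, swapExp_apply]
    refine congrArg e ?_
    simp only [Equiv.swap_apply_def]
    split_ifs <;> simp_all

theorem swapExp_comm (i j : Fin N) : swapExp i j = swapExp j i :=
  latticeAut_ext fun e k => by rw [swapExp_apply, swapExp_apply, Equiv.swap_comm]

theorem expAut_swapExp_zvar (i j k : Fin N) :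
    expAut (swapExp i j) (zvar k) = zvar (Equiv.swap i j k) := by
  rw [zvar_eq_mono, zvar_eq_mono, expAut_mono]
  congr 1
  funext l
  have : Equiv.swap i j l = k ↔ l = Equiv.swap i j k :=
      ⟨fun h => by rw [← h, Equiv.swap_apply_self], fun h => by rw [h, Equiv.swap_apply_self]⟩
  simp only [swapExp_apply, Pi.single_apply, this]

theorem expAut_invExp_zvar_self (i : Fin N) : expAut (invExp i) (zvar i) = (zvar i)⁻¹ := by
  rw [zvar_eq_mono, expAut_mono, ← mono_neg]
  congr 1
  funext l
  by_cases h : l = i <;> simp [invExp_apply, h]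

theorem expAut_invExp_zvar_of_ne {i k : Fin N} (h : k ≠ i) :
    expAut (invExp i) (zvar k) = zvar k := by
  rw [zvar_eq_mono, expAut_mono]
  congr 1
  funext l
  by_cases h' : l = i
  · subst h'; simp [invExp_apply, h.symm]
  · simp [invExp_apply, h']

theorem algebraMap_swapVar (i j : Fin N) (x : Laurent N) :
    algebraMap (Laurent N) (RatField N) (swapVar i j x) = expAut (swapExp i j) (algebraMap _ _ x) :=
  (expAut_algebraMap (swapExp i j) x).symm

theorem algebraMap_invVar (i : Fin N) (x : Laurent N) :
    algebraMap (Laurent N) (RatField N) (invVar i x) = expAut (invExp i) (algebraMap _ _ x) :=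
  (expAut_algebraMap (invExp i) x).symm

theorem zvar_ne_zero (i : Fin N) : zvar i ≠ 0 := mono_ne_zero _

theorem zvar_injective : Function.Injective (zvar : Fin N → RatField N) := fun i j h => by
  by_contra hij
  have := congrFun (mono_injective h) i
  simp [hij] at this

theorem zvar_ne_inv (i j : Fin N) : zvar i ≠ (zvar j)⁻¹ := fun h => by
  rw [zvar_eq_mono, zvar_eq_mono, ← mono_neg] at h
  have := congrFun (mono_injective h) i
  by_cases hij : i = j
  · subst hij; simp at this
  · simp [hij] at this

end Automorphisms

/-! ### Twisted operators -/

section Twisted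

variable {N : ℕ}

/-- The operator that applies the automorphism `g` to the entries and then the matrix `A`. -/
def twist (A : Matrix (Config N) (Config N) (RatField N)) (g : LatticeAut N) :
    AddMonoid.End (Config N → RatField N) where
  toFun ψ := A *ᵥ fun w => expAut g (ψ w)
  map_zero' := by
    have : (fun w : Config N => expAut g ((0 : Config N → RatField N) w)) = 0 := by
      funext w; simp
    rw [this, Matrix.mulVec_zero]
  map_add' ψ χ := by
    rw [← Matrix.mulVec_add]
    congr 1
    funext w; simp

instance endSMul : SMul (AddMonoid.End (Config N → RatField N)) (Config N → RatField N) :=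
  AddMonoid.End.applyDistribMulAction.toSMul

instance endDistribMulAction :
    DistribMulAction (AddMonoid.End (Config N → RatField N)) (Config N → RatField N) :=
  AddMonoid.End.applyDistribMulAction

theorem twist_smul (A : Matrix (Config N) (Config N) (RatField N)) (g : LatticeAut N)
    (ψ : Config N → RatField N) : twist A g • ψ = A *ᵥ fun w => expAut g (ψ w) := rfl

/-- The composition law of a semidirect product: moving the automorphism `g` past the matrix `B`
applies `g` to its entries. -/
theorem twist_mul (A B : Matrix (Config N) (Config N) (RatField N)) (g h : LatticeAut N) :
    twist A g * twist B h = twist (A * (expAut g).mapMatrix B) (g * h) := by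
  ext ψ w
  change (A *ᵥ fun w => expAut g ((B *ᵥ fun w => expAut h (ψ w)) w)) w =
    ((A * (expAut g).mapMatrix B) *ᵥ fun w => expAut (g * h) (ψ w)) w
  rw [← Matrix.mulVec_mulVec]
  congr 2
  funext w
  rw [RingHom.map_mulVec]
  simp only [expAut_mul]
  rfl

theorem twist_one_one : twist (1 : Matrix (Config N) (Config N) (RatField N)) 1 = 1 := by
  ext ψ w
  change ((1 : Matrix (Config N) (Config N) (RatField N)) *ᵥ fun w => expAut 1 (ψ w)) w = ψ w
  simp only [expAut_one, Matrix.one_mulVec]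

theorem twist_smul_smul (A : Matrix (Config N) (Config N) (RatField N)) (g : LatticeAut N)
    (c : RatField N) (ψ : Config N → RatField N) :
    twist A g • c • ψ = expAut g c • twist A g • ψ := by
  rw [twist_smul, twist_smul, ← Matrix.mulVec_smul]
  congr 1
  funext w
  simp

end Twisted

/-! ### The two halves of the scattering matrices -/

section Halves

variable {F : Type*} [Field F] {n : ℕ}

/-- The left half of the scattering matrix, with running spectral parameter `x`. -/
def leftHalf (p : Params F) (z : Fin (n + 1) → F) (i : Fin (n + 1)) (x : F) :
    Matrix (Config (n + 1)) (Config (n + 1)) F :=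
  ((leftBonds i).reverse.map fun j => Rmat p j (x / z j.castSucc)).prod * K1mat p x⁻¹ *
    ((leftBonds i).map fun j => Rmat p j (x * z j.castSucc)).prod

/-- The right half of the scattering matrix, with running spectral parameter `x`. -/
def rightHalf (p : Params F) (z : Fin (n + 1) → F) (i : Fin (n + 1)) (x : F) :
    Matrix (Config (n + 1)) (Config (n + 1)) F :=
  ((rightBonds i).map fun j => Rmat p j (x * z j.succ)).prod * KNmat p x *
    ((rightBonds i).reverse.map fun j => Rmat p j (x / z j.succ)).prod

theorem scattering_eq (p : Params F) (z : Fin (n + 1) → F) (i : Fin (n + 1)) :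
    scattering p z i = leftHalf p z i (z i) * rightHalf p z i (z i) := by
  simp only [scattering, leftHalf, rightHalf, mul_assoc]

theorem leftBonds_zero : leftBonds (0 : Fin (n + 1)) = [] := by
  simp [leftBonds]

theorem rightBonds_zero : rightBonds (0 : Fin (n + 1)) = List.finRange n := by
  simp [rightBonds]

theorem rightBonds_last : rightBonds (Fin.last n) = [] := by
  refine List.filter_eq_nil_iff.mpr fun j _ => ?_
  simp

theorem leftBonds_succ (j : Fin n) : leftBonds j.succ = leftBonds j.castSucc ++ [j] := by
  refine List.SortedLT.eq_of_mem_iff ?_ ?_ fun k => ?_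
  · exact ((List.sortedLT_finRange n).pairwise.filter _).sortedLT
  · refine List.Pairwise.sortedLT (List.pairwise_append.mpr
      ⟨(List.sortedLT_finRange n).pairwise.filter _, List.pairwise_singleton _ _, ?_⟩)
    intro a ha b hb
    rw [List.mem_singleton] at hb
    subst hb
    simpa [leftBonds] using ha
  · simp only [leftBonds, List.mem_filter, List.mem_finRange, true_and, decide_eq_true_eq,
      List.mem_append, List.mem_singleton, Fin.lt_def, Fin.ext_iff, Fin.val_castSucc, Fin.val_succ]
    omega

theorem rightBonds_castSucc (j : Fin n) : rightBonds j.castSucc = j :: rightBonds j.succ := by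
  refine List.SortedLT.eq_of_mem_iff ?_ ?_ fun k => ?_
  · exact ((List.sortedLT_finRange n).pairwise.filter _).sortedLT
  · refine List.Pairwise.sortedLT (List.pairwise_cons.mpr
      ⟨?_, (List.sortedLT_finRange n).pairwise.filter _⟩)
    intro b hb
    simp only [rightBonds, List.mem_filter, List.mem_finRange, true_and, decide_eq_true_eq,
      Fin.le_def, Fin.val_castSucc, Fin.val_succ] at hb
    exact hb
  · simp only [rightBonds, List.mem_filter, List.mem_finRange, true_and, decide_eq_true_eq,
      List.mem_cons, Fin.le_def, Fin.ext_iff, Fin.val_castSucc, Fin.val_succ]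
    omega

theorem leftHalf_zero (p : Params F) (z : Fin (n + 1) → F) (x : F) :
    leftHalf p z 0 x = K1mat p x⁻¹ := by
  simp [leftHalf, leftBonds_zero]

theorem leftHalf_succ (p : Params F) (z : Fin (n + 1) → F) (j : Fin n) (x : F) :
    leftHalf p z j.succ x =
      Rmat p j (x / z j.castSucc) * leftHalf p z j.castSucc x * Rmat p j (x * z j.castSucc) := by
  simp [leftHalf, leftBonds_succ, mul_assoc]

theorem rightHalf_last (p : Params F) (z : Fin (n + 1) → F) (x : F) :
    rightHalf p z (Fin.last n) x = KNmat p x := by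
  simp [rightHalf, rightBonds_last]

theorem rightHalf_castSucc (p : Params F) (z : Fin (n + 1) → F) (j : Fin n) (x : F) :
    rightHalf p z j.castSucc x =
      Rmat p j (x * z j.succ) * rightHalf p z j.succ x * Rmat p j (x / z j.succ) := by
  simp [rightHalf, rightBonds_castSucc, mul_assoc]

end Halves

/-! ### Base change of the operators -/

section BaseChange

variable {F F' : Type*} [Field F] [Field F'] {n : ℕ}

theorem Params.Regular.map {p : Params F} (hp : p.Regular) (φ : F →+* F') :
    (p.map φ).Regular where
  τ_ne := (map_ne_zero φ).mpr hp.τ_ne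
  sq_ne h := hp.sq_ne (φ.injective (by rw [map_pow, map_one]; exact h))
  a_ne h := hp.a_ne (φ.injective (h.trans (map_one φ).symm))
  b_ne h := hp.b_ne (φ.injective (h.trans (map_one φ).symm))
  c_ne h := hp.c_ne (φ.injective (h.trans (map_one φ).symm))
  d_ne h := hp.d_ne (φ.injective (h.trans (map_one φ).symm))

theorem mapMatrix_hop {X : Type*} [Fintype X] [DecidableEq X] (φ : F →+* F') (g : X → F)
    (π : Equiv.Perm X) : φ.mapMatrix (hop g π) = hop (fun w => φ (g w)) π := by
  ext w v
  simp only [RingHom.mapMatrix_apply, Matrix.map_apply, hop, Matrix.of_apply, map_sub]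
  congr 1 <;> split_ifs <;> simp

theorem mapMatrix_one_add_smul {X : Type*} [Fintype X] [DecidableEq X] (φ : F →+* F') (c : F)
    (A : Matrix X X F) : φ.mapMatrix (1 + c • A) = 1 + φ c • φ.mapMatrix A := by
  rw [map_add, map_one]
  congr 1
  ext w v
  simp

theorem mapMatrix_bondHop {N : ℕ} (φ : F →+* F') (τ : F) (i k : Fin N) :
    φ.mapMatrix (bondHop τ i k) = bondHop (φ τ) i k := by
  rw [bondHop, mapMatrix_hop]
  simp only [bulkRate, map_zpow₀]
  rfl

theorem mapMatrix_siteHop {N : ℕ} (φ : F →+* F') (ρ σ : F) (i : Fin N) :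
    φ.mapMatrix (siteHop ρ σ i) = siteHop (φ ρ) (φ σ) i := by
  rw [siteHop, mapMatrix_hop]
  have : ∀ x, φ (boundaryRate ρ σ x) = boundaryRate (φ ρ) (φ σ) x := fun x => by
    cases x <;> simp [boundaryRate]
  simp only [this]
  rfl

theorem mapMatrix_Rmat (φ : F →+* F') (p : Params F) (j : Fin n) (x : F) :
    φ.mapMatrix (Rmat p j x) = Rmat (p.map φ) j (φ x) := by
  rw [Rmat_eq, Rmat_eq, mapMatrix_one_add_smul, mapMatrix_bondHop]
  simp [bulkWeight, Params.map]

theorem mapMatrix_K1mat (φ : F →+* F') {p : Params F} (hp : p.Regular) (x : F) :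
    φ.mapMatrix (K1mat p x : Matrix (Config (n + 1)) _ F) = K1mat (p.map φ) (φ x) := by
  rw [K1mat_eq hp, K1mat_eq (hp.map φ), mapMatrix_one_add_smul, mapMatrix_siteHop]
  simp [leftWeight, Params.map]

theorem mapMatrix_KNmat (φ : F →+* F') {p : Params F} (hp : p.Regular) (x : F) :
    φ.mapMatrix (KNmat p x : Matrix (Config (n + 1)) _ F) = KNmat (p.map φ) (φ x) := by
  rw [KNmat_eq hp, KNmat_eq (hp.map φ), mapMatrix_one_add_smul, mapMatrix_siteHop]
  simp [rightWeight, Params.map]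

theorem mapMatrix_leftHalf (φ : F →+* F') {p : Params F} (hp : p.Regular) (z : Fin (n + 1) → F)
    (i : Fin (n + 1)) (x : F) : φ.mapMatrix (leftHalf p z i x) =
      leftHalf (p.map φ) (fun k => φ (z k)) i (φ x) := by
  simp only [leftHalf, map_mul, map_list_prod, List.map_map, mapMatrix_K1mat φ hp, map_inv₀,
    Function.comp_def, mapMatrix_Rmat, map_div₀]

theorem mapMatrix_rightHalf (φ : F →+* F') {p : Params F} (hp : p.Regular)
    (z : Fin (n + 1) → F) (i : Fin (n + 1)) (x : F) : φ.mapMatrix (rightHalf p z i x) =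
      rightHalf (p.map φ) (fun k => φ (z k)) i (φ x) := by
  simp only [rightHalf, map_mul, map_list_prod, List.map_map, mapMatrix_KNmat φ hp,
    Function.comp_def, mapMatrix_Rmat, map_div₀]

/-- Only the parameters of the sites before `i` enter besides the running parameter `x`, so a
substitution that moves other variables acts on `x` alone. -/
theorem leftHalf_congr (p : Params F) {z z' : Fin (n + 1) → F} {i : Fin (n + 1)}
    (h : ∀ k < i, z k = z' k) (x : F) : leftHalf p z i x = leftHalf p z' i x := by
  have h' : ∀ j ∈ leftBonds i, z j.castSucc = z' j.castSucc := fun j hj =>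
    h _ (by simpa [leftBonds] using hj)
  unfold leftHalf
  congr 2
  · congr 1
    exact List.map_congr_left fun j hj => by rw [h' j (List.mem_reverse.mp hj)]
  · exact List.map_congr_left fun j hj => by rw [h' j hj]

theorem rightHalf_congr (p : Params F) {z z' : Fin (n + 1) → F} {i : Fin (n + 1)}
    (h : ∀ k, i < k → z k = z' k) (x : F) : rightHalf p z i x = rightHalf p z' i x := by
  have h' : ∀ j ∈ rightBonds i, z j.succ = z' j.succ := fun j hj =>
    h _ (lt_of_le_of_lt (by simpa [rightBonds] using hj) Fin.castSucc_lt_succ)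
  unfold rightHalf
  congr 2
  · congr 1
    exact List.map_congr_left fun j hj => by rw [h' j hj]
  · exact List.map_congr_left fun j hj => by rw [h' j (List.mem_reverse.mp hj)]

end BaseChange

/-! ### The generators of the affine Weyl group as twisted operators -/

section Generators

variable {n : ℕ}

/-- The automorphism of the lattice of exponents attached to a generator. -/
def genAut (n : ℕ) : ℕ → LatticeAut (n + 1)
  | 0 => invExp 0
  | k + 1 => if h : k < n then swapExp (Fin.castSucc ⟨k, h⟩) (Fin.succ ⟨k, h⟩)
      else invExp (Fin.last n)

/-- The matrix attached to a generator. -/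
def genMat (n : ℕ) (p : Params ℂ) : ℕ → Matrix (Config (n + 1)) (Config (n + 1)) (RatField (n + 1))
  | 0 => K1mat (p.const (n + 1)) (zvar 0)⁻¹
  | k + 1 => if h : k < n then
      Rmat (p.const (n + 1)) ⟨k, h⟩ (zvar (Fin.succ ⟨k, h⟩) / zvar (Fin.castSucc ⟨k, h⟩))
      else KNmat (p.const (n + 1)) (zvar (Fin.last n))⁻¹

/-- The generators of the affine Weyl group acting on vectors of rational functions. -/
def gen (n : ℕ) (p : Params ℂ) (k : ℕ) : AddMonoid.End (Config (n + 1) → RatField (n + 1)) :=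
  twist (genMat n p k) (genAut n k)

theorem gen_zero (p : Params ℂ) :
    gen n p 0 = twist (K1mat (p.const (n + 1)) (zvar 0)⁻¹) (invExp 0) := rfl

theorem gen_succ (p : Params ℂ) (j : Fin n) : gen n p (j + 1) =
    twist (Rmat (p.const (n + 1)) j (zvar j.succ / zvar j.castSucc))
      (swapExp j.castSucc j.succ) := by
  simp [gen, genMat, genAut]

theorem gen_last (p : Params ℂ) : gen n p (n + 1) =
    twist (KNmat (p.const (n + 1)) (zvar (Fin.last n))⁻¹) (invExp (Fin.last n)) := by
  simp [gen, genMat, genAut]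

theorem const_map (N : ℕ) (p : Params ℂ) (g : LatticeAut N) :
    (p.const N).map (expAut g) = p.const N := by
  simp only [Params.const, Params.map, expAut_const]

theorem Params.Regular.const {p : Params ℂ} (hp : p.Regular) (N : ℕ) : (p.const N).Regular :=
  hp.map _

theorem expAut_Rmat (p : Params ℂ) (g : LatticeAut (n + 1)) (j : Fin n) (x : RatField (n + 1)) :
    (expAut g).mapMatrix (Rmat (p.const (n + 1)) j x) = Rmat (p.const (n + 1)) j (expAut g x) := by
  rw [mapMatrix_Rmat, const_map]

theorem expAut_K1mat {p : Params ℂ} (hp : p.Regular) (g : LatticeAut (n + 1))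
    (x : RatField (n + 1)) : (expAut g).mapMatrix
      (K1mat (p.const (n + 1)) x : Matrix (Config (n + 1)) _ (RatField (n + 1))) =
      K1mat (p.const (n + 1)) (expAut g x) := by
  rw [mapMatrix_K1mat _ (hp.const _), const_map]

theorem expAut_KNmat {p : Params ℂ} (hp : p.Regular) (g : LatticeAut (n + 1))
    (x : RatField (n + 1)) : (expAut g).mapMatrix
      (KNmat (p.const (n + 1)) x : Matrix (Config (n + 1)) _ (RatField (n + 1))) =
      KNmat (p.const (n + 1)) (expAut g x) := by
  rw [mapMatrix_KNmat _ (hp.const _), const_map]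

/-- Both sides obey the recursion `leftHalf_succ`. Conjugation by `T (j + 1)` contributes
`Ř(z_{j+1}/z_j)` on the left; on the right the same factor is first hit by the inversion and the
exchange, which turn its argument into `z_{j+1} z_j`. -/
theorem leftRefl_gen {p : Params ℂ} (hp : p.Regular) (i : Fin (n + 1)) :
    leftRefl (gen n p) i = twist (leftHalf (p.const (n + 1)) zvar i (zvar i)) (invExp i) := by
  induction i using Fin.induction with
  | zero => rw [leftHalf_zero]; rfl
  | succ j ih =>
    rw [Fin.val_castSucc] at ih
    rw [Fin.val_succ, leftRefl, ih, gen_succ, twist_mul, twist_mul]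
    congr 1
    · rw [mapMatrix_leftHalf _ (hp.const _), const_map, expAut_Rmat, expAut_swapExp_zvar,
        Equiv.swap_apply_left, expAut_mul, map_div₀, map_div₀, expAut_invExp_zvar_self,
        expAut_invExp_zvar_of_ne bond_ne.symm, map_inv₀, expAut_swapExp_zvar, expAut_swapExp_zvar,
        Equiv.swap_apply_left, Equiv.swap_apply_right, div_inv_eq_mul, leftHalf_succ,
        mul_comm (zvar j.castSucc)]
      congr 2
      refine leftHalf_congr _ (fun k hk => ?_) _
      rw [expAut_swapExp_zvar, Equiv.swap_apply_of_ne_of_ne hk.ne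
        (hk.trans Fin.castSucc_lt_succ).ne]
    · rw [swapExp_mul_invExp, Equiv.swap_apply_left, mul_assoc, swapExp_mul_self, mul_one]

/-- Sites are counted from zero, so site `i` belongs to the generators from `T (i + 1)` on. The
running parameter is `z_i⁻¹` because the last generator carries `K_N(1/z_N)`; the left reflection
inverts it back in `translation_gen`. -/
theorem rightRefl_gen {p : Params ℂ} (hp : p.Regular) (i : Fin (n + 1)) :
    rightRefl n (gen n p) (i + 1) =
      twist (rightHalf (p.const (n + 1)) zvar i (zvar i)⁻¹) (invExp i) := by
  induction i using Fin.reverseInduction with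
  | last => rw [Fin.val_last, rightRefl_last, gen_last, rightHalf_last]
  | cast j ih =>
    rw [Fin.val_succ] at ih
    rw [Fin.val_castSucc, rightRefl_eq _ (by omega), ih, gen_succ, twist_mul, twist_mul]
    congr 1
    · rw [mapMatrix_rightHalf _ (hp.const _), const_map, expAut_Rmat, map_inv₀,
        expAut_swapExp_zvar,
        Equiv.swap_apply_right, expAut_mul, map_div₀, map_div₀, expAut_invExp_zvar_self,
        expAut_invExp_zvar_of_ne bond_ne, map_inv₀, expAut_swapExp_zvar, expAut_swapExp_zvar,
        Equiv.swap_apply_left, Equiv.swap_apply_right, rightHalf_castSucc, div_eq_mul_inv,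
        div_eq_mul_inv, mul_comm (zvar j.succ)]
      congr 2
      refine rightHalf_congr _ (fun k hk => ?_) _
      rw [expAut_swapExp_zvar, Equiv.swap_apply_of_ne_of_ne
        (Fin.castSucc_lt_succ.trans hk).ne' hk.ne']
    · rw [swapExp_mul_invExp, Equiv.swap_apply_right, mul_assoc, swapExp_mul_self, mul_one]

/-- The left and right reflections both invert `z_i`. The inversions cancel, so the translation is a
linear operator, and its matrix is the product of the two halves of the scattering matrix. -/
theorem translation_gen {p : Params ℂ} (hp : p.Regular) (i : Fin (n + 1)) :
    translation n (gen n p) i = twist (scattering (p.const (n + 1)) zvar i) 1 := by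
  rw [translation, leftRefl_gen hp, rightRefl_gen hp, twist_mul, invExp_mul_self, scattering_eq,
    mapMatrix_rightHalf _ (hp.const _), const_map, map_inv₀, expAut_invExp_zvar_self, inv_inv]
  congr 2
  refine rightHalf_congr _ (fun k hk => ?_) _
  rw [expAut_invExp_zvar_of_ne hk.ne']

end Generators

/-! ### The affine Weyl group relations for the twisted generators -/

section GeneratorRelations

variable {n : ℕ}

theorem bulk_mono_ne {N : ℕ} (p : Params ℂ) {e : Fin N → ℤ} (he : e ≠ 0) :
    (p.const N).τ ^ 2 * mono e - 1 ≠ 0 := by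
  have := const_mul_mono_sub_const_ne_zero (c := p.τ ^ 2) (c' := 1) (Or.inr one_ne_zero) he
  rwa [map_pow, map_one] at this

theorem zvar_div_zvar {N : ℕ} (i j : Fin N) :
    zvar i / zvar j = mono (Pi.single i 1 - Pi.single j 1) := (mono_sub _ _).symm

theorem zvar_mul_zvar {N : ℕ} (i j : Fin N) :
    zvar i * zvar j = mono (Pi.single i 1 + Pi.single j 1) := (mono_add _ _).symm

theorem single_sub_single_ne {N : ℕ} {i j : Fin N} (h : i ≠ j) :
    (Pi.single i 1 - Pi.single j 1 : Fin N → ℤ) ≠ 0 := fun h0 => by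
  have := congrFun h0 i
  simp [h] at this

theorem single_add_single_ne {N : ℕ} {i j : Fin N} (h : i ≠ j) :
    (Pi.single i 1 + Pi.single j 1 : Fin N → ℤ) ≠ 0 := fun h0 => by
  have := congrFun h0 i
  simp [h] at this

theorem bulk_div_ne {N : ℕ} (p : Params ℂ) {i j : Fin N} (h : i ≠ j) :
    (p.const N).τ ^ 2 * (zvar i / zvar j) - 1 ≠ 0 := by
  rw [zvar_div_zvar]; exact bulk_mono_ne p (single_sub_single_ne h)

theorem bulk_mul_ne {N : ℕ} (p : Params ℂ) {i j : Fin N} (h : i ≠ j) :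
    (p.const N).τ ^ 2 * (zvar i * zvar j) - 1 ≠ 0 := by
  rw [zvar_mul_zvar]; exact bulk_mono_ne p (single_add_single_ne h)

theorem bulk_inv_mul_inv_ne {N : ℕ} (p : Params ℂ) {i j : Fin N} (h : i ≠ j) :
    (p.const N).τ ^ 2 * ((zvar i)⁻¹ * (zvar j)⁻¹) - 1 ≠ 0 := by
  rw [← mul_inv, zvar_mul_zvar, ← mono_neg]
  exact bulk_mono_ne p (neg_ne_zero.mpr (single_add_single_ne h))

theorem single_ne {N : ℕ} (i : Fin N) : (Pi.single i 1 : Fin N → ℤ) ≠ 0 := by simp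

theorem mono_sub_const_ne {N : ℕ} {e : Fin N → ℤ} (he : e ≠ 0) (a : ℂ) :
    mono e - algebraMap ℂ (RatField N) a ≠ 0 := by
  have := const_mul_mono_sub_const_ne_zero (c := 1) (c' := a) (Or.inl one_ne_zero) he
  rwa [map_one, one_mul] at this

theorem const_mul_mono_sub_one_ne {N : ℕ} {e : Fin N → ℤ} (he : e ≠ 0) (a : ℂ) :
    algebraMap ℂ (RatField N) a * mono e - 1 ≠ 0 := by
  have := const_mul_mono_sub_const_ne_zero (c := a) (c' := 1) (Or.inr one_ne_zero) he
  rwa [map_one] at this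

theorem zvar_sub_const_ne {N : ℕ} (i : Fin N) (a : ℂ) :
    zvar i - algebraMap ℂ (RatField N) a ≠ 0 := mono_sub_const_ne (single_ne i) a

theorem zvar_inv_sub_const_ne {N : ℕ} (i : Fin N) (a : ℂ) :
    (zvar i)⁻¹ - algebraMap ℂ (RatField N) a ≠ 0 := by
  rw [zvar_eq_mono, ← mono_neg]
  exact mono_sub_const_ne (neg_ne_zero.mpr (single_ne i)) a

theorem const_mul_zvar_sub_one_ne {N : ℕ} (i : Fin N) (a : ℂ) :
    algebraMap ℂ (RatField N) a * zvar i - 1 ≠ 0 := const_mul_mono_sub_one_ne (single_ne i) a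

theorem const_mul_zvar_inv_sub_one_ne {N : ℕ} (i : Fin N) (a : ℂ) :
    algebraMap ℂ (RatField N) a * (zvar i)⁻¹ - 1 ≠ 0 := by
  rw [zvar_eq_mono, ← mono_neg]
  exact const_mul_mono_sub_one_ne (neg_ne_zero.mpr (single_ne i)) a

theorem K1mat_zvar_mul {p : Params ℂ} (hp : p.Regular) :
    K1mat (p.const (n + 1)) (zvar 0) * K1mat (p.const (n + 1)) (zvar 0)⁻¹ =
      (1 : Matrix (Config (n + 1)) _ (RatField (n + 1))) :=
  K1mat_mul_inv (hp.const _) (zvar_ne_zero 0) (zvar_sub_const_ne _ _) (zvar_sub_const_ne _ _)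
    (zvar_inv_sub_const_ne _ _) (zvar_inv_sub_const_ne _ _)

theorem KNmat_zvar_mul {p : Params ℂ} (hp : p.Regular) (i : Fin (n + 1)) :
    KNmat (p.const (n + 1)) (zvar i) * KNmat (p.const (n + 1)) (zvar i)⁻¹ =
      (1 : Matrix (Config (n + 1)) _ (RatField (n + 1))) :=
  KNmat_mul_inv (hp.const _) (zvar_ne_zero i) (const_mul_zvar_sub_one_ne _ _)
    (const_mul_zvar_sub_one_ne _ _)
    (const_mul_zvar_inv_sub_one_ne _ _) (const_mul_zvar_inv_sub_one_ne _ _)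

theorem Rmat_zvar_mul {p : Params ℂ} (hp : p.Regular) (j : Fin n) {i k : Fin (n + 1)}
    (h : i ≠ k) : Rmat (p.const (n + 1)) j (zvar i / zvar k) *
      Rmat (p.const (n + 1)) j (zvar k / zvar i) = 1 := by
  have := Rmat_mul_inv (hp.const (n + 1)) j (div_ne_zero (zvar_ne_zero i) (zvar_ne_zero k))
    (bulk_div_ne p h) (by rw [inv_div]; exact bulk_div_ne p h.symm)
  rwa [inv_div] at this

theorem gen_mul_self {p : Params ℂ} (hp : p.Regular) {k : ℕ} (hk : k ≤ n + 1) :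
    gen n p k * gen n p k = 1 := by
  rcases k with _ | k
  · rw [gen_zero, twist_mul, invExp_mul_self, expAut_K1mat hp, map_inv₀, expAut_invExp_zvar_self,
      inv_inv, mul_eq_one_comm.mp (K1mat_zvar_mul hp), twist_one_one]
  · rcases (Nat.lt_succ_iff_lt_or_eq.mp hk) with hk | rfl
    · have hkn : k < n := by omega
      rw [gen_succ p ⟨k, hkn⟩, twist_mul, swapExp_mul_self, expAut_Rmat, map_div₀,
        expAut_swapExp_zvar, expAut_swapExp_zvar, Equiv.swap_apply_left, Equiv.swap_apply_right,
        Rmat_zvar_mul hp _ bond_ne.symm, twist_one_one]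
    · rw [gen_last, twist_mul, invExp_mul_self, expAut_KNmat hp, map_inv₀, expAut_invExp_zvar_self,
        inv_inv, mul_eq_one_comm.mp (KNmat_zvar_mul hp _), twist_one_one]

theorem twist_commute {N : ℕ} {A B : Matrix (Config N) (Config N) (RatField N)}
    {g h : LatticeAut N} (hA : (expAut h).mapMatrix A = A) (hB : (expAut g).mapMatrix B = B)
    (hAB : Commute A B) (hgh : Commute g h) : Commute (twist A g) (twist B h) := by
  rw [commute_iff_eq, twist_mul, twist_mul, hA, hB, hAB.eq, hgh.eq]

theorem gen_commute {p : Params ℂ} (hp : p.Regular) {j k : ℕ} (hjk : j + 2 ≤ k)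
    (hk : k ≤ n + 1) : Commute (gen n p j) (gen n p k) := by
  obtain ⟨k, rfl⟩ : ∃ k', k = k' + 1 := ⟨k - 1, by omega⟩
  rcases j with _ | j <;> rcases (Nat.lt_succ_iff_lt_or_eq.mp hk) with hk | rfl
  · have hkn : k < n := by omega
    have h1 : Fin.castSucc (⟨k, hkn⟩ : Fin n) ≠ 0 := by
      simp only [Ne, Fin.ext_iff, Fin.val_castSucc, Fin.val_zero]; omega
    have h2 : Fin.succ (⟨k, hkn⟩ : Fin n) ≠ 0 := Fin.succ_ne_zero _
    rw [gen_zero, gen_succ p ⟨k, hkn⟩]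
    refine twist_commute ?_ ?_ (K1mat_commute_Rmat (hp.const _) (by simp; omega) _ _) ?_
    · rw [expAut_K1mat hp, map_inv₀, expAut_swapExp_zvar,
        Equiv.swap_apply_of_ne_of_ne h1.symm h2.symm]
    · rw [expAut_Rmat, map_div₀, expAut_invExp_zvar_of_ne h1, expAut_invExp_zvar_of_ne h2]
    · have := swapExp_mul_invExp (Fin.castSucc (⟨k, hkn⟩ : Fin n)) (Fin.succ ⟨k, hkn⟩) 0
      rw [Equiv.swap_apply_of_ne_of_ne h1.symm h2.symm] at this
      exact this.symm
  · have h : (0 : Fin (k + 1)) ≠ Fin.last k := by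
      simp only [Ne, Fin.ext_iff, Fin.val_last, Fin.val_zero]; omega
    rw [gen_zero, gen_last]
    refine twist_commute ?_ ?_ (K1mat_commute_KNmat (hp.const _) (by omega) _ _)
      (invExp_commute _ _)
    · rw [expAut_K1mat hp, map_inv₀, expAut_invExp_zvar_of_ne h]
    · rw [expAut_KNmat hp, map_inv₀, expAut_invExp_zvar_of_ne h.symm]
  · have hkn : k < n := by omega
    have hjn : j < n := by omega
    have h1 : Fin.castSucc (⟨j, hjn⟩ : Fin n) ≠ Fin.castSucc ⟨k, hkn⟩ := by
      simp only [Ne, Fin.ext_iff, Fin.val_castSucc]; omega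
    have h2 : Fin.castSucc (⟨j, hjn⟩ : Fin n) ≠ Fin.succ ⟨k, hkn⟩ := by
      simp only [Ne, Fin.ext_iff, Fin.val_castSucc, Fin.val_succ]; omega
    have h3 : Fin.succ (⟨j, hjn⟩ : Fin n) ≠ Fin.castSucc ⟨k, hkn⟩ := by
      simp only [Ne, Fin.ext_iff, Fin.val_castSucc, Fin.val_succ]; omega
    have h4 : Fin.succ (⟨j, hjn⟩ : Fin n) ≠ Fin.succ ⟨k, hkn⟩ := by
      simp only [Ne, Fin.ext_iff, Fin.val_succ]; omega
    rw [gen_succ p ⟨j, hjn⟩, gen_succ p ⟨k, hkn⟩]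
    refine twist_commute ?_ ?_ (Rmat_commute _ (by simp; omega) _ _)
      (swapExp_commute h1 h2 h3 h4)
    · rw [expAut_Rmat, map_div₀, expAut_swapExp_zvar, expAut_swapExp_zvar,
        Equiv.swap_apply_of_ne_of_ne h1 h2, Equiv.swap_apply_of_ne_of_ne h3 h4]
    · rw [expAut_Rmat, map_div₀, expAut_swapExp_zvar, expAut_swapExp_zvar,
        Equiv.swap_apply_of_ne_of_ne h1.symm h3.symm, Equiv.swap_apply_of_ne_of_ne h2.symm h4.symm]
  · have hjn : j < k := by omega
    have h1 : Fin.castSucc (⟨j, hjn⟩ : Fin k) ≠ Fin.last k := by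
      simp only [Ne, Fin.ext_iff, Fin.val_castSucc, Fin.val_last]; omega
    have h2 : Fin.succ (⟨j, hjn⟩ : Fin k) ≠ Fin.last k := by
      simp only [Ne, Fin.ext_iff, Fin.val_succ, Fin.val_last]; omega
    rw [gen_succ p ⟨j, hjn⟩, gen_last]
    refine twist_commute ?_ ?_ (Rmat_commute_KNmat (hp.const _) (by simp; omega) _ _) ?_
    · rw [expAut_Rmat, map_div₀, expAut_invExp_zvar_of_ne h1, expAut_invExp_zvar_of_ne h2]
    · rw [expAut_KNmat hp, map_inv₀, expAut_swapExp_zvar,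
        Equiv.swap_apply_of_ne_of_ne h1.symm h2.symm]
    · have := swapExp_mul_invExp (Fin.castSucc (⟨j, hjn⟩ : Fin k)) (Fin.succ ⟨j, hjn⟩) (Fin.last k)
      rwa [Equiv.swap_apply_of_ne_of_ne h1.symm h2.symm] at this

/-- The relation splits into its two components: the Yang–Baxter equation with `u = z_k / z_j` and
`v = z_{k+1} / z_k` for the matrices, and the braid relation of transpositions for the
substitutions. -/
theorem gen_braid {p : Params ℂ} (hp : p.Regular) {j k : Fin n} (hjk : j.succ = k.castSucc) :
    gen n p (j + 1) * gen n p (k + 1) * gen n p (j + 1) =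
      gen n p (k + 1) * gen n p (j + 1) * gen n p (k + 1) := by
  have h1 : j.castSucc ≠ k.castSucc := hjk ▸ bond_ne
  have h2 : k.castSucc ≠ k.succ := bond_ne
  have h3 : j.castSucc ≠ k.succ := by
    have := congrArg Fin.val hjk
    simp only [Fin.val_castSucc, Fin.val_succ] at this
    simp only [Ne, Fin.ext_iff, Fin.val_castSucc, Fin.val_succ]; omega
  rw [gen_succ, gen_succ, hjk]
  simp only [twist_mul]
  refine congrArg₂ twist ?_ ?_
  · simp only [expAut_Rmat, expAut_mul, map_div₀, expAut_swapExp_zvar, Equiv.swap_apply_left,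
      Equiv.swap_apply_right, Equiv.swap_apply_of_ne_of_ne h3.symm h2.symm,
      Equiv.swap_apply_of_ne_of_ne h1 h3]
    have e : zvar k.castSucc / zvar j.castSucc * (zvar k.succ / zvar k.castSucc) =
        zvar k.succ / zvar j.castSucc := by
      rw [mul_comm, div_mul_div_cancel₀ (zvar_ne_zero _)]
    have := Rmat_yang_baxter (hp.const (n + 1)) hjk (u := zvar k.castSucc / zvar j.castSucc)
      (v := zvar k.succ / zvar k.castSucc) (bulk_div_ne p h1.symm) (bulk_div_ne p h2.symm)
      (by rw [e]; exact bulk_div_ne p h3.symm)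
    rw [e] at this
    exact this
  · rw [swapExp_mul_swapExp_mul_swapExp h1 h3 h2, swapExp_comm j.castSucc k.castSucc,
      swapExp_comm k.castSucc k.succ,
      swapExp_mul_swapExp_mul_swapExp h2.symm h3.symm h1.symm, swapExp_comm]

theorem gen_left {p : Params ℂ} (hp : p.Regular) {j : Fin n} (hj : j.castSucc = 0) :
    gen n p 0 * gen n p (j + 1) * gen n p 0 * gen n p (j + 1) =
      gen n p (j + 1) * gen n p 0 * gen n p (j + 1) * gen n p 0 := by
  have h1 : j.succ ≠ 0 := Fin.succ_ne_zero j
  rw [gen_zero, gen_succ, hj]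
  simp only [twist_mul]
  refine congrArg₂ twist ?_ ?_
  · simp only [expAut_Rmat, expAut_K1mat hp, expAut_mul, map_div₀, map_inv₀, expAut_swapExp_zvar,
      Equiv.swap_apply_left, Equiv.swap_apply_right, expAut_invExp_zvar_self,
      expAut_invExp_zvar_of_ne h1, div_inv_eq_mul]
    have e1 : ((zvar j.succ)⁻¹ * (zvar 0)⁻¹)⁻¹ = zvar 0 * zvar j.succ := by
      rw [mul_inv, inv_inv, inv_inv, mul_comm]
    have e2 : (zvar 0)⁻¹ / (zvar j.succ)⁻¹ = zvar j.succ / zvar 0 := inv_div_inv ..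
    have e3 : (zvar 0)⁻¹ * zvar j.succ = zvar j.succ / zvar 0 := by
      rw [div_eq_mul_inv, mul_comm]
    -- The generator `T 0` carries `K_1` at an inverse variable, so the reflection equation is used
    -- at the inverse parameters.
    have := left_reflection (hp.const (n + 1)) hj (u := (zvar j.succ)⁻¹) (v := (zvar 0)⁻¹)
      (inv_ne_zero (zvar_ne_zero _)) (inv_ne_zero (zvar_ne_zero _))
      (by rw [e1]; exact bulk_mul_ne p h1.symm) (by rw [e2]; exact bulk_div_ne p h1)
      (zvar_inv_sub_const_ne _ _) (zvar_inv_sub_const_ne _ _)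
      (zvar_inv_sub_const_ne _ _) (zvar_inv_sub_const_ne _ _)
    rw [e1, e2] at this
    rw [mul_comm (zvar j.succ), e3]
    exact this
  · have e := swapExp_mul_invExp 0 j.succ 0
    rw [Equiv.swap_apply_left] at e
    have c := invExp_commute 0 j.succ
    rw [mul_assoc (invExp 0), e, mul_assoc (invExp 0), mul_assoc (invExp j.succ),
      swapExp_mul_self, mul_one, c.eq]

theorem gen_right {p : Params ℂ} (hp : p.Regular) {j : Fin n} (hj : j.succ = Fin.last n) :
    gen n p (n + 1) * gen n p (j + 1) * gen n p (n + 1) * gen n p (j + 1) =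
      gen n p (j + 1) * gen n p (n + 1) * gen n p (j + 1) * gen n p (n + 1) := by
  have h1 : j.castSucc ≠ Fin.last n := (Fin.castSucc_lt_last j).ne
  rw [gen_last, gen_succ, hj]
  simp only [twist_mul]
  refine congrArg₂ twist ?_ ?_
  · simp only [expAut_Rmat, expAut_KNmat hp, expAut_mul, map_div₀, map_inv₀, expAut_swapExp_zvar,
      Equiv.swap_apply_left, Equiv.swap_apply_right, expAut_invExp_zvar_self,
      expAut_invExp_zvar_of_ne h1, div_inv_eq_mul]
    have e1 : (zvar (Fin.last n))⁻¹ / zvar j.castSucc =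
        (zvar j.castSucc)⁻¹ * (zvar (Fin.last n))⁻¹ := by
      rw [div_eq_mul_inv, mul_comm]
    have e2 : (zvar j.castSucc)⁻¹ / (zvar (Fin.last n))⁻¹ =
        zvar (Fin.last n) / zvar j.castSucc := inv_div_inv ..
    have e3 : (zvar j.castSucc)⁻¹ * zvar (Fin.last n) =
        zvar (Fin.last n) / zvar j.castSucc := by
      rw [div_eq_mul_inv, mul_comm]
    have e4 : (zvar j.castSucc)⁻¹ / zvar (Fin.last n) =
        (zvar j.castSucc)⁻¹ * (zvar (Fin.last n))⁻¹ := div_eq_mul_inv _ _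
    have := right_reflection (hp.const (n + 1)) hj (u := (zvar j.castSucc)⁻¹)
      (v := (zvar (Fin.last n))⁻¹) (inv_ne_zero (zvar_ne_zero _))
      (bulk_inv_mul_inv_ne p h1)
      (by rw [e2]; exact bulk_div_ne p h1.symm)
      (const_mul_zvar_inv_sub_one_ne _ _) (const_mul_zvar_inv_sub_one_ne _ _)
      (const_mul_zvar_inv_sub_one_ne _ _) (const_mul_zvar_inv_sub_one_ne _ _)
    rw [e2] at this
    rw [e1, e3, e4]
    exact this
  · have e := swapExp_mul_invExp j.castSucc (Fin.last n) (Fin.last n)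
    rw [Equiv.swap_apply_right] at e
    have c := invExp_commute (Fin.last n) j.castSucc
    rw [mul_assoc (invExp (Fin.last n)), e, mul_assoc (invExp (Fin.last n)),
      mul_assoc (invExp j.castSucc),
      swapExp_mul_self, mul_one, c.eq]

theorem affineRelations_gen {p : Params ℂ} (hp : p.Regular) : AffineRelations n (gen n p) where
  sq _ hj := gen_mul_self hp hj
  comm _ _ hjk hk := gen_commute hp hjk hk
  braid j hj hjn := by
    obtain ⟨j, rfl⟩ : ∃ j', j = j' + 1 := ⟨j - 1, by omega⟩
    exact gen_braid hp (j := ⟨j, by omega⟩) (k := ⟨j + 1, by omega⟩) rfl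
  left hn := gen_left hp (j := ⟨0, hn⟩) rfl
  right hn := by
    obtain ⟨n, rfl⟩ : ∃ n', n = n' + 1 := ⟨n - 1, by omega⟩
    exact gen_right hp (j := Fin.last n) rfl

/-- The spectral parameters, indexed by the natural numbers `1, …, n + 1`. -/
def zvarNat (n i : ℕ) : RatField (n + 1) := if h : i - 1 < n + 1 then zvar ⟨i - 1, h⟩ else 0

theorem zvarNat_eq {i : ℕ} (h : i - 1 < n + 1) : zvarNat n i = zvar ⟨i - 1, h⟩ := dif_pos h

/-- Generators are indexed from `0` and sites from zero, so variable `i` in the abstract action is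
the parameter of site `i - 1`. By truncated subtraction the values of `zvarNat` at `0` and `1`
coincide; only indices between `1` and `n + 1` are used. -/
theorem semilinearAction_gen (p : Params ℂ) :
    SemilinearAction n (gen n p) (Config (n + 1) → RatField (n + 1))
      (fun k => expAut (genAut n k)) (zvarNat n) where
  smul_smul _ _ _ c v := twist_smul_smul _ _ c v
  swap k hk hkn i hi hin := by
    obtain ⟨k, rfl⟩ : ∃ k', k = k' + 1 := ⟨k - 1, by omega⟩
    have hk' : k < n := by omega
    have hi' : Equiv.swap (k + 1) (k + 1 + 1) i - 1 < n + 1 := by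
      rw [Equiv.swap_apply_def]; split_ifs <;> omega
    rw [zvarNat_eq (by omega), zvarNat_eq hi', genAut, dif_pos hk', expAut_swapExp_zvar]
    congr 1
    simp only [Equiv.swap_apply_def, Fin.ext_iff, Fin.val_castSucc, Fin.val_succ]
    split_ifs <;> simp only [Fin.val_castSucc, Fin.val_succ] <;> omega
  last := by
    rw [zvarNat_eq (by omega), genAut, dif_neg (by omega)]
    exact expAut_invExp_zvar_self _
  fixed i hi hin := by
    rw [zvarNat_eq (by omega), genAut, dif_neg (by omega), expAut_invExp_zvar_of_ne]
    simp only [Ne, Fin.ext_iff, Fin.val_last]; omega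
  distinct i i' hi hin hi' hin' := by
    rw [zvarNat_eq (by omega), zvarNat_eq (by omega)]
    refine ⟨fun h => ?_, zvar_ne_inv _ _⟩
    have := congrArg Fin.val (zvar_injective h)
    simp only at this
    omega

end GeneratorRelations

/-! ### Existence of the solution -/

section Sectors

variable {F : Type*} [Field F] {N : ℕ}

/-- The number of second class particles. -/
def zeroCount (w : Config N) : ℕ := (Finset.univ.filter fun i => w i = 0).card

theorem zeroCount_swapSites (i j : Fin N) (w : Config N) :
    zeroCount (swapSites i j w) = zeroCount w := by
  unfold zeroCount
  refine Finset.card_equiv (Equiv.swap i j) fun k => ?_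
  simp only [Finset.mem_filter, Finset.mem_univ, true_and]
  rfl

theorem zeroCount_flipSite (i : Fin N) (w : Config N) :
    zeroCount (flipSite i w) = zeroCount w := by
  unfold zeroCount
  congr 1
  ext k
  simp only [Finset.mem_filter, Finset.mem_univ, true_and, flipSite_apply]
  split_ifs
  · exact SignType.neg_eq_zero_iff
  · rfl

/-- The matrices that preserve the sectors and whose columns sum to one. -/
def stochastic (F : Type*) [Field F] (N : ℕ) : Submonoid (Matrix (Config N) (Config N) F) where
  carrier := {A | 1 ᵥ* A = 1 ∧ ∀ w v, zeroCount w ≠ zeroCount v → A w v = 0}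
  one_mem' := ⟨Matrix.vecMul_one _, fun w v h => Matrix.one_apply_ne fun h' => h (h' ▸ rfl)⟩
  mul_mem' := by
    rintro A B ⟨hA, hA'⟩ ⟨hB, hB'⟩
    refine ⟨by rw [← Matrix.vecMul_vecMul, hA, hB], fun w v h => ?_⟩
    rw [Matrix.mul_apply]
    refine Finset.sum_eq_zero fun u _ => ?_
    by_cases hu : zeroCount w = zeroCount u
    · rw [hB' u v (hu ▸ h), mul_zero]
    · rw [hA' w u hu, zero_mul]

theorem one_add_smul_hop_mem_stochastic (c : F) (g : Config N → F) {π : Equiv.Perm (Config N)}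
    (hπ : ∀ w, π (π w) = w) (hz : ∀ w, zeroCount (π w) = zeroCount w) :
    1 + c • hop g π ∈ stochastic F N := by
  refine ⟨?_, fun w v h => ?_⟩
  · rw [Matrix.vecMul_add, Matrix.vecMul_smul, one_vecMul_hop g π hπ, smul_zero, add_zero,
      Matrix.vecMul_one]
  · have h1 : w ≠ v := fun h' => h (h' ▸ rfl)
    have h2 : v ≠ π w := fun h' => h (h' ▸ (hz w).symm)
    simp [hop, h1, h1.symm, h2]

theorem Rmat_mem_stochastic {n : ℕ} (p : Params F) (j : Fin n) (x : F) :
    Rmat p j x ∈ stochastic F (n + 1) := by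
  rw [Rmat_eq]
  exact one_add_smul_hop_mem_stochastic _ _ (swapSites_swapSites _ _) (zeroCount_swapSites _ _)

theorem K1mat_mem_stochastic {n : ℕ} (p : Params F) (x : F) :
    K1mat p x ∈ stochastic F (n + 1) := by
  rw [K1mat, atSite_boundaryLocal]
  exact one_add_smul_hop_mem_stochastic _ _ (flipSite_flipSite _) (zeroCount_flipSite _)

theorem KNmat_mem_stochastic {n : ℕ} (p : Params F) (x : F) :
    KNmat p x ∈ stochastic F (n + 1) := by
  rw [KNmat, atSite_boundaryLocal]
  exact one_add_smul_hop_mem_stochastic _ _ (flipSite_flipSite _) (zeroCount_flipSite _)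

theorem list_Rmat_mem_stochastic {n : ℕ} (p : Params F) (l : List (Fin n)) (x : Fin n → F) :
    (l.map fun j => Rmat p j (x j)).prod ∈ stochastic F (n + 1) := by
  refine Submonoid.list_prod_mem _ fun A hA => ?_
  obtain ⟨j, -, rfl⟩ := List.mem_map.mp hA
  exact Rmat_mem_stochastic _ _ _

/-- Supplies the stable subspace `sector` and the fixed functional `total` to which
`exists_common_fixed` is applied. -/
theorem scattering_mem_stochastic {n : ℕ} (p : Params F) (z : Fin (n + 1) → F) (i : Fin (n + 1)) :
    scattering p z i ∈ stochastic F (n + 1) := by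
  unfold scattering
  refine mul_mem (mul_mem (mul_mem (mul_mem (mul_mem ?_ (K1mat_mem_stochastic _ _)) ?_) ?_)
    (KNmat_mem_stochastic _ _)) ?_ <;> exact list_Rmat_mem_stochastic _ _ _

theorem InSector.mulVec {m : ℕ} {A : Matrix (Config N) (Config N) F} (hA : A ∈ stochastic F N)
    {ψ : Config N → F} (hψ : InSector m ψ) : InSector m (A *ᵥ ψ) := by
  intro w hw
  refine Finset.sum_eq_zero fun v _ => ?_
  by_cases h : zeroCount w = zeroCount v
  · rw [hψ v (fun h' => hw (h.trans h')), mul_zero]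
  · exact mul_eq_zero_of_left (hA.2 w v h) _

/-- The vectors of a sector. -/
def sector (F : Type*) [Field F] (N m : ℕ) : Submodule F (Config N → F) where
  carrier := {ψ | InSector m ψ}
  zero_mem' := fun _ _ => rfl
  add_mem' := fun hψ hχ w hw => by rw [Pi.add_apply, hψ w hw, hχ w hw, add_zero]
  smul_mem' := fun c ψ hψ w hw => by rw [Pi.smul_apply, hψ w hw, smul_zero]

/-- The sum of the entries of a vector. -/
def total (F : Type*) [Field F] (N : ℕ) : (Config N → F) →ₗ[F] F where
  toFun ψ := 1 ⬝ᵥ ψ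
  map_add' := dotProduct_add _
  map_smul' c ψ := by simp

theorem total_mulVec {A : Matrix (Config N) (Config N) F} (hA : A ∈ stochastic F N)
    (ψ : Config N → F) : total F N (A *ᵥ ψ) = total F N ψ := by
  change 1 ⬝ᵥ (A *ᵥ ψ) = 1 ⬝ᵥ ψ
  rw [Matrix.dotProduct_mulVec, hA.1]

theorem exists_zeroCount {m : ℕ} (hm : m ≤ N) : ∃ w : Config N, zeroCount w = m := by
  obtain ⟨s, -, hs⟩ := Finset.exists_subset_card_eq (s := (Finset.univ : Finset (Fin N)))
    (n := m) (by simpa using hm)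
  refine ⟨fun i => if i ∈ s then 0 else 1, ?_⟩
  rw [← hs, zeroCount]
  congr 1
  ext i
  simp

theorem exists_total_ne_zero {m : ℕ} (hm : m ≤ N) : ∃ ψ ∈ sector F N m, total F N ψ ≠ 0 := by
  obtain ⟨w, hw⟩ := exists_zeroCount hm
  refine ⟨Pi.single w 1, fun v hv => ?_, ?_⟩
  · have : v ≠ w := fun h => hv (h ▸ hw)
    simp [this]
  · change 1 ⬝ᵥ Pi.single w 1 ≠ (0 : F)
    simp

end Sectors

/-! ### Fixed vectors of the affine Weyl group and clearing of denominators -/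

section Existence

variable {n : ℕ}

theorem genMat_mem_stochastic (p : Params ℂ) (k : ℕ) :
    genMat n p k ∈ stochastic (RatField (n + 1)) (n + 1) := by
  rcases k with _ | k
  · exact K1mat_mem_stochastic _ _
  · rw [genMat]
    split_ifs
    · exact Rmat_mem_stochastic _ _ _
    · exact KNmat_mem_stochastic _ _

theorem translation_gen_smul {p : Params ℂ} (hp : p.Regular) (i : Fin (n + 1))
    (ψ : Config (n + 1) → RatField (n + 1)) :
    translation n (gen n p) i • ψ = scattering (p.const (n + 1)) zvar i *ᵥ ψ := by
  rw [translation_gen hp, twist_smul]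
  simp only [expAut_one]

/-- The vectors of a sector that are invariant under all scattering matrices. -/
def invariants (n m : ℕ) (p : Params ℂ) :
    Submodule (RatField (n + 1)) (Config (n + 1) → RatField (n + 1)) where
  carrier := {ψ | InSector m ψ ∧ IsScatteringInvariant p ψ}
  zero_mem' := ⟨(sector _ _ m).zero_mem, fun _ => Matrix.mulVec_zero _⟩
  add_mem' := fun h h' => ⟨(sector _ _ m).add_mem h.1 h'.1, fun i => by
    rw [Matrix.mulVec_add, h.2 i, h'.2 i]⟩
  smul_mem' := fun c _ h => ⟨(sector _ _ m).smul_mem c h.1, fun i => by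
    rw [Matrix.mulVec_smul, h.2 i]⟩

/-- The scattering matrices commute because they are translations of the affine Weyl group; the rest
is `exists_common_fixed` with the sum of the entries as functional. -/
theorem exists_invariant {m : ℕ} (hm : m ≤ n + 1) {p : Params ℂ} (hp : p.Regular) :
    ∃ u ∈ invariants n m p, u ≠ 0 := by
  have h := affineRelations_gen (n := n) hp
  obtain ⟨u, hu, hu0, huS⟩ := exists_common_fixed
    (fun i : Fin (n + 1) => Matrix.mulVecLin (scattering (p.const (n + 1)) zvar i))
    (fun i j => LinearMap.ext fun ψ => by
      change scattering _ _ i *ᵥ (scattering _ _ j *ᵥ ψ) =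
        scattering _ _ j *ᵥ (scattering _ _ i *ᵥ ψ)
      simp only [← translation_gen_smul hp, smul_smul]
      rcases lt_trichotomy (i : ℕ) j with hij | hij | hij
      · rw [(h.commute_translation_translation hij (by omega)).eq]
      · rw [hij]
      · rw [(h.commute_translation_translation hij (by omega)).eq])
    (sector _ (n + 1) m) (fun i v hv => InSector.mulVec (scattering_mem_stochastic _ _ i) hv)
    (total _ (n + 1)) (fun i v => total_mulVec (scattering_mem_stochastic _ _ i) v)
    (exists_total_ne_zero hm)
  exact ⟨u, ⟨hu, huS⟩, hu0⟩

theorem gen_smul_mem_invariants {m : ℕ} {p : Params ℂ} (hp : p.Regular) {k : ℕ} (hk : k ≤ n + 1)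
    {u : Config (n + 1) → RatField (n + 1)} (hu : u ∈ invariants n m p) :
    gen n p k • u ∈ invariants n m p := by
  refine ⟨?_, fun i => ?_⟩
  · refine InSector.mulVec (genMat_mem_stochastic p k) fun w hw => ?_
    rw [hu.1 w hw, map_zero]
  · rw [← translation_gen_smul hp]
    refine (affineRelations_gen hp).translation_smul_smul (fun i hi => ?_) hk (by omega)
    have := hu.2 ⟨i, by omega⟩
    rwa [← translation_gen_smul hp] at this

theorem exists_gen_fixed {m : ℕ} (hm : m ≤ n + 1) {p : Params ℂ} (hp : p.Regular) :
    ∃ u : Config (n + 1) → RatField (n + 1), InSector m u ∧ u ≠ 0 ∧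
      ∀ k ≤ n + 1, gen n p k • u = u := by
  have h := affineRelations_gen (n := n) hp
  obtain ⟨v, hv, hv0⟩ := exists_invariant hm hp
  obtain ⟨u, hu, hu0, huT⟩ := h.exists_fixed (semilinearAction_gen p) (invariants n m p)
    (fun k _ hk u hu => gen_smul_mem_invariants hp hk hu) hv hv0
  refine ⟨u, hu.1, hu0, fun k hk => ?_⟩
  rcases Nat.eq_zero_or_pos k with rfl | hk0
  -- The descent only provides invariance under `T 1, …, T (n + 1)`. The first translation is `T 0`
  -- times a word in these, and it fixes `u`, so `T 0` does too.
  · have h1 := hu.2 0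
    rw [← translation_gen_smul hp] at h1
    have h2 : translation n (gen n p) (0 : Fin (n + 1)) =
      gen n p 0 * rightRefl n (gen n p) 1 := rfl
    rwa [h2, mul_smul, rightRefl_smul_eq_self huT 1 (by omega) le_rfl] at h1
  · exact huT k hk0 hk

/-- The signed permutation of the variables. -/
def signedExp {N : ℕ} (x : (Fin N → ℤˣ) × Equiv.Perm (Fin N)) : LatticeAut N where
  toFun e k := x.1 k * e (x.2 k)
  invFun e k := x.1 (x.2.symm k) * e (x.2.symm k)
  left_inv e := by funext k; simp [← mul_assoc, ← Units.val_mul]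
  right_inv e := by funext k; simp [← mul_assoc, ← Units.val_mul]
  map_add' e f := by funext k; simp [mul_add]
  map_smul' c e := by funext k; simp [mul_left_comm]

theorem signedExp_one {N : ℕ} : signedExp (1 : (Fin N → ℤˣ) × Equiv.Perm (Fin N)) = 1 :=
  latticeAut_ext fun e k => by simp [signedExp]

/-- Left multiplication by a generator permutes the family of signed permutations. This is all that
the invariance of a product over the family requires. -/
theorem genAut_mul_signedExp (k : ℕ) :
    ∃ π : Equiv.Perm ((Fin (n + 1) → ℤˣ) × Equiv.Perm (Fin (n + 1))),
      ∀ x, genAut n k * signedExp x = signedExp (π x) := by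
  have hinv : ∀ i : Fin (n + 1), ∃ π : Equiv.Perm ((Fin (n + 1) → ℤˣ) × Equiv.Perm (Fin (n + 1))),
      ∀ x, invExp i * signedExp x = signedExp (π x) := fun i =>
    ⟨Equiv.prodCongrLeft fun _ => Equiv.mulLeft (Function.update 1 i (-1)), fun x =>
      latticeAut_ext fun e l => by
        by_cases h : l = i
        · subst h; simp [signedExp, invExp_apply]
        · simp [signedExp, invExp_apply, h]⟩
  rcases k with _ | k
  · exact hinv 0
  · rw [genAut]
    split_ifs with h
    · refine ⟨Equiv.prodCongr (Equiv.arrowCongr (Equiv.swap (Fin.castSucc ⟨k, h⟩)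
        (Fin.succ ⟨k, h⟩)) (Equiv.refl _)) (Equiv.mulRight (Equiv.swap (Fin.castSucc ⟨k, h⟩)
        (Fin.succ ⟨k, h⟩))), fun x => latticeAut_ext fun e l => ?_⟩
      simp [signedExp, swapExp_apply]
    · exact hinv _

/-- The norm of `d`: the product of its images under all signed permutations of the variables, which
contains `d` itself as the factor of the identity. -/
theorem exists_invariant_multiple (d : Laurent (n + 1)) (hd : d ≠ 0) :
    ∃ D : Laurent (n + 1), D ≠ 0 ∧ d ∣ D ∧ ∀ k, expAut (genAut n k) (algebraMap _ _ D) =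
      algebraMap (Laurent (n + 1)) (RatField (n + 1)) D := by
  classical
  refine ⟨∏ x, AddMonoidAlgebra.domCongr ℂ ℂ (signedExp x).toAddEquiv d, ?_, ?_, fun k => ?_⟩
  · exact Finset.prod_ne_zero_iff.mpr fun x _ => (map_ne_zero_iff _ (AlgEquiv.injective _)).mpr hd
  · have h1 : AddMonoidAlgebra.domCongr ℂ ℂ (signedExp (1 : (Fin (n + 1) → ℤˣ) ×
        Equiv.Perm (Fin (n + 1)))).toAddEquiv d = d := by
      refine IsFractionRing.injective (Laurent (n + 1)) (RatField (n + 1)) ?_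
      rw [← expAut_algebraMap, signedExp_one, expAut_one]
    conv_lhs => rw [← h1]
    exact Finset.dvd_prod_of_mem _ (Finset.mem_univ _)
  · obtain ⟨π, hπ⟩ := genAut_mul_signedExp (n := n) k
    simp only [map_prod, ← expAut_algebraMap, ← expAut_mul, hπ]
    exact Equiv.prod_comp π fun x => expAut (signedExp x) (algebraMap _ _ d)

/-- The generators act semilinearly, so multiplying a fixed vector by an invariant scalar keeps it
fixed; the scalar is the norm of a common denominator. -/
theorem exists_laurent_fixed {m : ℕ} (hm : m ≤ n + 1) {p : Params ℂ} (hp : p.Regular) :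
    ∃ Ψ : Config (n + 1) → Laurent (n + 1), Ψ ≠ 0 ∧ InSector m Ψ ∧
      ∀ k ≤ n + 1, gen n p k • toRat Ψ = toRat Ψ := by
  obtain ⟨u, hum, hu0, hu⟩ := exists_gen_fixed hm hp
  obtain ⟨d, hd⟩ := IsLocalization.exist_integer_multiples_of_finite
    (nonZeroDivisors (Laurent (n + 1))) u
  obtain ⟨D, hD0, ⟨c, hc⟩, hD⟩ := exists_invariant_multiple (d : Laurent (n + 1))
    (nonZeroDivisors.ne_zero d.2)
  choose Ψ hΨ using hd
  have hinj := IsFractionRing.injective (Laurent (n + 1)) (RatField (n + 1))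
  have hΨ' : toRat (fun w => c * Ψ w) = algebraMap _ (RatField (n + 1)) D • u := by
    funext w
    rw [toRat, map_mul, hΨ, Pi.smul_apply, hc, map_mul, Algebra.smul_def, smul_eq_mul]
    ring
  have hD0' : algebraMap _ (RatField (n + 1)) D ≠ 0 := by
    rw [Ne, ← map_zero (algebraMap (Laurent (n + 1)) (RatField (n + 1)))]
    exact fun h => hD0 (hinj h)
  refine ⟨fun w => c * Ψ w, fun h0 => ?_, fun w hw => ?_, fun k hk => ?_⟩
  · have : toRat (fun w => c * Ψ w) = 0 := by
      rw [h0]; funext w; exact map_zero _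
    rw [hΨ', smul_eq_zero] at this
    exact this.elim hD0' hu0
  · refine hinj ?_
    have := congrFun hΨ' w
    rw [Pi.smul_apply, hum w hw, smul_zero] at this
    rw [map_zero]
    exact this
  · rw [hΨ', gen, twist_smul_smul, hD]
    congr 1
    exact hu k hk

theorem isScatteringInvariant_of_gen_fixed {p : Params ℂ} (hp : p.Regular)
    {u : Config (n + 1) → RatField (n + 1)} (hu : ∀ k ≤ n + 1, gen n p k • u = u) :
    IsScatteringInvariant p u := fun i => by
  rw [← translation_gen_smul hp, translation, mul_smul,
    rightRefl_smul_eq_self (fun k _ hk => hu k hk) _ (by omega) (by omega),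
    leftRefl_smul_eq_self hu _ (by omega)]

/-- Being fixed means `B g(u) = u`. By unitarity the matrix in the exchange equation is the inverse
of the one in the generator, and it isolates `g(u)`. -/
theorem mulVec_eq_of_twist_fixed {N : ℕ} {A B : Matrix (Config N) (Config N) (RatField N)}
    {g : LatticeAut N} {u : Config N → RatField N} (hu : twist B g • u = u) (hAB : A * B = 1) :
    A *ᵥ u = fun w => expAut g (u w) := by
  conv_lhs => rw [← hu]
  rw [twist_smul, Matrix.mulVec_mulVec, hAB, Matrix.one_mulVec]

theorem exchangeReflection_of_gen_fixed {p : Params ℂ} (hp : p.Regular)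
    {Ψ : Config (n + 1) → Laurent (n + 1)} (hu : ∀ k ≤ n + 1, gen n p k • toRat Ψ = toRat Ψ) :
    ExchangeReflection p Ψ where
  bulk j := by
    have h := hu (j + 1) (by omega)
    rw [gen_succ] at h
    rw [mulVec_eq_of_twist_fixed h (Rmat_zvar_mul hp j bond_ne)]
    funext w
    exact (algebraMap_swapVar _ _ _).symm
  left := by
    have h := hu 0 (by omega)
    rw [gen_zero] at h
    rw [mulVec_eq_of_twist_fixed h (K1mat_zvar_mul hp)]
    funext w
    exact (algebraMap_invVar _ _).symm
  right := by
    have h := hu (n + 1) le_rfl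
    rw [gen_last] at h
    rw [mulVec_eq_of_twist_fixed h (KNmat_zvar_mul hp _)]
    funext w
    exact (algebraMap_invVar _ _).symm

end Existence

/-! ### The Markov generator on a sector -/

section MaximumPrinciple

/-- The maximum principle, with `a w v` the rate from `v` to `w`. Evaluating `hf` at a maximum of
`f` on `C` gives `k ≤ 0`, at a minimum `k ≥ 0`. With `k = 0` every transition of positive rate from
a maximum leads to another maximum, and `hconn`, which expresses irreducibility, spreads the maximal
value over `C`. Diagonal entries of `a` are multiplied by zero and are unrestricted. -/
theorem eq_const_of_generator {X : Type*} [Fintype X] (a : X → X → ℝ) (C : Finset X)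
    (ha : ∀ w v, w ≠ v → 0 ≤ a w v) (hC : ∀ v ∈ C, ∀ w, w ∉ C → a w v = 0)
    (hconn : ∀ P : X → Prop, (∀ v ∈ C, ∀ w, P v → w ≠ v → 0 < a w v → P w) →
      ∀ v ∈ C, ∀ w ∈ C, P v → P w)
    (hne : C.Nonempty) (f : X → ℝ) (k : ℝ) (hf : ∀ v ∈ C, ∑ w, (f w - f v) * a w v = k) :
    k = 0 ∧ ∃ r, ∀ v ∈ C, f v = r := by
  have key : ∀ (g : X → ℝ) (v : X), v ∈ C → (∀ w ∈ C, g w ≤ g v) →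
      ∀ w, (g w - g v) * a w v ≤ 0 := fun g v hv hmax w => by
    by_cases hw : w ∈ C
    · rcases eq_or_ne w v with rfl | h
      · simp
      · exact mul_nonpos_of_nonpos_of_nonneg (sub_nonpos.mpr (hmax w hw)) (ha w v h)
    · rw [hC v hv w hw, mul_zero]
  obtain ⟨v₀, hv₀, hmax⟩ := C.exists_max_image f hne
  obtain ⟨v₁, hv₁, hmin⟩ := C.exists_max_image (fun v => -f v) hne
  have h0 : k ≤ 0 := by
    rw [← hf v₀ hv₀]
    exact Finset.sum_nonpos fun w _ => key f v₀ hv₀ hmax w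
  have h1 : 0 ≤ k := by
    rw [← hf v₁ hv₁, ← neg_nonpos, ← Finset.sum_neg_distrib]
    refine Finset.sum_nonpos fun w _ => ?_
    have := key (fun v => -f v) v₁ hv₁ hmin w
    linarith
  have hk := le_antisymm h0 h1
  refine ⟨hk, f v₀, fun w hw => hconn (fun v => f v = f v₀) ?_ v₀ hv₀ w hw rfl⟩
  intro v hv w hfv _ hpos
  have hle := key f v hv (fun u hu => (hmax u hu).trans hfv.ge)
  have hz := (Finset.sum_eq_zero_iff_of_nonpos fun w _ => hle w).mp ((hf v hv).trans hk) w
    (Finset.mem_univ w)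
  have := (mul_eq_zero.mp hz).resolve_right hpos.ne'
  linarith

end MaximumPrinciple

/-! ### Irreducibility of the sectors -/

section Connectivity

variable {n : ℕ}

theorem exists_perm_zeros {N : ℕ} {v w : Config N} (h : zeroCount v = zeroCount w) :
    ∃ σ : Equiv.Perm (Fin N), ∀ k, v (σ k) = 0 ↔ w k = 0 := by
  have hc : Fintype.card {k // w k = 0} = Fintype.card {k // v k = 0} := by
    rw [Fintype.card_subtype, Fintype.card_subtype]
    exact h.symm
  let e := Fintype.equivOfCardEq hc
  exact ⟨e.extendSubtype, fun k => ⟨fun hk => by_contra fun hw =>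
    e.extendSubtype_not_mem k hw hk, fun hk => e.extendSubtype_mem k hk⟩⟩

/-- Neighbouring exchanges generate all permutations, and conjugating the flip at the first site by
them gives the flip at every site. A permutation aligns the second class particles, and flips then
correct the remaining sites. -/
theorem sector_connected {P : Config (n + 1) → Prop}
    (hswap : ∀ (j : Fin n) (w), P w → P (swapSites j.castSucc j.succ w))
    (hflip : ∀ w, P w → P (flipSite 0 w)) {v w : Config (n + 1)}
    (h : zeroCount v = zeroCount w) (hv : P v) : P w := by
  have hperm : ∀ (σ : Equiv.Perm (Fin (n + 1))) (u : Config (n + 1)), P u → P (u ∘ σ) := by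
    intro σ
    have hσ : σ ∈ Submonoid.closure
        (Set.range fun i : Fin n => Equiv.swap i.castSucc i.succ) := by
      rw [Equiv.Perm.mclosure_swap_castSucc_succ]; trivial
    induction hσ using Submonoid.closure_induction with
    | mem σ hσ =>
      obtain ⟨j, rfl⟩ := hσ
      exact hswap j
    | one => exact fun u hu => hu
    | mul σ ρ _ _ ihσ ihρ => exact fun u hu => ihρ _ (ihσ u hu)
  have hflip' : ∀ (i : Fin (n + 1)) (u), P u → P (flipSite i u) := fun i u hu => by
    have := hperm (Equiv.swap 0 i) _ (hflip _ (hperm (Equiv.swap 0 i) u hu))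
    convert this using 1
    funext k
    have hk : Equiv.swap 0 i k = 0 ↔ k = i := by
      rw [Equiv.swap_apply_eq_iff, Equiv.swap_apply_left]
    simp only [Function.comp_apply, flipSite_apply, hk, Equiv.swap_apply_self]
  have hflips : ∀ (s : Finset (Fin (n + 1))) (u), P u →
      P (fun k => if k ∈ s then -u k else u k) := by
    intro s
    induction s using Finset.induction_on with
    | empty => exact fun u hu => by simpa using hu
    | insert i s hi ih =>
      intro u hu
      convert hflip' i _ (ih u hu) using 1
      funext k
      rw [flipSite_apply]
      by_cases hk : k = i
      · subst hk; simp [hi]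
      · simp [hk]
  obtain ⟨σ, hσ⟩ := exists_perm_zeros h
  -- After alignment of the zeros, two differing entries are both nonzero and hence opposite.
  convert hflips (Finset.univ.filter fun k => v (σ k) ≠ w k) _ (hperm σ v hv) using 1
  funext k
  have hk := hσ k
  simp only [Finset.mem_filter, Finset.mem_univ, true_and, Function.comp_apply]
  generalize v (σ k) = x at *
  generalize w k = y at *
  revert hk
  cases x <;> cases y <;> simp

end Connectivity

/-! ### Positivity of the Markov generator and its left null vectors -/

section Generator

variable {n : ℕ}

/-- The generator of the two-species exclusion process with open boundaries. -/
def generator {F : Type*} [Field F] (n : ℕ) (p : Params F) :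
    Matrix (Config (n + 1)) (Config (n + 1)) F :=
  siteHop p.γ p.α 0 + ∑ j : Fin n, bondHop p.τ j.castSucc j.succ +
    siteHop p.β p.δ (Fin.last n)

theorem one_vecMul_generator {F : Type*} [Field F] (p : Params F) :
    (1 : Config (n + 1) → F) ᵥ* generator n p = 0 := by
  have h1 := one_vecMul_hop (fun w : Config (n + 1) => boundaryRate p.γ p.α (w 0)) _
    (flipSite_flipSite 0)
  have h2 := one_vecMul_hop (fun w : Config (n + 1) => boundaryRate p.β p.δ (w (Fin.last n))) _
    (flipSite_flipSite (Fin.last n))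
  have h3 : ∀ j : Fin n, (1 : Config (n + 1) → F) ᵥ* bondHop p.τ j.castSucc j.succ = 0 :=
    fun j => one_vecMul_hop _ _ (swapSites_swapSites _ _)
  rw [generator, Matrix.vecMul_add, Matrix.vecMul_add, siteHop, siteHop, h1, h2,
    Matrix.vecMul_sum]
  simp [h3]

open scoped ComplexOrder

theorem hop_apply_of_ne {F X : Type*} [Field F] [Fintype X] [DecidableEq X] (g : X → F)
    (π : Equiv.Perm X) {w v : X} (h : w ≠ v) : hop g π w v = if v = π w then g w else 0 := by
  simp [hop, h.symm]

theorem bulkRate_pos {τ : ℂ} (hτ : 0 < τ) (x y : SignType) : 0 < bulkRate τ x y :=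
  zpow_pos hτ _

theorem boundaryRate_nonneg {ρ σ : ℂ} (hρ : 0 < ρ) (hσ : 0 < σ) (x : SignType) :
    0 ≤ boundaryRate ρ σ x := by
  unfold boundaryRate
  split_ifs
  exacts [hσ.le, hρ.le, le_rfl]

theorem hop_nonneg {X : Type*} [Fintype X] [DecidableEq X] {g : X → ℂ} (hg : ∀ w, 0 ≤ g w)
    (π : Equiv.Perm X) {w v : X} (h : w ≠ v) : 0 ≤ hop g π w v := by
  rw [hop_apply_of_ne g π h]
  split_ifs
  exacts [hg w, le_rfl]

theorem generator_eq_zero (p : Params ℂ) {w v : Config (n + 1)} (h : zeroCount w ≠ zeroCount v) :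
    generator n p w v = 0 := by
  have hne : w ≠ v := fun h' => h (h' ▸ rfl)
  have h1 : ∀ i, v ≠ flipSite i w := fun i h' => h (h' ▸ (zeroCount_flipSite i w).symm)
  have h2 : ∀ i j, v ≠ swapSites i j w := fun i j h' => h (h' ▸ (zeroCount_swapSites i j w).symm)
  simp [generator, siteHop, bondHop, hop_apply_of_ne _ _ hne, Matrix.sum_apply, h1, h2]

variable {p : Params ℂ}

theorem generator_nonneg (hp : p.PositiveRates) {w v : Config (n + 1)} (h : w ≠ v) :
    0 ≤ generator n p w v := by
  obtain ⟨hτ, hα, hβ, hγ, hδ⟩ := hp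
  simp only [generator, Matrix.add_apply, Matrix.sum_apply]
  exact add_nonneg (add_nonneg (hop_nonneg (fun _ => boundaryRate_nonneg hγ hα _) _ h)
    (Finset.sum_nonneg fun j _ => hop_nonneg (fun _ => (bulkRate_pos hτ _ _).le) _ h))
    (hop_nonneg (fun _ => boundaryRate_nonneg hβ hδ _) _ h)

theorem generator_swapSites_pos (hp : p.PositiveRates) (j : Fin n) {v : Config (n + 1)}
    (h : swapSites j.castSucc j.succ v ≠ v) :
    0 < generator n p (swapSites j.castSucc j.succ v) v := by
  obtain ⟨hτ, hα, hβ, hγ, hδ⟩ := hp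
  simp only [generator, Matrix.add_apply, Matrix.sum_apply]
  refine add_pos_of_pos_of_nonneg (add_pos_of_nonneg_of_pos
    (hop_nonneg (fun _ => boundaryRate_nonneg hγ hα _) _ h)
    (Finset.sum_pos' (fun j _ => hop_nonneg (fun _ => (bulkRate_pos hτ _ _).le) _ h)
      ⟨j, Finset.mem_univ _, ?_⟩))
    (hop_nonneg (fun _ => boundaryRate_nonneg hβ hδ _) _ h)
  rw [bondHop, hop_apply_of_ne _ _ h, if_pos (swapSites_swapSites _ _ _).symm]
  exact bulkRate_pos hτ _ _

theorem generator_flipSite_pos (hp : p.PositiveRates) {v : Config (n + 1)}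
    (h : flipSite 0 v ≠ v) : 0 < generator n p (flipSite 0 v) v := by
  obtain ⟨hτ, hα, hβ, hγ, hδ⟩ := hp
  simp only [generator, Matrix.add_apply, Matrix.sum_apply]
  refine add_pos_of_pos_of_nonneg (add_pos_of_pos_of_nonneg ?_
    (Finset.sum_nonneg fun j _ => hop_nonneg (fun _ => (bulkRate_pos hτ _ _).le) _ h))
    (hop_nonneg (fun _ => boundaryRate_nonneg hβ hδ _) _ h)
  rw [siteHop, hop_apply_of_ne _ _ h, if_pos (flipSite_flipSite _ _).symm]
  have h0 : v 0 ≠ 0 := fun h0 => h (funext fun k => by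
    rw [flipSite_apply]
    split_ifs with hk
    · rw [hk, h0]; rfl
    · rfl)
  rw [flipSite_apply, if_pos rfl]
  generalize v 0 = x at h0
  cases x
  · exact absurd rfl h0
  · simpa [boundaryRate] using hα
  · simpa [boundaryRate] using hγ

/-- A left null vector of the generator on a sector, up to a constant, is constant. -/
theorem eq_const_of_vecMul_generator (hp : p.PositiveRates) {m : ℕ} (hm : m ≤ n + 1)
    {y : Config (n + 1) → ℂ} {k : ℂ}
    (hy : ∀ v, zeroCount v = m → (y ᵥ* generator n p) v = k) :
    k = 0 ∧ ∃ r, ∀ v, zeroCount v = m → y v = r := by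
  -- The off-diagonal entries are real, so the maximum principle can be applied separately to the
  -- real and imaginary parts of `y`. Diagonal entries do not matter for the differences `y w - y
  -- v`.
  have him : ∀ w v : Config (n + 1), w ≠ v → (generator n p w v).im = 0 := fun w v h =>
    (Complex.nonneg_iff.mp (generator_nonneg hp h)).2.symm
  -- The columns of the generator sum to zero, so subtracting the constant `y v` changes nothing.
  have hsum : ∀ v, zeroCount v = m → ∑ w, (y w - y v) * generator n p w v = k := by
    intro v hv
    have h1 := congrFun (one_vecMul_generator (n := n) p) v
    have h2 := hy v hv
    simp only [Matrix.vecMul, dotProduct, Pi.one_apply, one_mul, Pi.zero_apply] at h1 h2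
    simp only [sub_mul, Finset.sum_sub_distrib, ← Finset.mul_sum, h1, h2, mul_zero, sub_zero]
  have main : ∀ (f : Config (n + 1) → ℝ) (c : ℝ),
      (∀ v, zeroCount v = m → ∑ w, (f w - f v) * (generator n p w v).re = c) →
      c = 0 ∧ ∃ r, ∀ v, zeroCount v = m → f v = r := by
    intro f c hf
    have := eq_const_of_generator (fun w v => (generator n p w v).re)
      (Finset.univ.filter fun v => zeroCount v = m)
      (fun w v h => (Complex.nonneg_iff.mp (generator_nonneg hp h)).1)
      (fun v hv w hw => by
        simp only [Finset.mem_filter, Finset.mem_univ, true_and] at hv hw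
        rw [generator_eq_zero p fun h => hw (h.trans hv), Complex.zero_re])
      (fun P hP v hv w hw hPv => by
        simp only [Finset.mem_filter, Finset.mem_univ, true_and] at hP hv hw
        refine (sector_connected (P := fun u => zeroCount u = m ∧ P u) ?_ ?_ (hv.trans hw.symm)
          ⟨hv, hPv⟩).2
        · rintro j u ⟨hu, hPu⟩
          refine ⟨(zeroCount_swapSites _ _ _).trans hu, ?_⟩
          by_cases h : swapSites j.castSucc j.succ u = u
          · rwa [h]
          · exact hP u hu _ hPu h (Complex.pos_iff.mp (generator_swapSites_pos hp j h)).1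
        · rintro u ⟨hu, hPu⟩
          refine ⟨(zeroCount_flipSite _ _).trans hu, ?_⟩
          by_cases h : flipSite 0 u = u
          · rwa [h]
          · exact hP u hu _ hPu h (Complex.pos_iff.mp (generator_flipSite_pos hp h)).1)
      (by
        obtain ⟨w, hw⟩ := exists_zeroCount hm
        exact ⟨w, by simpa using hw⟩)
      f c (by simpa using hf)
    simpa using this
  have hre := main (fun v => (y v).re) k.re fun v hv => by
    rw [← hsum v hv, Complex.re_sum]
    refine Finset.sum_congr rfl fun w _ => ?_
    rcases eq_or_ne w v with rfl | h
    · simp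
    · simp [him w v h]
  have him' := main (fun v => (y v).im) k.im fun v hv => by
    rw [← hsum v hv, Complex.im_sum]
    refine Finset.sum_congr rfl fun w _ => ?_
    rcases eq_or_ne w v with rfl | h
    · simp
    · simp [him w v h]
  obtain ⟨h1, r, hr⟩ := hre
  obtain ⟨h2, s, hs⟩ := him'
  exact ⟨Complex.ext h1 h2, ⟨r, s⟩, fun v hv => Complex.ext (hr v hv) (hs v hv)⟩

end Generator

/-! ### Nondegeneracy on vectors of total zero, as a determinant -/

section Augmented

variable {F : Type*} [Field F] {N : ℕ}

/-- The matrix that acts on a sector as `A` plus the matrix with all entries one, and as the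
identity on the rows outside of the sector. -/
def augmented (m : ℕ) (A : Matrix (Config N) (Config N) F) : Matrix (Config N) (Config N) F :=
  Matrix.of fun w v => if zeroCount w = m then A w v + 1 else if w = v then 1 else 0

theorem augmented_mulVec_eq_zero {m : ℕ} {A : Matrix (Config N) (Config N) F} {ψ : Config N → F}
    (hψ : InSector m ψ) (hA : A *ᵥ ψ = 0) (h0 : total F N ψ = 0) : augmented m A *ᵥ ψ = 0 := by
  funext w
  by_cases hw : zeroCount w = m
  · have h1 := congrFun hA w
    change 1 ⬝ᵥ ψ = 0 at h0
    simp only [Matrix.mulVec, dotProduct, Pi.one_apply, one_mul, Pi.zero_apply] at h0 h1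
    simp [augmented, Matrix.mulVec, dotProduct, hw, add_mul, Finset.sum_add_distrib, h0, h1]
  · have : ψ w = 0 := hψ w hw
    simp [augmented, Matrix.mulVec, dotProduct, hw, this]

/-- Let `y` be a left null vector and `s` the sum of its entries over the sector. On the sector `y`
times the generator is the constant `-s`, so `s = 0` and `y` is a constant `r` there. Now `s` is `r`
times the size of the sector, hence `r = 0`, and the columns outside the sector show that `y`
vanishes there too. -/
theorem det_augmented_generator_ne_zero {n m : ℕ} (hm : m ≤ n + 1) {p : Params ℂ}
    (hp : p.PositiveRates) : (augmented m (generator n p)).det ≠ 0 := by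
  intro h
  obtain ⟨y, hy0, hy⟩ := Matrix.exists_vecMul_eq_zero_iff.mpr h
  refine hy0 ?_
  set s := ∑ w, if zeroCount w = m then y w else 0 with hs
  have hcol : ∀ v, (∑ w, (if zeroCount w = m then y w * generator n p w v else 0)) + s +
      (if zeroCount v = m then 0 else y v) = 0 := by
    intro v
    have h1 := congrFun hy v
    rw [Pi.zero_apply] at h1
    refine Eq.trans ?_ h1
    rw [hs]
    have h2 : (if zeroCount v = m then 0 else y v) =
        ∑ w, if w = v then (if zeroCount w = m then 0 else y w) else 0 := by simp
    rw [h2, ← Finset.sum_add_distrib, ← Finset.sum_add_distrib]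
    refine Finset.sum_congr rfl fun w _ => ?_
    by_cases hw : zeroCount w = m <;> simp [augmented, hw, mul_add]
  have hin : ∀ v, zeroCount v = m → (y ᵥ* generator n p) v = -s := by
    intro v hv
    have h1 := hcol v
    rw [if_pos hv, add_zero] at h1
    rw [eq_neg_iff_add_eq_zero, ← h1]
    congr 1
    refine Finset.sum_congr rfl fun w _ => ?_
    split_ifs with hw
    · rfl
    · exact mul_eq_zero_of_right _ (generator_eq_zero p fun h => hw (h.trans hv))
  obtain ⟨hk, r, hr⟩ := eq_const_of_vecMul_generator hp hm hin
  have hs0 : s = 0 := neg_eq_zero.mp hk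
  have hr0 : r = 0 := by
    obtain ⟨w₀, hw₀⟩ := exists_zeroCount hm
    have h1 : s = ∑ w : Config (n + 1), if zeroCount w = m then r else 0 :=
      Finset.sum_congr rfl fun w _ => by
        split_ifs with hw
        · exact hr w hw
        · rfl
    rw [hs0, ← Finset.sum_filter, Finset.sum_const, nsmul_eq_mul] at h1
    refine (mul_eq_zero.mp h1.symm).resolve_left (Nat.cast_ne_zero.mpr ?_)
    exact (Finset.card_pos.mpr ⟨w₀, by simpa using hw₀⟩).ne'
  have hin0 : ∀ v, zeroCount v = m → y v = 0 := fun v hv => (hr v hv).trans hr0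
  funext v
  by_cases hv : zeroCount v = m
  · exact hin0 v hv
  · have h1 := hcol v
    rw [hs0, add_zero, if_neg hv, Finset.sum_eq_zero, zero_add] at h1
    · exact h1
    · intro w _
      split_ifs with hw
      · rw [hin0 w hw, zero_mul]
      · rfl

end Augmented

/-! ### Specialisation of rational functions -/

section Specialisation

variable {R K L : Type*} [CommRing R] [Field K] [Algebra R K] [Field L]

/-- The pairs of a fraction and its value under an extension of the homomorphism `φ`. -/
def specialisation (K : Type*) [Field K] [Algebra R K] (φ : R →+* L) : Subring (K × L) where
  carrier := {x | ∃ a b, φ b ≠ 0 ∧ x.1 * algebraMap R K b = algebraMap R K a ∧ x.2 * φ b = φ a}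
  one_mem' := ⟨1, 1, by simp, by simp, by simp⟩
  zero_mem' := ⟨0, 1, by simp, by simp, by simp⟩
  mul_mem' := by
    rintro x y ⟨a, b, h, h1, h2⟩ ⟨a', b', h', h1', h2'⟩
    refine ⟨a * a', b * b', by simp [h, h'], ?_, ?_⟩
    · simp only [Prod.fst_mul, map_mul, ← h1, ← h1']; ring
    · simp only [Prod.snd_mul, map_mul, ← h2, ← h2']; ring
  add_mem' := by
    rintro x y ⟨a, b, h, h1, h2⟩ ⟨a', b', h', h1', h2'⟩
    refine ⟨a * b' + a' * b, b * b', by simp [h, h'], ?_, ?_⟩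
    · simp only [Prod.fst_add, map_mul, map_add, ← h1, ← h1']; ring
    · simp only [Prod.snd_add, map_mul, map_add, ← h2, ← h2']; ring
  neg_mem' := by
    rintro x ⟨a, b, h, h1, h2⟩
    exact ⟨-a, b, h, by simp [h1], by simp [h2]⟩

theorem algebraMap_mem_specialisation (φ : R →+* L) (a : R) :
    (algebraMap R K a, φ a) ∈ specialisation K φ :=
  ⟨a, 1, by simp, by simp, by simp⟩

/-- A fraction with nonzero value has nonzero numerator. This is what carries nonvanishing from
special parameters back to rational functions. -/
theorem fst_ne_zero_of_mem_specialisation [FaithfulSMul R K] {φ : R →+* L} {x : K × L}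
    (hx : x ∈ specialisation K φ) (h : x.2 ≠ 0) : x.1 ≠ 0 := by
  obtain ⟨a, b, hb, h1, h2⟩ := hx
  intro h0
  rw [h0, zero_mul] at h1
  have ha : a = 0 := FaithfulSMul.algebraMap_injective R K (by rw [← h1, map_zero])
  rw [ha, map_zero] at h2
  exact (mul_ne_zero h hb) h2

theorem inv_mem_specialisation [FaithfulSMul R K] {φ : R →+* L} {f : K} {c : L}
    (hx : (f, c) ∈ specialisation K φ) (h : c ≠ 0) : (f⁻¹, c⁻¹) ∈ specialisation K φ := by
  have hf := fst_ne_zero_of_mem_specialisation hx h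
  obtain ⟨a, b, hb, h1, h2⟩ := hx
  simp only at h1 h2 hf
  refine ⟨b, a, by rw [← h2]; exact mul_ne_zero h hb, ?_, ?_⟩
  · rw [← h1, inv_mul_cancel_left₀ hf]
  · rw [← h2, inv_mul_cancel_left₀ h]

theorem div_mem_specialisation [FaithfulSMul R K] {φ : R →+* L} {f g : K} {c d : L}
    (hx : (f, c) ∈ specialisation K φ) (hy : (g, d) ∈ specialisation K φ) (h : d ≠ 0) :
    (f / g, c / d) ∈ specialisation K φ := by
  rw [div_eq_mul_inv, div_eq_mul_inv]
  exact mul_mem hx (inv_mem_specialisation hy h)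

variable {X : Type*}

/-- The matrix `A` of fractions has the value `B` under an extension of `φ`. -/
def Specialises (φ : R →+* L) (A : Matrix X X K) (B : Matrix X X L) : Prop :=
  ∀ w v, (A w v, B w v) ∈ specialisation K φ

theorem Specialises.one [DecidableEq X] (φ : R →+* L) : Specialises φ (1 : Matrix X X K) 1 := fun w v => by
  rw [Matrix.one_apply, Matrix.one_apply]
  split_ifs
  exacts [one_mem _, zero_mem _]

theorem Specialises.add {φ : R →+* L} {A A' : Matrix X X K} {B B' : Matrix X X L}
    (h : Specialises φ A B) (h' : Specialises φ A' B') : Specialises φ (A + A') (B + B') :=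
  fun w v => add_mem (h w v) (h' w v)

theorem Specialises.sub {φ : R →+* L} {A A' : Matrix X X K} {B B' : Matrix X X L}
    (h : Specialises φ A B) (h' : Specialises φ A' B') : Specialises φ (A - A') (B - B') :=
  fun w v => sub_mem (h w v) (h' w v)

theorem Specialises.smul {φ : R →+* L} {A : Matrix X X K} {B : Matrix X X L} {f : K} {c : L}
    (hf : (f, c) ∈ specialisation K φ) (h : Specialises φ A B) :
    Specialises φ (f • A) (c • B) := fun w v => mul_mem hf (h w v)

theorem Specialises.mul [Fintype X] {φ : R →+* L} {A A' : Matrix X X K} {B B' : Matrix X X L}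
    (h : Specialises φ A B) (h' : Specialises φ A' B') : Specialises φ (A * A') (B * B') := by
  intro w v
  have : ((A * A') w v, (B * B') w v) = ∑ u, (A w u, B w u) * (A' u v, B' u v) := by
    refine Prod.ext ?_ ?_
    · simp [Matrix.mul_apply, Prod.fst_sum]
    · simp [Matrix.mul_apply, Prod.snd_sum]
  rw [this]
  exact sum_mem fun u _ => mul_mem (h w u) (h' u v)

theorem Specialises.list_prod [Fintype X] [DecidableEq X] {φ : R →+* L} {ι : Type*}
    {A : ι → Matrix X X K}
    {B : ι → Matrix X X L} (h : ∀ j, Specialises φ (A j) (B j)) (l : List ι) :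
    Specialises φ (l.map A).prod (l.map B).prod := by
  induction l with
  | nil => exact Specialises.one φ
  | cons j l ih => simpa using (h j).mul ih

/-- The matrix of pairs has entries in the subring `specialisation K φ`, so its determinant lies
there; the two projections of this determinant are `A.det` and `B.det`. -/
theorem Specialises.det_ne_zero [FaithfulSMul R K] [Fintype X] [DecidableEq X] {φ : R →+* L}
    {A : Matrix X X K} {B : Matrix X X L} (h : Specialises φ A B) (hB : B.det ≠ 0) : A.det ≠ 0 := by
  let C : Matrix X X (specialisation K φ) := Matrix.of fun w v => ⟨(A w v, B w v), h w v⟩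
  let ι := (specialisation K φ).subtype
  have h1 : ((RingHom.fst K L).comp ι) C.det = A.det := by
    rw [RingHom.map_det]; rfl
  have h2 : ((RingHom.snd K L).comp ι) C.det = B.det := by
    rw [RingHom.map_det]; rfl
  rw [← h1]
  refine fst_ne_zero_of_mem_specialisation C.det.2 ?_
  rw [← h2] at hB
  exact hB

theorem Specialises.augmented {N m : ℕ} {φ : R →+* L} {A : Matrix (Config N) (Config N) K}
    {B : Matrix (Config N) (Config N) L} (h : Specialises φ A B) :
    Specialises φ (augmented m A) (augmented m B) := by
  intro w v
  simp only [OpenTwoASEP.augmented, Matrix.of_apply]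
  split_ifs
  exacts [add_mem (h w v) (one_mem _), one_mem _, zero_mem _]

end Specialisation

/-! ### Specialisation of the scattering matrix -/

section ScatteringValue

variable {n : ℕ}

/-- The values `x, 1, …, 1` of the spectral parameters. -/
def firstValue (n : ℕ) (x : ℂ) (i : Fin (n + 1)) : ℂ := if i = 0 then x else 1

/-- The evaluation of Laurent polynomials at `x, 1, …, 1`. -/
def firstEval (n : ℕ) (x : ℂˣ) : Laurent (n + 1) →ₐ[ℂ] ℂ :=
  AddMonoidAlgebra.lift ℂ ℂ (Fin (n + 1) → ℤ)
    { toFun := fun e => ((x ^ (e.toAdd 0) : ℂˣ) : ℂ)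
      map_one' := by simp
      map_mul' := fun e f => by simp [_root_.zpow_add] }

theorem const_mem_specialisation {N : ℕ} (φ : Laurent N →ₐ[ℂ] ℂ) (c : ℂ) :
    (algebraMap ℂ (RatField N) c, c) ∈ specialisation (RatField N) φ.toRingHom := by
  have := algebraMap_mem_specialisation (K := RatField N) φ.toRingHom (algebraMap ℂ (Laurent N) c)
  rw [← IsScalarTower.algebraMap_apply] at this
  convert this using 2
  exact (φ.commutes c).symm

theorem zvar_mem_specialisation (x : ℂˣ) (i : Fin (n + 1)) :
    (zvar i, firstValue n x i) ∈ specialisation (RatField (n + 1)) (firstEval n x).toRingHom := by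
  have e : firstEval n x (AddMonoidAlgebra.single (Pi.single i 1) 1) = firstValue n x i := by
    rw [firstEval, AddMonoidAlgebra.lift_single]
    by_cases h : i = 0
    · subst h; simp [firstValue]
    · simp [firstValue, h, Ne.symm h]
  rw [← e]
  exact algebraMap_mem_specialisation _ _

theorem Specialises.const_mapMatrix {N : ℕ} (φ : Laurent N →ₐ[ℂ] ℂ)
    (A : Matrix (Config N) (Config N) ℂ) : Specialises φ.toRingHom
      ((algebraMap ℂ (RatField N)).mapMatrix A) A :=
  fun w v => const_mem_specialisation φ (A w v)

variable {φ : Laurent (n + 1) →ₐ[ℂ] ℂ} {f : RatField (n + 1)} {x : ℂ}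

theorem specialises_Rmat (p : Params ℂ) (j : Fin n)
    (hf : (f, x) ∈ specialisation (RatField (n + 1)) φ.toRingHom) (h : p.τ * x - p.τ⁻¹ ≠ 0) :
    Specialises φ.toRingHom (Rmat (p.const (n + 1)) j f) (Rmat p j x) := by
  rw [Rmat_eq, Rmat_eq, Params.const, Params.map, ← mapMatrix_bondHop]
  refine (Specialises.one _).add (Specialises.smul ?_ (Specialises.const_mapMatrix φ _))
  refine div_mem_specialisation (sub_mem hf (one_mem _)) ?_ h
  have hτ := const_mem_specialisation φ p.τ
  have hτ' := const_mem_specialisation φ p.τ⁻¹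
  rw [map_inv₀] at hτ'
  exact sub_mem (mul_mem hτ hf) hτ'

theorem specialises_K1mat {p : Params ℂ} (hp : p.Regular)
    (hf : (f, x) ∈ specialisation (RatField (n + 1)) φ.toRingHom)
    (h : (x - p.a) * (x - p.b) ≠ 0) :
    Specialises φ.toRingHom (K1mat (n := n) (p.const (n + 1)) f) (K1mat p x) := by
  have e : siteHop 1 (-((p.const (n + 1)).a * (p.const (n + 1)).b)) (0 : Fin (n + 1)) =
      (algebraMap ℂ (RatField (n + 1))).mapMatrix (siteHop 1 (-(p.a * p.b)) 0) := by
    rw [mapMatrix_siteHop]; simp [Params.const, Params.map]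
  rw [K1mat_eq hp, K1mat_eq (hp.const _), e]
  refine (Specialises.one _).add (Specialises.smul ?_ (Specialises.const_mapMatrix φ _))
  exact div_mem_specialisation (sub_mem (pow_mem hf 2) (one_mem _))
    (mul_mem (sub_mem hf (const_mem_specialisation φ p.a))
      (sub_mem hf (const_mem_specialisation φ p.b))) h

theorem specialises_KNmat {p : Params ℂ} (hp : p.Regular)
    (hf : (f, x) ∈ specialisation (RatField (n + 1)) φ.toRingHom)
    (h : (p.c * x - 1) * (p.d * x - 1) ≠ 0) :
    Specialises φ.toRingHom (KNmat (n := n) (p.const (n + 1)) f) (KNmat p x) := by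
  have e : siteHop (-((p.const (n + 1)).c * (p.const (n + 1)).d)) 1 (Fin.last n) =
      (algebraMap ℂ (RatField (n + 1))).mapMatrix
        (siteHop (-(p.c * p.d)) 1 (Fin.last n)) := by
    rw [mapMatrix_siteHop]; simp [Params.const, Params.map]
  rw [KNmat_eq hp, KNmat_eq (hp.const _), e]
  refine (Specialises.one _).add (Specialises.smul ?_ (Specialises.const_mapMatrix φ _))
  exact div_mem_specialisation (sub_mem (one_mem _) (pow_mem hf 2))
    (mul_mem (sub_mem (mul_mem (const_mem_specialisation φ p.c) hf) (one_mem _))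
      (sub_mem (mul_mem (const_mem_specialisation φ p.d) hf) (one_mem _))) h

/-- The first scattering matrix at the spectral parameters `x, 1, …, 1`. -/
def firstScattering (n : ℕ) (p : Params ℂ) (x : ℂ) : Matrix (Config (n + 1)) (Config (n + 1)) ℂ :=
  K1mat p x⁻¹ * ((List.finRange n).map fun j => Rmat p j x).prod * KNmat p x *
    ((List.finRange n).reverse.map fun j => Rmat p j x).prod

/-- The first site has no bonds to its left, and with the other parameters equal to `1` both `z_1
z_j` and `z_1 / z_j` take the value `x`. The three hypotheses keep all denominators nonzero at this
point. -/
theorem specialises_scattering {p : Params ℂ} (hp : p.Regular) (x : ℂˣ)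
    (h1 : p.τ * x - p.τ⁻¹ ≠ 0) (h2 : ((x : ℂ)⁻¹ - p.a) * ((x : ℂ)⁻¹ - p.b) ≠ 0)
    (h3 : (p.c * x - 1) * (p.d * x - 1) ≠ 0) :
    Specialises (firstEval n x).toRingHom (scattering (p.const (n + 1)) zvar 0)
      (firstScattering n p x) := by
  have h0 := zvar_mem_specialisation (n := n) x 0
  have hj : ∀ j : Fin n, _ := fun j => zvar_mem_specialisation (n := n) x j.succ
  simp only [firstValue, if_true, Fin.succ_ne_zero, if_false] at h0 hj
  have hmul : ∀ j : Fin n, (zvar 0 * zvar j.succ, (x : ℂ)) ∈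
      specialisation (RatField (n + 1)) (firstEval n x).toRingHom := fun j => by
    simpa using mul_mem h0 (hj j)
  have hdiv : ∀ j : Fin n, (zvar 0 / zvar j.succ, (x : ℂ)) ∈
      specialisation (RatField (n + 1)) (firstEval n x).toRingHom := fun j => by
    simpa using div_mem_specialisation h0 (hj j) one_ne_zero
  rw [scattering_eq, leftHalf_zero, rightHalf, rightBonds_zero, ← mul_assoc, ← mul_assoc]
  exact (((specialises_K1mat hp (inv_mem_specialisation h0 x.ne_zero) h2).mul
    (Specialises.list_prod (fun j => specialises_Rmat p j (hmul j) h1) _)).mul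
    (specialises_KNmat hp h0 h3)).mul
    (Specialises.list_prod (fun j => specialises_Rmat p j (hdiv j) h1) _)

end ScatteringValue

/-! ### First order expansion of the scattering matrix -/

section Expansion

variable {X : Type*} [DecidableEq X]

/-- The matrix `A x` is `1 + (x - 1) D + o(x - 1)` at `x = 1`. -/
def FirstOrder (A : ℂ → Matrix X X ℂ) (D : Matrix X X ℂ) : Prop :=
  ∃ H : ℂ → Matrix X X ℂ, ContinuousAt H 1 ∧ H 1 = D ∧ ∀ x ≠ 0, A x = 1 + (x - 1) • H x

theorem FirstOrder.one : FirstOrder (fun _ => (1 : Matrix X X ℂ)) 0 :=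
  ⟨fun _ => 0, continuousAt_const, rfl, fun x _ => by simp⟩

theorem FirstOrder.mul [Fintype X] {A B : ℂ → Matrix X X ℂ} {D E : Matrix X X ℂ} (hA : FirstOrder A D)
    (hB : FirstOrder B E) : FirstOrder (fun x => A x * B x) (D + E) := by
  obtain ⟨H, hH, rfl, h⟩ := hA
  obtain ⟨H', hH', rfl, h'⟩ := hB
  refine ⟨fun x => H x + H' x + (x - 1) • (H x * H' x), ?_, by simp, fun x hx => ?_⟩
  · exact (hH.add hH').add ((continuousAt_id.sub continuousAt_const).smul (hH.mul hH'))
  · simp only [h x hx, h' x hx, mul_add, add_mul, mul_one, one_mul, smul_mul_assoc,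
      mul_smul_comm, smul_add]
    abel

theorem FirstOrder.list_prod [Fintype X] {ι : Type*} {A : ι → ℂ → Matrix X X ℂ}
    {D : ι → Matrix X X ℂ} (h : ∀ j, FirstOrder (A j) (D j)) (l : List ι) :
    FirstOrder (fun x => (l.map fun j => A j x).prod) (l.map D).sum := by
  induction l with
  | nil => exact FirstOrder.one
  | cons j l ih => simpa using (h j).mul ih

theorem FirstOrder.one_add_smul {g h : ℂ → ℂ} (hh : ContinuousAt h 1)
    (hg : ∀ x ≠ 0, g x = (x - 1) * h x) {c : ℂ} (hc : h 1 = c) (A : Matrix X X ℂ) :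
    FirstOrder (fun x => 1 + g x • A) (c • A) :=
  ⟨fun x => h x • A, hh.smul continuousAt_const, by simp only [hc],
    fun x hx => by simp only [hg x hx, smul_smul]⟩

variable {n : ℕ} {p : Params ℂ}

theorem firstOrder_Rmat (hp : p.Regular) (j : Fin n) :
    FirstOrder (fun x => Rmat p j x)
      ((p.τ - p.τ⁻¹)⁻¹ • bondHop p.τ j.castSucc j.succ) := by
  simp only [Rmat_eq]
  have h0 : p.τ * 1 - p.τ⁻¹ ≠ 0 := fun h => hp.inv_sub_ne (by linear_combination -h)
  refine FirstOrder.one_add_smul (h := fun x => (p.τ * x - p.τ⁻¹)⁻¹) ?_ (fun x _ => rfl) ?_ _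
  · exact ContinuousAt.inv₀ (by fun_prop) h0
  · simp

/-- The factor `2` comes from the numerator `x⁻² - 1`, which has derivative `-2` at `x = 1`; the
rest of the weight times `γ⁻¹` equals `-(τ - τ⁻¹)⁻¹` there. -/
theorem firstOrder_K1mat (hp : p.Regular) :
    FirstOrder (fun x => K1mat p x⁻¹)
      ((2 * (p.τ - p.τ⁻¹)⁻¹) • siteHop p.γ p.α (0 : Fin (n + 1))) := by
  simp only [K1mat, atSite_boundaryLocal]
  have h0 := hp.inv_sub_ne
  have h0' : p.τ - p.τ⁻¹ ≠ 0 := fun h => h0 (by linear_combination -h)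
  have ha := sub_ne_zero.mpr hp.a_ne
  have hb := sub_ne_zero.mpr hp.b_ne
  have ha' := sub_ne_zero.mpr hp.a_ne.symm
  have hb' := sub_ne_zero.mpr hp.b_ne.symm
  refine FirstOrder.one_add_smul
    (h := fun x => -(x⁻¹ + 1) * x⁻¹ / ((x⁻¹ - p.a) * (x⁻¹ - p.b)) * p.γ⁻¹) ?_ (fun x hx => ?_) ?_ _
  · have hi : ContinuousAt (fun x : ℂ => x⁻¹) 1 := continuousAt_inv₀ one_ne_zero
    refine ContinuousAt.mul (ContinuousAt.div ?_ ?_ ?_) continuousAt_const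
    · exact (hi.add continuousAt_const).neg.mul hi
    · exact (hi.sub continuousAt_const).mul (hi.sub continuousAt_const)
    · rw [inv_one]; exact mul_ne_zero ha' hb'
  · have : (x⁻¹) ^ 2 - 1 = (x - 1) * (-(x⁻¹ + 1) * x⁻¹) := by field_simp; ring
    rw [this]; ring
  · have e : p.γ⁻¹ = (p.a - 1) * (p.b - 1) * (-(p.τ - p.τ⁻¹)⁻¹) := by
      rw [Params.γ, inv_div, div_eq_mul_inv, ← inv_neg, neg_sub]
    simp only [e, inv_one]
    field_simp
    ring

theorem firstOrder_KNmat (hp : p.Regular) :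
    FirstOrder (fun x => KNmat p x)
      ((2 * (p.τ - p.τ⁻¹)⁻¹) • siteHop p.β p.δ (Fin.last n)) := by
  simp only [KNmat, atSite_boundaryLocal]
  have h0 := hp.inv_sub_ne
  have h0' : p.τ - p.τ⁻¹ ≠ 0 := fun h => h0 (by linear_combination -h)
  have ha := sub_ne_zero.mpr hp.c_ne
  have hb := sub_ne_zero.mpr hp.d_ne
  refine FirstOrder.one_add_smul
    (h := fun x => -(x + 1) / ((p.c * x - 1) * (p.d * x - 1)) * p.δ⁻¹) ?_ (fun x hx => ?_) ?_ _
  · refine ContinuousAt.mul (ContinuousAt.div (by fun_prop) (by fun_prop) ?_) continuousAt_const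
    rw [mul_one, mul_one]; exact mul_ne_zero ha hb
  · have : 1 - x ^ 2 = (x - 1) * (-(x + 1)) := by ring
    rw [this]; ring
  · have e : p.δ⁻¹ = (p.c - 1) * (p.d - 1) * (-(p.τ - p.τ⁻¹)⁻¹) := by
      rw [Params.δ, inv_div, div_eq_mul_inv, ← inv_neg, neg_sub]
    simp only [e, mul_one]
    field_simp
    ring

/-- Every `Ř_j` occurs twice with derivative `(τ - τ⁻¹)⁻¹ e_j`, and each boundary matrix once with
twice that factor. The contributions add up to one common multiple of the generator. -/
theorem firstOrder_firstScattering (hp : p.Regular) :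
    FirstOrder (firstScattering n p) ((2 * (p.τ - p.τ⁻¹)⁻¹) • generator n p) := by
  have hR := FirstOrder.list_prod (fun j : Fin n => firstOrder_Rmat hp j)
  have h := (((firstOrder_K1mat hp).mul (hR (List.finRange n))).mul
    (firstOrder_KNmat (n := n) hp)).mul (hR (List.finRange n).reverse)
  convert h using 1
  · rfl
  have hs : ((List.finRange n).map fun j : Fin n =>
      (p.τ - p.τ⁻¹)⁻¹ • bondHop p.τ j.castSucc j.succ).sum =
      (p.τ - p.τ⁻¹)⁻¹ • ∑ j : Fin n, bondHop p.τ j.castSucc j.succ := by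
    rw [Finset.smul_sum, Fin.sum_univ_def]
  rw [List.map_reverse, List.sum_reverse, hs, generator, smul_add, smul_add]
  simp only [two_mul, add_smul]
  abel

end Expansion

/-! ### Uniqueness of the solution -/

section Uniqueness

variable {n m : ℕ} {p : Params ℂ}

theorem exists_specialisation (hm : m ≤ n + 1) (hp : p.Regular) (hpos : p.PositiveRates) :
    ∃ (x : ℂˣ) (c : ℂ), p.τ * x - p.τ⁻¹ ≠ 0 ∧ ((x : ℂ)⁻¹ - p.a) * ((x : ℂ)⁻¹ - p.b) ≠ 0 ∧
      (p.c * x - 1) * (p.d * x - 1) ≠ 0 ∧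
      (augmented m (c • (firstScattering n p x - 1))).det ≠ 0 := by
  obtain ⟨H, hH, hH1, hS⟩ := firstOrder_firstScattering (n := n) hp
  set q := 2 * (p.τ - p.τ⁻¹)⁻¹
  have hq : q ≠ 0 := mul_ne_zero two_ne_zero (inv_ne_zero fun h =>
    hp.inv_sub_ne (by linear_combination -h))
  have hdet : ContinuousAt (fun x => (augmented m (q⁻¹ • H x)).det) 1 := by
    have h1 : Continuous fun A : Matrix (Config (n + 1)) (Config (n + 1)) ℂ =>
        (augmented m (q⁻¹ • A)).det := by
      refine Continuous.matrix_det (continuous_matrix fun w v => ?_)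
      simp only [augmented, Matrix.of_apply]
      split_ifs
      · exact (((continuous_apply_apply w v).const_smul q⁻¹)).add continuous_const
      · exact continuous_const
      · exact continuous_const
    exact h1.continuousAt.comp hH
  have hi : ContinuousAt (fun x : ℂ => x⁻¹) 1 := continuousAt_inv₀ one_ne_zero
  have e1 := hdet.eventually_ne (y := 0) (by
    rw [hH1, smul_smul, inv_mul_cancel₀ hq, one_smul]
    exact det_augmented_generator_ne_zero hm hpos)
  have e2 : ∀ᶠ x : ℂ in nhds 1, p.τ * x - p.τ⁻¹ ≠ 0 :=
    ContinuousAt.eventually_ne (by fun_prop)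
      (fun h => hp.inv_sub_ne (by linear_combination -h))
  have e3 : ∀ᶠ x : ℂ in nhds 1, (x⁻¹ - p.a) * (x⁻¹ - p.b) ≠ 0 :=
    ContinuousAt.eventually_ne ((hi.sub continuousAt_const).mul (hi.sub continuousAt_const)) (by
      rw [inv_one]
      exact mul_ne_zero (sub_ne_zero.mpr hp.a_ne.symm) (sub_ne_zero.mpr hp.b_ne.symm))
  have e4 : ∀ᶠ x : ℂ in nhds 1, (p.c * x - 1) * (p.d * x - 1) ≠ 0 :=
    ContinuousAt.eventually_ne (by fun_prop) (by
      rw [mul_one, mul_one]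
      exact mul_ne_zero (sub_ne_zero.mpr hp.c_ne) (sub_ne_zero.mpr hp.d_ne))
  have e5 : ∀ᶠ x : ℂ in nhds 1, x ≠ 0 := continuousAt_id.eventually_ne one_ne_zero
  -- The point is taken in a punctured neighbourhood of `1`, because `x ≠ 1` is needed to recover `H
  -- x` from the scattering matrix.
  obtain ⟨x, ⟨h1, h2, h3, h4, h5⟩, hx1⟩ := (((e1.and (e2.and (e3.and (e4.and e5)))).filter_mono
    (nhdsWithin_le_nhds (s := {1}ᶜ))).and self_mem_nhdsWithin).exists
  -- With this constant, `c • (firstScattering n p x - 1)` is `q⁻¹ • H x`, which tends to the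
  -- generator as `x` tends to `1`.
  refine ⟨Units.mk0 x h5, q⁻¹ * (x - 1)⁻¹, h2, h3, h4, ?_⟩
  rw [Units.val_mk0, hS x h5, add_sub_cancel_left, smul_smul, mul_assoc,
    inv_mul_cancel₀ (sub_ne_zero.mpr hx1), mul_one]
  exact h1

/-- Invariance under the first scattering matrix alone suffices: the augmented matrix of `c • (S_1 -
1)` kills `ψ`, and its determinant is nonzero because it is nonzero after specialisation. -/
theorem eq_zero_of_total_eq_zero (hm : m ≤ n + 1) (hp : p.Regular) (hpos : p.PositiveRates)
    {ψ : Config (n + 1) → RatField (n + 1)} (hψ : InSector m ψ) (hS : IsScatteringInvariant p ψ)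
    (h0 : total _ (n + 1) ψ = 0) : ψ = 0 := by
  obtain ⟨x, c, h1, h2, h3, hdet⟩ := exists_specialisation hm hp hpos
  have hspec := (Specialises.smul (const_mem_specialisation (firstEval n x) c)
    ((specialises_scattering hp x h1 h2 h3).sub (Specialises.one _))).augmented (m := m)
  by_contra hne
  refine hspec.det_ne_zero hdet (Matrix.exists_mulVec_eq_zero_iff.mp ⟨ψ, hne, ?_⟩)
  refine augmented_mulVec_eq_zero hψ ?_ h0
  rw [Matrix.smul_mulVec, Matrix.sub_mulVec, hS 0, Matrix.one_mulVec, sub_self, smul_zero]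

/-- An invariant vector of the sector is determined by its total, so the ratio of the totals is the
required factor. -/
theorem exists_eq_smul (hm : m ≤ n + 1) (hp : p.Regular) (hpos : p.PositiveRates)
    {Ψ Φ : Config (n + 1) → RatField (n + 1)} (hΨ : Ψ ∈ invariants n m p) (hΨ0 : Ψ ≠ 0)
    (hΦ : Φ ∈ invariants n m p) : ∃ r : RatField (n + 1), Φ = r • Ψ := by
  have ht : total _ (n + 1) Ψ ≠ 0 := fun h =>
    hΨ0 (eq_zero_of_total_eq_zero hm hp hpos hΨ.1 hΨ.2 h)
  refine ⟨total _ (n + 1) Φ / total _ (n + 1) Ψ, sub_eq_zero.mp ?_⟩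
  have h := (invariants n m p).sub_mem hΦ
    ((invariants n m p).smul_mem (total _ (n + 1) Φ / total _ (n + 1) Ψ) hΨ)
  refine eq_zero_of_total_eq_zero hm hp hpos h.1 h.2 ?_
  rw [map_sub, map_smul, smul_eq_mul, div_mul_cancel₀ _ ht, sub_self]

end Uniqueness

end

end OpenTwoASEP

theorem mainTheorem3 (n m : ℕ) (hm : m ≤ n + 1) (p : OpenTwoASEP.Params ℂ)
    (hτ : p.τ ≠ 0) (ht : p.τ ^ 2 ≠ 1)
    (ha : p.a ≠ 1) (hb : p.b ≠ 1) (hc : p.c ≠ 1) (hd : p.d ≠ 1) :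
    ∃ Ψ : OpenTwoASEP.Config (n + 1) → OpenTwoASEP.Laurent (n + 1),
      Ψ ≠ 0 ∧
      OpenTwoASEP.InSector m Ψ ∧
      OpenTwoASEP.IsScatteringInvariant p (OpenTwoASEP.toRat Ψ) ∧
      (p.PositiveRates →
        ∀ Φ : OpenTwoASEP.Config (n + 1) → OpenTwoASEP.RatField (n + 1),
          OpenTwoASEP.InSector m Φ → OpenTwoASEP.IsScatteringInvariant p Φ →
            ∃ r : OpenTwoASEP.RatField (n + 1), Φ = r • OpenTwoASEP.toRat Ψ) ∧
      OpenTwoASEP.ExchangeReflection p Ψ := by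
  have hp : p.Regular := ⟨hτ, ht, ha, hb, hc, hd⟩
  obtain ⟨Ψ, hΨ0, hΨ, hfix⟩ := OpenTwoASEP.exists_laurent_fixed hm hp
  have hS := OpenTwoASEP.isScatteringInvariant_of_gen_fixed hp hfix
  have hinj := IsFractionRing.injective (OpenTwoASEP.Laurent (n + 1))
    (OpenTwoASEP.RatField (n + 1))
  have hrat : OpenTwoASEP.InSector m (OpenTwoASEP.toRat Ψ) := fun w hw =>
    (congrArg _ (hΨ w hw)).trans (map_zero _)
  have hrat0 : OpenTwoASEP.toRat Ψ ≠ 0 := fun h =>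
    hΨ0 (funext fun w => hinj ((congrFun h w).trans (map_zero _).symm))
  exact ⟨Ψ, hΨ0, hΨ, hS, fun hpos Φ hΦ hΦS =>
    OpenTwoASEP.exists_eq_smul hm hp hpos ⟨hrat, hS⟩ hrat0 ⟨hΦ, hΦS⟩,
    OpenTwoASEP.exchangeReflection_of_gen_fixed hp hfix⟩
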